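/- Let $f:\mathbb R^2\to\mathbb R$ be smooth, $2\pi$-periodic in $y$ and zero for $|x|>R$ ($R>0$), and let $0<\beta<\tfrac12$. For $\varepsilon>0$ and $0<\mu<\sqrt{1-2\beta}$ put $\omega^2=(1-\beta)^2-\mu^2$, $\gamma=\omega^2/4\pi$, $k_0=\sqrt{1-2\beta-\mu^2}$, $k_m=\sqrt{(\beta+m)^2-\omega^2}$ for $m\ne 0,-1$, $k_{-1}=\mu$, $f_j(x)=\int_0^{2\pi}e^{-ijy}f(x,y)\,dy$, $\tilde f_j(\xi)=\int_{\mathbb R} e^{-i\xi x}f_j(x)\,dx$, and $$G_0(x)=\frac{i}{2k_0}e^{ik_0|x|},\qquad G_m(x)=\frac1{2k_m}e^{-k_m|x|}\ (m\ne0),\qquad H_n=G_n\ (n\neq-1),\qquad H_{-1}(x)=\frac1{2\mu}\left(e^{-\mu|x|}-1\right).$$ Let $\mathcal A$ be the Banach space of sequences $\mathbf A=(A_j)_{j\in\mathbb Z}$ in $C([-R,R],\mathbb C)$ with $\|\mathbf A\|^2=\sum_j\sup|A_j|^2<\infty$ (each $A_j$ being extended by $0$ to $\mathbb R$ in integrals),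 and let $\hat T:\mathcal A\to\mathcal A$ be the bounded operator $(\hat T\mathbf A)_m=2\gamma\sum_{n}(H_n*A_n)f_{m-n}$. Let $(\mathbf g^{(1)})_m=e^{ik_0x}f_m$, $(\mathbf g^{(2)})_m=f_{m+1}$ and $\langle h\rangle=\int_{\mathbb R} h\,dx$. When $1-\varepsilon\hat T$ is invertible on $\mathcal A$, put $\mathbf Y^{(i)}=(1-\varepsilon\hat T)^{-1}\mathbf g^{(i)}$, $$F=\langle Y^{(2)}_{-1}\rangle,\quad Q=\langle Y^{(1)}_{-1}\rangle,\quad P^\pm=\langle Y^{(1)}_0e^{\pm ik_0x}\rangle,\quad R^\pm=\langle Y^{(2)}_0e^{\pm ik_0x}\rangle,$$ and, when $\mu-\varepsilon\gamma F\ne0$, also $$C=\frac{2\varepsilon\mu\gamma Q}{\mu-\varepsilon\gamma F},\quad \mathbf g=\mathbf g^{(1)}+\frac{C}{2\mu}\mathbf g^{(2)},\quad \mathbf A=2\varepsilon\gamma(1-\varepsilon\hat T)^{-1}\mathbf g,$$ $$\Psi_0=e^{ik_0x}+G_0*A_0,\quad \Psi_m=G_m*A_m\ (m\neq0),\quad \Psi(x,y)=e^{i\beta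 y}\sum_{n\in\mathbb Z}\Psi_n(x)e^{iny},$$ $$\mathcal R=\frac{i\varepsilon\gamma}{k_0}\,\frac{(\mu-\varepsilon\gamma F)P^++\varepsilon\gamma QR^+}{\mu-\varepsilon\gamma F},\qquad \mathcal T=1+\frac{i\varepsilon\gamma}{k_0}\,\frac{(\mu-\varepsilon\gamma F)P^-+\varepsilon\gamma QR^-}{\mu-\varepsilon\gamma F}.$$ The scattering problem. Let $\Pi=\mathbb R\times(0,2\pi)$, and consider the conditions $$(\mathrm{BC})\qquad u(x,2\pi)=e^{2\pi i\beta}u(x,0),\quad u_y(x,2\pi)=e^{2\pi i\beta}u_y(x,0).$$ Let $H_1^\beta(\Pi)$ be the completion, in the norm $\|u\|_{L^2(\Pi)}+\|\nabla u\|_{L^2(\Pi)}$, of the smooth functions that satisfy (BC) and vanish for large $|x|$. Let $\chi$ be a smooth cut-off function with $\chi=0$ for $x\le0$ and $\chi=1$ for $x\ge1$. A triple $(u,r,t)$ of a function $u$ on $\Pi$ and numbers $r,t\in\mathbb C$ solves the scattering problem for a plane wave incident from the left if $$u-\chi(x)\,t\,e^{i\beta y+ik_0x}-\chi(-x)\left(e^{i\beta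 y+ik_0x}+r\,e^{i\beta y-ik_0x}\right)\in H_1^\beta(\Pi)$$ and $\int_\Pi\nabla u\cdot\nabla\overline\Phi\,dx\,dy=\omega^2\int_\Pi(1+\varepsilon f)\,u\,\overline\Phi\,dx\,dy$ for all smooth $\Phi$ that satisfy (BC) and vanish for large $|x|$. **Theorem.** 1. Let $\varepsilon>0$ and $0<\mu<\sqrt{1-2\beta}$, let $1-\varepsilon\hat T$ be invertible, and let $\mu-\varepsilon\gamma F\neq0$. Then the series for $\Psi$ converges absolutely at every point of the plane, $\Psi\in C^2$ satisfies $-\Delta\Psi=\omega^2(1+\varepsilon f)\Psi$ and (BC), and $(\Psi,\mathcal R,\mathcal T)$ solves the scattering problem. 2. There are $\varepsilon_0>0$ and $0<\mu_0\le\sqrt{1-2\beta}$, depending only on $f$ and $\beta$, such that for all $0<\varepsilon<\varepsilon_0$ and $0<\mu<\mu_0$ the operator $1-\varepsilon\hat T$ is invertible, and such that, with $\kappa=\sqrt{1-2\beta}$, if $\tilde f_1(\kappa)\ne0$ or $\tilde f_1(-\kappa)\neq0$, then $\mu-\varepsilon\gamma F\ne0$ for all these $\varepsilon,\mu$, and $(\Psi,\mathcal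 R,\mathcal T)$ is the unique solution of the scattering problem ($\Psi$ being unique up to equality almost everywhere on $\Pi$). -/

import Mathlib

open Real Set Filter Topology MeasureTheory
open scoped ContDiff ENNReal ComplexConjugate

noncomputable section

namespace Scatter

/-- A real smooth function `f(x, y)`, `2π`-periodic in `y` and vanishing for `|x| > R`. -/
structure Perturbation where
  f : ℝ × ℝ → ℝ
  R : ℝ
  R_pos : 0 < R
  smooth : ContDiff ℝ ∞ f
  periodic : ∀ x y, f (x, y + 2 * π) = f (x, y)
  vanish : ∀ x y, R < |x| → f (x, y) = 0

variable (p : Perturbation)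

/-- `f_j(x) = ∫₀^{2π} e^{-ijy} f(x, y) dy`. -/
def Perturbation.coeff (j : ℤ) (x : ℝ) : ℂ :=
  ∫ y in (0 : ℝ)..(2 * π), Complex.exp (-(Complex.I * j * y)) * (p.f (x, y) : ℂ)

/-- The Fourier transform `∫ e^{-iξx} f_j(x) dx` of `f_j`. -/
def Perturbation.coeffHat (j : ℤ) (ξ : ℝ) : ℂ :=
  ∫ x : ℝ, Complex.exp (-(Complex.I * ξ * x)) * p.coeff j x

/-- `ω² = (1 - β)² - μ²`. -/
def omegaSq (β μ : ℝ) : ℝ := (1 - β) ^ 2 - μ ^ 2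

/-- `γ = ω² / (4π)`. -/
def gam (β μ : ℝ) : ℝ := omegaSq β μ / (4 * π)

/-- `k₀ = (1 - 2β - μ²)^{1/2} = (ω² - β²)^{1/2}`. -/
def kZero (β μ : ℝ) : ℝ := √(1 - 2 * β - μ ^ 2)

/-- `k_m = ((β + m)² - ω²)^{1/2}`, used for `m ≠ 0, -1`. -/
def kExp (β μ : ℝ) (m : ℤ) : ℝ := √((β + m) ^ 2 - omegaSq β μ)

/-- The Green functions `G_m` (outgoing for `m = 0`, exponentially decaying otherwise). -/
def green (β μ : ℝ) (m : ℤ) (x : ℝ) : ℂ :=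
  if m = 0 then
    Complex.I / (2 * (kZero β μ : ℂ)) * Complex.exp (Complex.I * kZero β μ * (|x| : ℝ))
  else if m = -1 then ((1 / (2 * μ) * Real.exp (-(μ * |x|)) : ℝ) : ℂ)
  else ((1 / (2 * kExp β μ m) * Real.exp (-(kExp β μ m * |x|)) : ℝ) : ℂ)

/-- The kernels `H_n`: `G_n` for `n ≠ -1` and the regularized `G_r = G_{-1} - 1/(2μ)`
for `n = -1`. -/
def kernelH (β μ : ℝ) (n : ℤ) (x : ℝ) : ℂ :=
  if n = -1 then ((1 / (2 * μ) * (Real.exp (-(μ * |x|)) - 1) : ℝ) : ℂ) else green β μ n x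

/-- `C[-R, R]`. -/
abbrev Comp : Type := C(Icc (-p.R) p.R, ℂ)

/-- The Banach space `𝒜` of sequences `(A_j)`, `j ∈ ℤ`, in `C[-R, R]` with
`∑ⱼ (sup |A_j|)² < ∞`. -/
abbrev Space : Type := lp (fun _ : ℤ => Comp p) 2

variable {p}

/-- Extension of an element of `C[-R, R]` by zero to the real line. -/
def zeroExt (a : Comp p) (x : ℝ) : ℂ := if h : x ∈ Icc (-p.R) p.R then a ⟨x, h⟩ else 0

/-- The convolution `(h * a)(x)` on the real line. -/
def conv (h : ℝ → ℂ) (a : Comp p) (x : ℝ) : ℂ := ∫ ξ : ℝ, h (x - ξ) * zeroExt a ξ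

/-- `⟨a⟩ = ∫ a(x) dx`. -/
def avg (a : Comp p) : ℂ := ∫ x : ℝ, zeroExt a x

/-- `⟨a e^{ikx}⟩ = ∫ a(x) e^{ikx} dx`. -/
def avgExp (k : ℝ) (a : Comp p) : ℂ := ∫ x : ℝ, zeroExt a x * Complex.exp (Complex.I * k * x)

lemma conv_eq (h : ℝ → ℂ) (a : Comp p) (x : ℝ) :
    conv h a x = ∫ ξ in (-p.R)..p.R,
      h (x - ξ) * IccExtend (by linarith [p.R_pos] : -p.R ≤ p.R) a ξ := by
  have hR : -p.R ≤ p.R := by linarith [p.R_pos]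
  rw [conv, intervalIntegral.integral_of_le hR, ← integral_Icc_eq_integral_Ioc,
    ← integral_indicator measurableSet_Icc]
  congr 1
  funext ξ
  by_cases hx : ξ ∈ Icc (-p.R) p.R
  · rw [indicator_of_mem hx, IccExtend_of_mem _ _ hx, zeroExt, dif_pos hx]
  · rw [indicator_of_notMem hx, zeroExt, dif_neg hx, mul_zero]

lemma continuous_conv {h : ℝ → ℂ} (hh : Continuous h) (a : Comp p) : Continuous (conv h a) := by
  have hR : -p.R ≤ p.R := by linarith [p.R_pos]
  have ha : Continuous (IccExtend hR a) := a.continuous.Icc_extend'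
  rw [show conv h a = fun x => _ from funext (conv_eq h a)]
  apply intervalIntegral.continuous_parametric_intervalIntegral_of_continuous'
  exact (hh.comp (continuous_fst.sub continuous_snd)).mul (ha.comp continuous_snd)

lemma continuous_green (β μ : ℝ) (m : ℤ) : Continuous (green β μ m) := by
  unfold green
  split_ifs <;> fun_prop

lemma continuous_kernelH (β μ : ℝ) (m : ℤ) : Continuous (kernelH β μ m) := by
  unfold kernelH
  split_ifs
  · fun_prop
  · exact continuous_green β μ m

/-- `H_n * a` as an element of `C[-R, R]`. -/
def convH (β μ : ℝ) (n : ℤ) (a : Comp p) : Comp p :=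
  ⟨fun x => conv (kernelH β μ n) a x,
    (continuous_conv (continuous_kernelH β μ n) a).comp continuous_subtype_val⟩

lemma continuous_coeff (p : Perturbation) (j : ℤ) : Continuous (p.coeff j) := by
  have := p.smooth.continuous
  unfold Perturbation.coeff
  apply intervalIntegral.continuous_parametric_intervalIntegral_of_continuous'
  simp only [Function.uncurry_def]
  fun_prop

/-- `f_j` as an element of `C[-R, R]`. -/
def coeffC (p : Perturbation) (j : ℤ) : Comp p :=
  ⟨fun x => p.coeff j x, (continuous_coeff p j).comp continuous_subtype_val⟩

lemma convH_add (β μ : ℝ) (n : ℤ) (a b : Comp p) :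
    convH β μ n (a + b) = convH β μ n a + convH β μ n b := by
  have hR : -p.R ≤ p.R := by linarith [p.R_pos]
  ext x
  have e : ∀ c : Comp p, IntervalIntegrable
      (fun ξ => kernelH β μ n (x - ξ) * IccExtend hR c ξ) volume (-p.R) p.R := fun c =>
    Continuous.intervalIntegrable (((continuous_kernelH β μ n).comp
      (continuous_const.sub continuous_id)).mul c.continuous.Icc_extend') _ _
  simp only [convH, ContinuousMap.coe_mk, ContinuousMap.add_apply, conv_eq]
  rw [← intervalIntegral.integral_add (e a) (e b)]
  congr 1
  funext ξ
  simp [IccExtend, mul_add]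

lemma convH_smul (β μ : ℝ) (n : ℤ) (c : ℂ) (a : Comp p) :
    convH β μ n (c • a) = c • convH β μ n a := by
  ext x
  simp only [convH, ContinuousMap.coe_mk, ContinuousMap.smul_apply, conv_eq, smul_eq_mul]
  rw [← intervalIntegral.integral_const_mul]
  congr 1
  funext ξ
  simp [IccExtend]
  ring

lemma norm_convH_le (β μ : ℝ) (n : ℤ) (a : Comp p) {M : ℝ} (hM0 : 0 ≤ M)
    (hM : ∀ x ∈ Icc (-(2 * p.R)) (2 * p.R), ‖kernelH β μ n x‖ ≤ M) :
    ‖convH β μ n a‖ ≤ M * (2 * p.R) * ‖a‖ := by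
  have hR := p.R_pos
  rw [ContinuousMap.norm_le _ (by positivity)]
  intro x
  simp only [convH, ContinuousMap.coe_mk, conv_eq]
  have := intervalIntegral.norm_integral_le_of_norm_le_const (a := -p.R) (b := p.R)
    (C := M * ‖a‖) (f := fun ξ => kernelH β μ n (x - ξ) *
      IccExtend (by linarith [p.R_pos] : -p.R ≤ p.R) a ξ) ?_
  · refine this.trans (le_of_eq ?_)
    rw [abs_of_pos (by linarith)]
    ring
  · intro ξ hξ
    rw [uIoc_of_le (by linarith)] at hξ
    rw [norm_mul]
    refine mul_le_mul (hM _ ?_) (a.norm_coe_le_norm _) (norm_nonneg _) hM0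
    have := x.2
    constructor <;> linarith [this.1, this.2, hξ.1, hξ.2]

lemma exists_kernelH_bound (β μ r : ℝ) :
    ∃ M, 0 ≤ M ∧ ∀ n, ∀ x ∈ Icc (-r) r, ‖kernelH β μ n x‖ ≤ M := by
  have hc : ∀ n, ∃ M, ∀ x ∈ Icc (-r) r, ‖kernelH β μ n x‖ ≤ M := fun n =>
    isCompact_Icc.exists_bound_of_continuousOn (continuous_kernelH β μ n).continuousOn
  choose M hM using hc
  obtain ⟨N, hN⟩ := exists_nat_gt (|β| + |1 - β| + 2)
  let B : ℝ := ∑ n ∈ Finset.Icc (-(N : ℤ)) N, |M n|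
  have hB : 0 ≤ B := Finset.sum_nonneg fun _ _ => abs_nonneg _
  refine ⟨B + 1, by linarith, fun n x hx => ?_⟩
  by_cases hn : n ∈ Finset.Icc (-(N : ℤ)) N
  · have h1 : |M n| ≤ B := Finset.single_le_sum (f := fun n => |M n|)
      (fun _ _ => abs_nonneg _) hn
    linarith [hM n x hx, le_abs_self (M n)]
  · have hn' : (N : ℝ) < |(n : ℝ)| := by
      have : (N : ℤ) < |n| := by
        by_contra h
        exact hn (Finset.mem_Icc.2 (abs_le.1 (not_lt.1 h)))
      exact_mod_cast this
    have hNp : (2 : ℝ) < N := by linarith [abs_nonneg β, abs_nonneg (1 - β)]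
    have n0 : n ≠ 0 := by
      rintro rfl
      simp at hn'
      linarith
    have n1 : n ≠ -1 := by
      rintro rfl
      norm_num at hn'
      subst hn'
      norm_num at hNp
    have hk : 1 ≤ kExp β μ n := by
      rw [kExp, Real.one_le_sqrt, omegaSq]
      have h1 : |1 - β| + 2 ≤ |β + n| := by
        have := abs_sub_abs_le_abs_sub (n : ℝ) (-β)
        rw [abs_neg, sub_neg_eq_add, add_comm (n : ℝ)] at this
        linarith
      have h2 : (|1 - β| + 2) ^ 2 ≤ |β + n| ^ 2 := pow_le_pow_left₀ (by positivity) h1 2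
      rw [sq_abs] at h2
      nlinarith [sq_abs (1 - β), abs_nonneg (1 - β), sq_nonneg μ]
    simp only [kernelH, green, n0, n1, if_false]
    rw [Complex.norm_real, norm_mul, Real.norm_eq_abs, Real.norm_eq_abs, Real.abs_exp,
      abs_of_nonneg (by positivity)]
    have e1 : Real.exp (-(kExp β μ n * |x|)) ≤ 1 := by
      rw [Real.exp_le_one_iff]
      have := abs_nonneg x
      nlinarith
    have e2 : 1 / (2 * kExp β μ n) ≤ 1 := by
      rw [div_le_one (by linarith)]
      linarith
    calc _ ≤ (1 : ℝ) * 1 := mul_le_mul e2 e1 (Real.exp_pos _).le zero_le_one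
      _ ≤ B + 1 := by linarith

lemma coeff_by_parts {g g' : ℝ → ℂ} (hg : ∀ y, HasDerivAt g (g' y) y) (hc : Continuous g')
    (h2 : g (2 * π) = g 0) {m : ℤ} (hm : m ≠ 0) :
    ∫ y in (0 : ℝ)..(2 * π), Complex.exp (-(Complex.I * m * y)) * g y =
      (Complex.I * m)⁻¹ *
        ∫ y in (0 : ℝ)..(2 * π), Complex.exp (-(Complex.I * m * y)) * g' y := by
  have hm' : (Complex.I * m : ℂ) ≠ 0 := mul_ne_zero Complex.I_ne_zero (by exact_mod_cast hm)
  set c : ℂ := Complex.I * m with hcdef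
  have hu : ∀ y : ℝ, HasDerivAt (fun y : ℝ => -c⁻¹ * Complex.exp (-(c * y)))
      (Complex.exp (-(c * y))) y := by
    intro y
    have h1 : HasDerivAt (fun y : ℝ => -(c * (y : ℂ))) (-(c * 1)) y :=
      ((Complex.ofRealCLM.hasDerivAt (x := y)).const_mul c).neg
    have h3 := (h1.cexp).const_mul (-c⁻¹)
    refine h3.congr_deriv ?_
    generalize Complex.exp (-(c * (y : ℂ))) = w
    field_simp
  have key := intervalIntegral.integral_mul_deriv_eq_deriv_mul (a := (0 : ℝ)) (b := 2 * π)
    (u := fun y : ℝ => -c⁻¹ * Complex.exp (-(c * y)))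
    (u' := fun y : ℝ => Complex.exp (-(c * y))) (v := g) (v' := g')
    (fun y _ => hu y) (fun y _ => hg y)
    (Continuous.intervalIntegrable (by fun_prop) _ _) (hc.intervalIntegrable _ _)
  have he : Complex.exp (-(c * ((2 * π : ℝ) : ℂ))) = 1 := by
    rw [Complex.exp_eq_one_iff]
    refine ⟨-m, ?_⟩
    rw [hcdef]
    push_cast
    ring
  have h0 : Complex.exp (-(c * ((0 : ℝ) : ℂ))) = 1 := by simp
  rw [he, h0, h2] at key
  simp only [mul_assoc] at key
  rw [intervalIntegral.integral_const_mul] at key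
  linear_combination key

lemma exists_coeff_bound (p : Perturbation) :
    ∃ K, ∀ m : ℤ, m ≠ 0 → ‖coeffC p m‖ ≤ K * (1 / (m : ℝ) ^ 2) := by
  have hs := p.smooth
  let d1 : ℝ × ℝ → ℝ := fun q => fderiv ℝ p.f q (0, 1)
  have hd1 : ContDiff ℝ ∞ d1 := (hs.fderiv_right (m := ∞) (by simp)).clm_apply contDiff_const
  let d2 : ℝ × ℝ → ℝ := fun q => fderiv ℝ d1 q (0, 1)
  have hd2 : ContDiff ℝ ∞ d2 := (hd1.fderiv_right (m := ∞) (by simp)).clm_apply contDiff_const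
  have hder : ∀ (h : ℝ × ℝ → ℝ), ContDiff ℝ ∞ h → ∀ x y : ℝ,
      HasDerivAt (fun y => h (x, y)) (fderiv ℝ h (x, y) (0, 1)) y := by
    intro h hh x y
    have h1 : HasFDerivAt h (fderiv ℝ h (x, y)) (x, y) :=
      (hh.differentiable (by simp) _).hasFDerivAt
    have h2 : HasDerivAt (fun y : ℝ => (x, y)) ((0 : ℝ), (1 : ℝ)) y :=
      (hasDerivAt_const y x).prodMk (hasDerivAt_id y)
    exact h1.comp_hasDerivAt y h2
  have hper : ∀ x y, d1 (x, y + 2 * π) = d1 (x, y) := by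
    intro x y
    have e1 := (hder p.f hs x (y + 2 * π)).comp_add_const y (2 * π)
    simp only [p.periodic] at e1
    exact e1.unique (hder p.f hs x y)
  obtain ⟨M, hM⟩ := (isCompact_Icc.prod isCompact_Icc : IsCompact
    (Icc (-p.R) p.R ×ˢ Icc (0 : ℝ) (2 * π))).exists_bound_of_continuousOn
    hd2.continuous.continuousOn
  have hpi := Real.pi_pos
  have hM0 : 0 ≤ M := (norm_nonneg _).trans (hM (0, 0)
    ⟨⟨by linarith [p.R_pos], p.R_pos.le⟩, ⟨le_rfl, by positivity⟩⟩)
  refine ⟨M * (2 * π), fun m hm => ?_⟩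
  rw [ContinuousMap.norm_le _ (by positivity)]
  rintro ⟨x, hx⟩
  simp only [coeffC, ContinuousMap.coe_mk, Perturbation.coeff]
  have f2 : p.f (x, 2 * π) = p.f (x, 0) := by simpa using p.periodic x 0
  have f3 : d1 (x, 2 * π) = d1 (x, 0) := by simpa using hper x 0
  have c1 := hd1.continuous
  have c2 := hd2.continuous
  rw [coeff_by_parts (g := fun y => ((p.f (x, y) : ℝ) : ℂ)) (g' := fun y => ((d1 (x, y) : ℝ) : ℂ))
      (fun y => (hder p.f hs x y).ofReal_comp) (by fun_prop) (by simp [f2]) hm,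
    coeff_by_parts (g := fun y => ((d1 (x, y) : ℝ) : ℂ)) (g' := fun y => ((d2 (x, y) : ℝ) : ℂ))
      (fun y => (hder d1 hd1 x y).ofReal_comp) (by fun_prop) (by simp [f3]) hm]
  have hb := intervalIntegral.norm_integral_le_of_norm_le_const (a := (0 : ℝ)) (b := 2 * π)
    (C := M) (f := fun y : ℝ => Complex.exp (-(Complex.I * m * y)) * ((d2 (x, y) : ℝ) : ℂ)) ?_
  · rw [sub_zero, abs_of_pos (by positivity)] at hb
    rw [norm_mul, norm_mul, norm_inv, norm_mul, Complex.norm_I, one_mul, Complex.norm_intCast,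
      ← mul_assoc, ← mul_inv, ← sq, sq_abs, mul_comm, one_div]
    exact mul_le_mul_of_nonneg_right hb (by positivity)
  · intro y hy
    rw [uIoc_of_le (by positivity)] at hy
    have e : ‖Complex.exp (-(Complex.I * m * y))‖ = 1 := by
      rw [Complex.norm_exp]
      simp
    rw [norm_mul, e, one_mul, Complex.norm_real]
    exact hM (x, y) ⟨hx, ⟨hy.1.le, hy.2⟩⟩

lemma summable_norm_coeffC (p : Perturbation) : Summable fun m : ℤ => ‖coeffC p m‖ := by
  obtain ⟨K, hK⟩ := exists_coeff_bound p
  have h1 : Summable fun m : ℤ => K * (1 / (m : ℝ) ^ 2) :=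
    (Real.summable_one_div_int_pow.2 (by norm_num)).mul_left K
  refine Summable.of_norm_bounded_eventually h1 ?_
  rw [eventually_cofinite]
  refine (finite_singleton (0 : ℤ)).subset fun m hm => ?_
  by_contra h0
  exact hm (by simpa using hK m h0)

lemma memℓp_two_of_summable {a : ℤ → Comp p} (h : Summable fun m => ‖a m‖) : Memℓp a 2 := by
  have h1 : Memℓp a 1 := memℓp_gen (by simpa using h)
  exact h1.of_exponent_ge (by norm_num)

/-- `H_n * A_n` componentwise, as an operator on `𝒜`. -/
lemma exists_diag (p : Perturbation) (β μ : ℝ) :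
    ∃ D : Space p →L[ℂ] Space p, ∀ A n, D A n = convH β μ n (A n) := by
  obtain ⟨M, hM0, hM⟩ := exists_kernelH_bound β μ (2 * p.R)
  have hR := p.R_pos
  have hb : ∀ n (a : Comp p), ‖convH β μ n a‖ ≤ M * (2 * p.R) * ‖a‖ := fun n a =>
    norm_convH_le β μ n a hM0 (hM n)
  let L : ∀ _ : ℤ, Comp p →L[ℂ] Comp p := fun n =>
    LinearMap.mkContinuous
      { toFun := convH β μ n, map_add' := convH_add β μ n, map_smul' := convH_smul β μ n }
      (M * (2 * p.R)) (hb n)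
  have hmem : ∀ A : Space p, Memℓp (fun n => convH β μ n (A n)) 2 := by
    intro A
    have hA := lp.memℓp A
    apply memℓp_gen
    have h2 := (hA.summable (by norm_num)).mul_left ((M * (2 * p.R)) ^ 2)
    simp only [ENNReal.toReal_ofNat, Real.rpow_two] at h2 ⊢
    refine Summable.of_nonneg_of_le (fun _ => by positivity) (fun n => ?_) h2
    rw [← mul_pow]
    exact pow_le_pow_left₀ (norm_nonneg _) (hb n _) 2
  refine ⟨LinearMap.mkContinuous
    { toFun := fun A => ⟨fun n => convH β μ n (A n), hmem A⟩
      map_add' := fun A B => by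
        ext n : 2
        exact convH_add β μ n (A n) (B n)
      map_smul' := fun c A => by
        ext n : 2
        exact convH_smul β μ n c (A n) } (M * (2 * p.R)) ?_, fun A n => rfl⟩
  intro A
  refine lp.norm_le_of_forall_sum_le (by norm_num) (by positivity) fun s => ?_
  simp only [ENNReal.toReal_ofNat, Real.rpow_two]
  have h3 := lp.sum_rpow_le_norm_rpow (p := 2) (by norm_num) A s
  simp only [ENNReal.toReal_ofNat, Real.rpow_two] at h3
  calc _ ≤ ∑ n ∈ s, (M * (2 * p.R)) ^ 2 * ‖A n‖ ^ 2 := Finset.sum_le_sum fun n _ => by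
        rw [← mul_pow]
        exact pow_le_pow_left₀ (norm_nonneg _) (hb n _) 2
    _ = (M * (2 * p.R)) ^ 2 * ∑ n ∈ s, ‖A n‖ ^ 2 := by rw [Finset.mul_sum]
    _ ≤ _ := by
        rw [mul_pow (M * (2 * p.R)) ‖A‖]
        exact mul_le_mul_of_nonneg_left h3 (by positivity)

/-- Multiplication by `φ` composed with a shift by `j`. -/
lemma exists_shiftMul (φ : Comp p) (j : ℤ) :
    ∃ S : Space p →L[ℂ] Space p, ‖S‖ ≤ ‖φ‖ ∧ ∀ A m, S A m = A (m - j) * φ := by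
  have hmem : ∀ A : Space p, Memℓp (fun m => A (m - j) * φ) 2 := by
    intro A
    apply memℓp_gen
    have h1 := ((lp.memℓp A).summable (by norm_num)).mul_right (‖φ‖ ^ 2)
    have h2 := ((Equiv.subRight j).summable_iff).2 h1
    simp only [ENNReal.toReal_ofNat, Real.rpow_two] at h2 ⊢
    refine Summable.of_nonneg_of_le (fun _ => by positivity) (fun n => ?_) h2
    simp only [Function.comp_apply, Equiv.subRight_apply]
    rw [← mul_pow]
    exact pow_le_pow_left₀ (norm_nonneg _) (norm_mul_le _ _) 2
  let S : Space p →ₗ[ℂ] Space p :=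
    { toFun := fun A => ⟨fun m => A (m - j) * φ, hmem A⟩
      map_add' := fun A B => by
        ext n : 2
        exact add_mul (A (n - j)) (B (n - j)) φ
      map_smul' := fun c A => by
        ext n : 2
        exact smul_mul_assoc c (A (n - j)) φ }
  have hb : ∀ A, ‖S A‖ ≤ ‖φ‖ * ‖A‖ := by
    intro A
    refine lp.norm_le_of_forall_sum_le (by norm_num) (by positivity) fun s => ?_
    simp only [ENNReal.toReal_ofNat, Real.rpow_two]
    have h3 := lp.sum_rpow_le_norm_rpow (p := 2) (by norm_num) A
      (s.map (Equiv.subRight j).toEmbedding)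
    simp only [ENNReal.toReal_ofNat, Real.rpow_two, Finset.sum_map] at h3
    calc _ ≤ ∑ n ∈ s, ‖φ‖ ^ 2 * ‖A (n - j)‖ ^ 2 := Finset.sum_le_sum fun n _ => by
          rw [← mul_pow, mul_comm]
          exact pow_le_pow_left₀ (norm_nonneg _) (norm_mul_le _ _) 2
      _ = ‖φ‖ ^ 2 * ∑ n ∈ s, ‖A (n - j)‖ ^ 2 := by rw [Finset.mul_sum]
      _ ≤ _ := by
          rw [mul_pow]
          exact mul_le_mul_of_nonneg_left h3 (by positivity)
  exact ⟨S.mkContinuous _ hb, S.mkContinuous_norm_le (norm_nonneg _) hb, fun A m => rfl⟩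

lemma hasSum_apply {S : ℤ → Space p →L[ℂ] Space p} (hsum : Summable S) (B : Space p) (m : ℤ) :
    HasSum (fun j => S j B m) ((∑' j, S j) B m) := by
  let ev : (Space p →L[ℂ] Space p) →L[ℂ] Comp p :=
    (lp.evalCLM ℂ (fun _ : ℤ => Comp p) 2 m).comp (ContinuousLinearMap.apply ℂ (Space p) B)
  exact hsum.hasSum.mapL ev

lemma hasSum_smul_comp {u : ℤ → Comp p} {a : Comp p} (h : HasSum u a) (c : ℂ) (m : ℤ) :
    HasSum (fun n => c • u (m - n)) (c • a) :=
  (((Equiv.subLeft m).hasSum_iff).2 h).const_smul c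

lemma summable_of_norm_le {E : Type*} [NormedAddCommGroup E] [NormedSpace ℂ E] [CompleteSpace E]
    {u : ℤ → ℝ} (hu : Summable u) {S : ℤ → E →L[ℂ] E} (h : ∀ j, ‖S j‖ ≤ u j) : Summable S :=
  Summable.of_norm_bounded hu h

lemma exists_opT (p : Perturbation) (β μ : ℝ) :
    ∃ T : Space p →L[ℂ] Space p, ∀ A m,
      HasSum (fun n => (2 * gam β μ : ℂ) • (convH β μ n (A n) * coeffC p (m - n))) (T A m) := by
  obtain ⟨D, hD⟩ := exists_diag p β μ
  obtain ⟨S, hSS⟩ := Classical.axiom_of_choice fun j : ℤ => exists_shiftMul (coeffC p j) j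
  have hS : ∀ j, ‖S j‖ ≤ ‖coeffC p j‖ := fun j => (hSS j).1
  have hS' : ∀ j A m, S j A m = A (m - j) * coeffC p j := fun j => (hSS j).2
  have hsum : Summable S := summable_of_norm_le (summable_norm_coeffC p) hS
  generalize hc : (2 * gam β μ : ℂ) = c
  generalize hL : ∑' j, S j = L
  refine ⟨c • L.comp D, fun A m => ?_⟩
  have h1 := hasSum_smul_comp (hasSum_apply hsum (D A) m) c m
  rw [hL] at h1
  have h5 : ∀ n, S (m - n) (D A) m = convH β μ n (A n) * coeffC p (m - n) := by
    intro n
    rw [hS', sub_sub_cancel, hD]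
  simp only [h5] at h1
  exact h1

lemma memℓp_opT (β μ : ℝ) (A : Space p) : Memℓp (fun m : ℤ =>
    ∑' n, (2 * gam β μ : ℂ) • (convH β μ n (A n) * coeffC p (m - n))) 2 := by
  obtain ⟨T, hT⟩ := exists_opT p β μ
  rw [show (fun m : ℤ => ∑' n, (2 * gam β μ : ℂ) • (convH β μ n (A n) * coeffC p (m - n))) =
    fun m => T A m from funext fun m => (hT A m).tsum_eq]
  exact lp.memℓp (T A)

/-- `(T̂ A)_m = 2γ ∑ₙ (H_n * A_n) f_{m-n}` as a map of `𝒜` to itself. -/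
def opTFun (β μ : ℝ) (A : Space p) : Space p :=
  ⟨fun m => ∑' n, (2 * gam β μ : ℂ) • (convH β μ n (A n) * coeffC p (m - n)), memℓp_opT β μ A⟩

lemma exists_opTFun_eq (p : Perturbation) (β μ : ℝ) :
    ∃ T : Space p →L[ℂ] Space p, ∀ A, opTFun β μ A = T A := by
  obtain ⟨T, hT⟩ := exists_opT p β μ
  refine ⟨T, fun A => ?_⟩
  ext m : 2
  exact (hT A m).tsum_eq

variable (p)

/-- The bounded operator `T̂ : 𝒜 → 𝒜`, `(T̂ A)_m = 2γ ∑ₙ (H_n * A_n) f_{m-n}`. -/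
def opT (β μ : ℝ) : Space p →L[ℂ] Space p where
  toFun := opTFun β μ
  map_add' A B := by
    obtain ⟨T, hT⟩ := exists_opTFun_eq p β μ
    rw [hT, hT, hT, map_add]
  map_smul' c A := by
    obtain ⟨T, hT⟩ := exists_opTFun_eq p β μ
    rw [hT, hT, map_smul, RingHom.id_apply]
  cont := by
    obtain ⟨T, hT⟩ := exists_opTFun_eq p β μ
    exact T.continuous.congr fun A => (hT A).symm

/-- `(1 - ε T̂)⁻¹` (the inverse in the algebra of bounded operators on `𝒜`). -/
def resolvent (β ε μ : ℝ) : Space p →L[ℂ] Space p :=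
  Ring.inverse (1 - (ε : ℂ) • opT p β μ)

/-- `x ↦ e^{ikx}` on `[-R, R]`. -/
def expC (k : ℝ) : Comp p := ⟨fun x => Complex.exp (Complex.I * k * (x : ℝ)), by fun_prop⟩

/-- `(g⁽¹⁾)_m = e^{i k₀ x} f_m`. -/
def gOne (β μ : ℝ) : Space p :=
  ⟨fun m => expC p (kZero β μ) * coeffC p m, memℓp_two_of_summable <|
    Summable.of_nonneg_of_le (fun _ => norm_nonneg _) (fun _ => norm_mul_le _ _)
      ((summable_norm_coeffC p).mul_left _)⟩

/-- `(g⁽²⁾)_m = f_{m+1}`. -/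
def gTwo : Space p :=
  ⟨fun m => coeffC p (m + 1), memℓp_two_of_summable <|
    (summable_norm_coeffC p).comp_injective (add_left_injective (1 : ℤ))⟩

/-- `F = ⟨((1 - εT̂)⁻¹ g⁽²⁾)₋₁⟩`. -/
def quantF (β ε μ : ℝ) : ℂ := avg (resolvent p β ε μ (gTwo p) (-1))

/-- `Q = ⟨((1 - εT̂)⁻¹ g⁽¹⁾)₋₁⟩`. -/
def quantQ (β ε μ : ℝ) : ℂ := avg (resolvent p β ε μ (gOne p β μ) (-1))

/-- `P⁺ = ⟨((1 - εT̂)⁻¹ g⁽¹⁾)₀ e^{i k₀ x}⟩`. -/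
def quantPplus (β ε μ : ℝ) : ℂ := avgExp (kZero β μ) (resolvent p β ε μ (gOne p β μ) 0)

/-- `P⁻ = ⟨((1 - εT̂)⁻¹ g⁽¹⁾)₀ e^{-i k₀ x}⟩`. -/
def quantPminus (β ε μ : ℝ) : ℂ := avgExp (-kZero β μ) (resolvent p β ε μ (gOne p β μ) 0)

/-- `R⁺ = ⟨((1 - εT̂)⁻¹ g⁽²⁾)₀ e^{i k₀ x}⟩`. -/
def quantRplus (β ε μ : ℝ) : ℂ := avgExp (kZero β μ) (resolvent p β ε μ (gTwo p) 0)

/-- `R⁻ = ⟨((1 - εT̂)⁻¹ g⁽²⁾)₀ e^{-i k₀ x}⟩`. -/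
def quantRminus (β ε μ : ℝ) : ℂ := avgExp (-kZero β μ) (resolvent p β ε μ (gTwo p) 0)

/-- The expression `μ - ε γ F`. -/
def disp (β ε μ : ℝ) : ℂ := μ - ε * gam β μ * quantF p β ε μ

/-- `C = 2 ε μ γ Q / (μ - ε γ F)`. -/
def constC (β ε μ : ℝ) : ℂ := 2 * ε * μ * gam β μ * quantQ p β ε μ / disp p β ε μ

/-- `g = g⁽¹⁾ + (C / 2μ) g⁽²⁾`. -/
def gVec (β ε μ : ℝ) : Space p := gOne p β μ + (constC p β ε μ / (2 * μ)) • gTwo p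

/-- `A = 2 ε γ (1 - εT̂)⁻¹ g`. -/
def vecA (β ε μ : ℝ) : Space p := (2 * ε * gam β μ : ℂ) • resolvent p β ε μ (gVec p β ε μ)

/-- `Ψ₀ = e^{i k₀ x} + G₀ * A₀` and `Ψ_m = G_m * A_m` for `m ≠ 0`. -/
def psiComp (β ε μ : ℝ) (m : ℤ) (x : ℝ) : ℂ :=
  (if m = 0 then Complex.exp (Complex.I * kZero β μ * x) else 0) +
    conv (green β μ m) (vecA p β ε μ m) x

/-- `Ψ(x, y) = e^{iβy} ∑ₙ Ψ_n(x) e^{iny}`. -/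
def psi (β ε μ : ℝ) (q : ℝ × ℝ) : ℂ :=
  Complex.exp (Complex.I * β * q.2) *
    ∑' n : ℤ, psiComp p β ε μ n q.1 * Complex.exp (Complex.I * n * q.2)

/-- The reflection coefficient
`(iεγ/k₀) (μ - εγF)⁻¹ {(μ - εγF) P⁺ + εγ Q R⁺}`. -/
def reflCoeff (β ε μ : ℝ) : ℂ :=
  Complex.I * ε * gam β μ / kZero β μ * (1 / disp p β ε μ) *
    (disp p β ε μ * quantPplus p β ε μ + ε * gam β μ * quantQ p β ε μ * quantRplus p β ε μ)

/-- The transmission coefficient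
`1 + (iεγ/k₀) (μ - εγF)⁻¹ {(μ - εγF) P⁻ + εγ Q R⁻}`. -/
def transCoeff (β ε μ : ℝ) : ℂ :=
  1 + Complex.I * ε * gam β μ / kZero β μ * (1 / disp p β ε μ) *
    (disp p β ε μ * quantPminus p β ε μ + ε * gam β μ * quantQ p β ε μ * quantRminus p β ε μ)

variable {p}

/-- The partial derivative in `x`. -/
def dX (u : ℝ × ℝ → ℂ) (q : ℝ × ℝ) : ℂ := deriv (fun s => u (s, q.2)) q.1

/-- The partial derivative in `y`. -/
def dY (u : ℝ × ℝ → ℂ) (q : ℝ × ℝ) : ℂ := deriv (fun s => u (q.1, s)) q.2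

/-- The quasiperiodic boundary conditions on `y = 0` and `y = 2π`. -/
def QuasiBC (β : ℝ) (u : ℝ × ℝ → ℂ) : Prop :=
  ∀ x, u (x, 2 * π) = Complex.exp (2 * π * Complex.I * β) * u (x, 0) ∧
    dY u (x, 2 * π) = Complex.exp (2 * π * Complex.I * β) * dY u (x, 0)

/-- Smooth functions that satisfy the boundary conditions and vanish for large `|x|`. -/
def IsTest (β : ℝ) (u : ℝ × ℝ → ℂ) : Prop :=
  ContDiff ℝ ∞ u ∧ QuasiBC β u ∧ ∃ M, ∀ x y, M < |x| → u (x, y) = 0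

/-- Lebesgue measure on the strip `Π = ℝ × (0, 2π)`. -/
def stripMeasure : Measure (ℝ × ℝ) := volume.restrict (univ ×ˢ Ioo 0 (2 * π))

/-- `v` belongs to `H₁^β(Π)`, the completion of the test functions in the norm
`‖v‖_{L²(Π)} + ‖∇v‖_{L²(Π)}`, and `(vx, vy)` is its gradient. -/
def IsH1 (β : ℝ) (v vx vy : ℝ × ℝ → ℂ) : Prop :=
  MemLp v 2 stripMeasure ∧ MemLp vx 2 stripMeasure ∧ MemLp vy 2 stripMeasure ∧
    ∃ φ : ℕ → ℝ × ℝ → ℂ, (∀ k, IsTest β (φ k)) ∧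
      Tendsto (fun k => eLpNorm (φ k - v) 2 stripMeasure) atTop (𝓝 0) ∧
      Tendsto (fun k => eLpNorm (dX (φ k) - vx) 2 stripMeasure) atTop (𝓝 0) ∧
      Tendsto (fun k => eLpNorm (dY (φ k) - vy) 2 stripMeasure) atTop (𝓝 0)

/-- The leading part at infinity, with `χ = Real.smoothTransition` (smooth, `0` for `x ≤ 0`,
`1` for `x ≥ 1`):
`χ(x) 𝒯 e^{iβy + ik₀x} + χ(-x) (e^{iβy + ik₀x} + ℛ e^{iβy - ik₀x})`. -/
def leading (β μ : ℝ) (r t : ℂ) (q : ℝ × ℝ) : ℂ :=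
  (Real.smoothTransition q.1 : ℂ) *
      (t * Complex.exp (Complex.I * β * q.2 + Complex.I * kZero β μ * q.1)) +
    (Real.smoothTransition (-q.1) : ℂ) *
      (Complex.exp (Complex.I * β * q.2 + Complex.I * kZero β μ * q.1) +
        r * Complex.exp (Complex.I * β * q.2 - Complex.I * kZero β μ * q.1))

variable (p)

/-- `Ψ` solves the scattering problem for a plane wave incident from the left, with reflection
coefficient `r` and transmission coefficient `t`: `Ψ` minus its leading part belongs to
`H₁^β(Π)`, and `∫_Π ∇Ψ · ∇Φ̄ = ω² ∫_Π (1 + ε f) Ψ Φ̄` for all test functions `Φ`. -/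
def IsScatteringSolution (β ε μ : ℝ) (u : ℝ × ℝ → ℂ) (r t : ℂ) : Prop :=
  ∃ vx vy : ℝ × ℝ → ℂ, IsH1 β (u - leading β μ r t) vx vy ∧
    ∀ φ, IsTest β φ →
      ∫ q, ((vx q + dX (leading β μ r t) q) * conj (dX φ q) +
          (vy q + dY (leading β μ r t) q) * conj (dY φ q)) ∂stripMeasure =
        omegaSq β μ * ∫ q, (1 + ε * p.f q : ℂ) * u q * conj (φ q) ∂stripMeasure

/-- `u` is a classical solution of `-Δu = ω² (1 + ε f) u` with the quasiperiodic boundary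
conditions. -/
def IsClassicalSolution (β ε μ : ℝ) (u : ℝ × ℝ → ℂ) : Prop :=
  ContDiff ℝ 2 u ∧ QuasiBC β u ∧
    ∀ q, -(dX (dX u) q + dY (dY u) q) = omegaSq β μ * (1 + ε * p.f q) * u q

end Scatter

end

open Scatter

noncomputable section

namespace Scatter

/-! Expand `Ψ` in the transversal modes `e^{i(β+m)y}`. The equation becomes `-Ψ_m'' + k_m² Ψ_m =
A_m` with `k_m² = (β+m)² - ω²`, where `A_m = 2εγ ∑ₙ f_{m-n} Ψ_n` is the `m`-th mode of the source
`ω² ε f Ψ`. Inverting with the decaying or outgoing `G_m` gives a fixed-point equation for `A`. As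
`μ → 0` only `G_{-1}` is singular, and its singular part is the constant `1/(2μ)`, which contributes
a rank-one term: `A = ε T̂ A + 2εγ (g⁽¹⁾ + (⟨A_{-1}⟩/2μ) g⁽²⁾)`. Applying the resolvent and
averaging mode `-1` leaves the scalar equation `(μ - εγF) ⟨A_{-1}⟩ = 2εμγQ`, whose solution is `C`
(`avg_vecA`, `hasSum_of_eq`).

Existence: `A` is a priori only square summable, but `G_m` gains `(1+|m|)⁻²`, so the `Ψ_m` are
summable, and then so are the `A_m`, being a convolution with the summable `f_j`. This suffices to
differentiate the mode series twice (`modeBounds_of_gconv`, `isClassicalSolution_psi`). To the left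
and right of the support of `f` the mode `0` is an explicit combination of `e^{±ik₀x}`, whose
amplitudes are `ℛ` and `𝒯`; the remaining modes decay exponentially. Mollification and cut-off put
the remainder into `H₁^β` (`isH1_of_decay`), and integration by parts gives the weak equation.

Small parameters: the kernels `H_n` are bounded uniformly in small `μ`, so a Neumann series inverts
`1 - εT̂` for small `ε`. To first order `F = ⟨f_0⟩ + ε⟨(T̂g⁽²⁾)_{-1}⟩ + O(ε²)`. The number `⟨f_0⟩`
is real, and in the second term only the propagating kernel `G_0` has an imaginary part; it
contributes a positive multiple of `|f̃_1(k₀)|² + |f̃_1(-k₀)|²`, the radiation loss of mode `-1`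
into mode `0` (`im_avg_opT_gTwo`). So `Im F > 0` when `f̃_1(±κ)` do not both vanish, and `μ - εγF`
cannot be zero.

Uniqueness: let `W` be the difference of two solutions. Testing with `χ_N · (G_n * ζ) · e^{i(β+n)y}`
and letting `N → ∞` shows that each mode of `W` is the field radiated by the source `ω² ε f W`. The
error from the cut-off vanishes: against the square integrable part by dominated convergence, and
against the outgoing part by orthogonality of modes or because a Wronskian of outgoing functions is
zero (`IsDifference.tendsto_cutoffError`). Hence the source is an element of `𝒜` that solves the
homogeneous fixed-point equation, and `μ - εγF ≠ 0` forces it to vanish (`eq_zero_of_disp_ne_zero`).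
Then all modes of `W` are zero, so `W = 0`, and the amplitudes agree because a nonzero propagating
wave is not square integrable. -/

/-! ### Convolution with the one-dimensional Green function. -/

/-- The decaying or outgoing Green function `e^{-k|x|} / 2k` of `-d²/dx² + k²`. -/
def expGreen (k : ℂ) (x : ℝ) : ℂ := 1 / (2 * k) * Complex.exp (-(k * (|x| : ℝ)))

lemma continuous_expGreen (k : ℂ) : Continuous (expGreen k) := by
  unfold expGreen
  fun_prop

/-- The convolution with the Green function `expGreen k`. -/
def gconv (k : ℂ) (a : ℝ → ℂ) (x : ℝ) : ℂ := ∫ ξ : ℝ, expGreen k (x - ξ) * a ξ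

/-- The derivative of `gconv k a`. -/
def gconvDeriv (k : ℂ) (a : ℝ → ℂ) (x : ℝ) : ℂ :=
  1 / 2 * (Complex.exp (k * x) * (∫ ξ in Ioi x, Complex.exp (-(k * ξ)) * a ξ) -
    Complex.exp (-(k * x)) * ∫ ξ in Iic x, Complex.exp (k * ξ) * a ξ)

section

variable {k : ℂ} {a : ℝ → ℂ} {R : ℝ}

lemma hasCompactSupport_of_vanish (h0 : ∀ x, R < |x| → a x = 0) : HasCompactSupport a :=
  HasCompactSupport.intro (isCompact_Icc (a := -R) (b := R)) fun x hx => h0 x <| by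
    by_contra h
    exact hx (abs_le.1 (not_lt.1 h))

lemma integrable_mul_of_vanish (ha : Continuous a) (h0 : ∀ x, R < |x| → a x = 0) {g : ℝ → ℂ}
    (hg : Continuous g) : Integrable fun x => g x * a x :=
  (hg.mul ha).integrable_of_hasCompactSupport ((hasCompactSupport_of_vanish h0).mul_left)

/-- Cutting at `ξ = x` removes the absolute value and separates the variables. Differentiation then
needs only the fundamental theorem of calculus, and the behaviour outside the support can be read
off. -/
lemma gconv_eq (ha : Continuous a) (h0 : ∀ x, R < |x| → a x = 0) (x : ℝ) :
    gconv k a x = 1 / (2 * k) *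
      (Complex.exp (k * x) * (∫ ξ in Ioi x, Complex.exp (-(k * ξ)) * a ξ) +
        Complex.exp (-(k * x)) * ∫ ξ in Iic x, Complex.exp (k * ξ) * a ξ) := by
  have hi := integrable_mul_of_vanish ha h0 (g := fun ξ => expGreen k (x - ξ))
    ((continuous_expGreen k).comp (by fun_prop))
  rw [gconv, ← intervalIntegral.integral_Iic_add_Ioi (b := x) hi.integrableOn hi.integrableOn,
    add_comm, mul_add, ← mul_assoc, ← mul_assoc, ← integral_const_mul, ← integral_const_mul]
  congr 1
  · refine setIntegral_congr_fun measurableSet_Ioi fun ξ hξ => ?_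
    have hξ' : x < ξ := hξ
    simp only [expGreen, abs_of_neg (sub_neg.2 hξ')]
    rw [show -(k * ((-(x - ξ) : ℝ) : ℂ)) = k * x + -(k * ξ) by push_cast; ring, Complex.exp_add]
    ring
  · refine setIntegral_congr_fun measurableSet_Iic fun ξ hξ => ?_
    have hξ' : ξ ≤ x := hξ
    simp only [expGreen, abs_of_nonneg (sub_nonneg.2 hξ')]
    rw [show -(k * ((x - ξ : ℝ) : ℂ)) = -(k * x) + k * ξ by push_cast; ring, Complex.exp_add]
    ring

lemma hasDerivAt_integral_Iic {g : ℝ → ℂ} (hg : Continuous g) (hi : Integrable g) (x : ℝ) :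
    HasDerivAt (fun x => ∫ ξ in Iic x, g ξ) (g x) x := by
  have e : (fun x => ∫ ξ in Iic x, g ξ) = fun x => (∫ ξ in Iic 0, g ξ) + ∫ ξ in (0 : ℝ)..x, g ξ := by
    funext y
    rw [← intervalIntegral.integral_Iic_sub_Iic hi.integrableOn hi.integrableOn]
    ring
  rw [e]
  exact ((intervalIntegral.integral_hasDerivAt_right (hg.intervalIntegrable _ _)
    (hg.stronglyMeasurableAtFilter _ _) hg.continuousAt)).const_add _

lemma hasDerivAt_integral_Ioi {g : ℝ → ℂ} (hg : Continuous g) (hi : Integrable g) (x : ℝ) :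
    HasDerivAt (fun x => ∫ ξ in Ioi x, g ξ) (-g x) x := by
  have e : (fun x => ∫ ξ in Ioi x, g ξ) = fun x => (∫ ξ, g ξ) - ∫ ξ in Iic x, g ξ := by
    funext y
    rw [← intervalIntegral.integral_Iic_add_Ioi (b := y) hi.integrableOn hi.integrableOn]
    ring
  rw [e]
  exact (hasDerivAt_integral_Iic hg hi x).const_sub _

lemma hasDerivAt_cexp_mul (k : ℂ) (x : ℝ) :
    HasDerivAt (fun x : ℝ => Complex.exp (k * x)) (k * Complex.exp (k * x)) x := by
  have h := ((Complex.ofRealCLM.hasDerivAt (x := x)).const_mul k).cexp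
  simp only [Complex.ofRealCLM_apply, Complex.ofReal_one, mul_one] at h
  exact h.congr_deriv (mul_comm _ _)

lemma hasDerivAt_cexp_neg_mul (k : ℂ) (x : ℝ) :
    HasDerivAt (fun x : ℝ => Complex.exp (-(k * x))) (-(k * Complex.exp (-(k * x)))) x := by
  simpa only [neg_mul] using hasDerivAt_cexp_mul (-k) x

/-- The endpoint terms of the two half-line integrals have opposite signs and cancel, since the
Green function is continuous at `0`. -/
lemma hasDerivAt_gconv (hk : k ≠ 0) (ha : Continuous a) (h0 : ∀ x, R < |x| → a x = 0) (x : ℝ) :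
    HasDerivAt (gconv k a) (gconvDeriv k a x) x := by
  rw [show gconv k a = _ from funext (gconv_eq ha h0)]
  have h1 := hasDerivAt_integral_Ioi (g := fun ξ : ℝ => Complex.exp (-(k * ξ)) * a ξ)
    (by fun_prop) (integrable_mul_of_vanish ha h0 (by fun_prop)) x
  have h2 := hasDerivAt_integral_Iic (g := fun ξ : ℝ => Complex.exp (k * ξ) * a ξ)
    (by fun_prop) (integrable_mul_of_vanish ha h0 (by fun_prop)) x
  refine ((((hasDerivAt_cexp_mul k x).mul h1).add
    ((hasDerivAt_cexp_neg_mul k x).mul h2)).const_mul (1 / (2 * k))).congr_deriv ?_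
  rw [gconvDeriv]
  have e : Complex.exp (k * x) * Complex.exp (-(k * x)) = 1 := by rw [← Complex.exp_add]; simp
  field_simp
  linear_combination (0 : ℂ) * e

/-- Here the two endpoint terms add up to `-a x`: the derivative of the Green function jumps by `-1`
at `0`. -/
lemma hasDerivAt_gconvDeriv (ha : Continuous a) (h0 : ∀ x, R < |x| → a x = 0)
    (x : ℝ) : HasDerivAt (gconvDeriv k a) (k ^ 2 * gconv k a x - a x) x := by
  have h1 := hasDerivAt_integral_Ioi (g := fun ξ : ℝ => Complex.exp (-(k * ξ)) * a ξ)
    (by fun_prop) (integrable_mul_of_vanish ha h0 (by fun_prop)) x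
  have h2 := hasDerivAt_integral_Iic (g := fun ξ : ℝ => Complex.exp (k * ξ) * a ξ)
    (by fun_prop) (integrable_mul_of_vanish ha h0 (by fun_prop)) x
  refine ((((hasDerivAt_cexp_mul k x).mul h1).sub
    ((hasDerivAt_cexp_neg_mul k x).mul h2)).const_mul (1 / 2)).congr_deriv ?_
  rw [gconv_eq ha h0]
  have e : Complex.exp (k * x) * Complex.exp (-(k * x)) = 1 := by rw [← Complex.exp_add]; simp
  field_simp
  linear_combination (-2 * a x) * e

lemma continuous_gconv (hk : k ≠ 0) (ha : Continuous a) (h0 : ∀ x, R < |x| → a x = 0) :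
    Continuous (gconv k a) :=
  continuous_iff_continuousAt.2 fun x => (hasDerivAt_gconv hk ha h0 x).continuousAt

lemma continuous_gconvDeriv (ha : Continuous a) (h0 : ∀ x, R < |x| → a x = 0) :
    Continuous (gconvDeriv k a) :=
  continuous_iff_continuousAt.2 fun x => (hasDerivAt_gconvDeriv ha h0 x).continuousAt

lemma integral_Ioi_eq_zero (h0 : ∀ x, R < |x| → a x = 0) {x : ℝ} (hx : R ≤ x) (g : ℝ → ℂ) :
    ∫ ξ in Ioi x, g ξ * a ξ = 0 :=
  setIntegral_eq_zero_of_forall_eq_zero fun ξ (hξ : x < ξ) => by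
    rw [h0 ξ ((hx.trans_lt hξ).trans_le (le_abs_self ξ)), mul_zero]

/-- The inequality is strict, unlike on the right, because `Iic x` contains its endpoint and `a
(-R)` may be nonzero here. -/
lemma integral_Iic_eq_zero (h0 : ∀ x, R < |x| → a x = 0) {x : ℝ} (hx : x < -R) (g : ℝ → ℂ) :
    ∫ ξ in Iic x, g ξ * a ξ = 0 :=
  setIntegral_eq_zero_of_forall_eq_zero fun ξ (hξ : ξ ≤ x) => by
    rw [h0 ξ (by have := neg_le_abs ξ; linarith), mul_zero]

lemma gconv_of_right (ha : Continuous a) (h0 : ∀ x, R < |x| → a x = 0) {x : ℝ} (hx : R ≤ x) :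
    gconv k a x = 1 / (2 * k) * Complex.exp (-(k * x)) * ∫ ξ : ℝ, Complex.exp (k * ξ) * a ξ := by
  have hi := integrable_mul_of_vanish ha h0 (g := fun ξ : ℝ => Complex.exp (k * ξ)) (by fun_prop)
  rw [gconv_eq ha h0, integral_Ioi_eq_zero h0 hx,
    ← intervalIntegral.integral_Iic_add_Ioi (b := x) hi.integrableOn hi.integrableOn,
    integral_Ioi_eq_zero h0 hx]
  ring

lemma gconv_of_left (ha : Continuous a) (h0 : ∀ x, R < |x| → a x = 0) {x : ℝ} (hx : x < -R) :
    gconv k a x = 1 / (2 * k) * Complex.exp (k * x) * ∫ ξ : ℝ, Complex.exp (-(k * ξ)) * a ξ := by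
  have hi := integrable_mul_of_vanish ha h0 (g := fun ξ : ℝ => Complex.exp (-(k * ξ)))
    (by fun_prop)
  rw [gconv_eq ha h0, integral_Iic_eq_zero h0 hx,
    ← intervalIntegral.integral_Iic_add_Ioi (b := x) hi.integrableOn hi.integrableOn,
    integral_Iic_eq_zero h0 hx]
  ring

/-- Beyond the support only the exponential `e^{-kx}` is present. This first-order relation is the
decay or radiation condition, used later to make a Wronskian vanish. -/
lemma gconvDeriv_of_right (hk : k ≠ 0) (ha : Continuous a) (h0 : ∀ x, R < |x| → a x = 0) {x : ℝ}
    (hx : R ≤ x) : gconvDeriv k a x = -(k * gconv k a x) := by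
  rw [gconv_eq ha h0, gconvDeriv, integral_Ioi_eq_zero h0 hx]
  field_simp
  ring

lemma gconvDeriv_of_left (hk : k ≠ 0) (ha : Continuous a) (h0 : ∀ x, R < |x| → a x = 0) {x : ℝ}
    (hx : x < -R) : gconvDeriv k a x = k * gconv k a x := by
  rw [gconv_eq ha h0, gconvDeriv, integral_Iic_eq_zero h0 hx]
  field_simp
  ring

/-- The two halves are precisely those of `gconv` and `gconvDeriv`, which differ in a sign and a
prefactor, so one estimate serves both. Only `Re k` enters, and it may be zero. -/
lemma norm_cexp_mul_integral_le (ha : Continuous a) (h0 : ∀ x, R < |x| → a x = 0) (x : ℝ) :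
    ‖Complex.exp (k * x) * (∫ ξ in Ioi x, Complex.exp (-(k * ξ)) * a ξ)‖ +
      ‖Complex.exp (-(k * x)) * ∫ ξ in Iic x, Complex.exp (k * ξ) * a ξ‖ ≤
    ∫ ξ, Real.exp (-(k.re * |x - ξ|)) * ‖a ξ‖ := by
  have hi : Integrable fun ξ => Real.exp (-(k.re * |x - ξ|)) * ‖a ξ‖ :=
    Continuous.integrable_of_hasCompactSupport (by fun_prop)
      ((hasCompactSupport_of_vanish h0).norm.mul_left)
  rw [← intervalIntegral.integral_Iic_add_Ioi (b := x) hi.integrableOn hi.integrableOn, add_comm]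
  refine add_le_add ?_ ?_
  · rw [← integral_const_mul]
    refine (norm_integral_le_integral_norm _).trans (le_of_eq ?_)
    refine setIntegral_congr_fun measurableSet_Iic fun ξ hξ => ?_
    have hξ' : ξ ≤ x := hξ
    simp only [norm_mul, Complex.norm_exp, abs_of_nonneg (sub_nonneg.2 hξ')]
    rw [← mul_assoc, ← Real.exp_add]
    congr 2
    simp
    ring
  · rw [← integral_const_mul]
    refine (norm_integral_le_integral_norm _).trans (le_of_eq ?_)
    refine setIntegral_congr_fun measurableSet_Ioi fun ξ hξ => ?_
    have hξ' : x < ξ := hξ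
    simp only [norm_mul, Complex.norm_exp, abs_of_neg (sub_neg.2 hξ')]
    rw [← mul_assoc, ← Real.exp_add]
    congr 2
    simp
    ring

lemma norm_gconv_le (ha : Continuous a) (h0 : ∀ x, R < |x| → a x = 0) (x : ℝ) :
    ‖gconv k a x‖ ≤ 1 / (2 * ‖k‖) * ∫ ξ, Real.exp (-(k.re * |x - ξ|)) * ‖a ξ‖ := by
  rw [gconv_eq ha h0, norm_mul]
  refine mul_le_mul (by simp) ((norm_add_le _ _).trans (norm_cexp_mul_integral_le ha h0 x))
    (norm_nonneg _) (by positivity)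

lemma norm_gconvDeriv_le (ha : Continuous a) (h0 : ∀ x, R < |x| → a x = 0) (x : ℝ) :
    ‖gconvDeriv k a x‖ ≤ 1 / 2 * ∫ ξ, Real.exp (-(k.re * |x - ξ|)) * ‖a ξ‖ := by
  rw [gconvDeriv, norm_mul]
  refine mul_le_mul (by simp) ((norm_sub_le _ _).trans (norm_cexp_mul_integral_le ha h0 x))
    (norm_nonneg _) (by positivity)

end

lemma integral_exp_neg_mul_abs_sub {κ : ℝ} (hκ : 0 < κ) (x : ℝ) :
    Integrable (fun ξ : ℝ => Real.exp (-(κ * |x - ξ|))) ∧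
      ∫ ξ : ℝ, Real.exp (-(κ * |x - ξ|)) = 2 / κ := by
  have e : ∫ y : ℝ, Real.exp (-(κ * |y|)) = 2 / κ := by
    rw [integral_comp_abs (f := fun y => Real.exp (-(κ * y)))]
    have := integral_exp_mul_Ioi (a := -κ) (by linarith) 0
    simp only [neg_mul] at this
    rw [this]
    simp
    ring
  have hi : Integrable fun y : ℝ => Real.exp (-(κ * |y|)) := by
    -- A non-integrable function has integral `0` by convention, so the nonzero value already
    -- computed forces integrability.
    by_contra h
    rw [integral_undef h] at e
    have : 0 < 2 / κ := by positivity
    linarith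
  exact ⟨hi.comp_sub_left x, by
    rw [integral_sub_left_eq_self (fun y : ℝ => Real.exp (-(κ * |y|))) volume x, e]⟩

/-- Half of the rate `κ` makes the integral converge, which gives `4/κ`. The other half is at least
`δ` and becomes decay in `x` through `|x| ≤ |x - ξ| + R` on the support. -/
lemma integral_exp_mul_norm_le {a : ℝ → ℂ} {R S κ δ : ℝ}
    (h0 : ∀ x, R < |x| → a x = 0) (hS : ∀ x, ‖a x‖ ≤ S) (hδ : 0 ≤ δ) (hκ : 0 < κ)
    (hδκ : 2 * δ ≤ κ) (x : ℝ) :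
    ∫ ξ, Real.exp (-(κ * |x - ξ|)) * ‖a ξ‖ ≤
      4 / κ * Real.exp (δ * R) * S * Real.exp (-(δ * |x|)) := by
  obtain ⟨hi, he⟩ := integral_exp_neg_mul_abs_sub (half_pos hκ) x
  have hS0 : 0 ≤ S := (norm_nonneg _).trans (hS 0)
  calc _ ≤ ∫ ξ, Real.exp (-(κ / 2 * |x - ξ|)) *
        (Real.exp (δ * R) * Real.exp (-(δ * |x|)) * S) := by
        refine integral_mono_of_nonneg (Eventually.of_forall fun _ => by positivity)
          (hi.mul_const _) (Eventually.of_forall fun ξ => ?_)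
        by_cases hξ : R < |ξ|
        · simp only [h0 ξ hξ, norm_zero, mul_zero]
          positivity
        · simp only [← mul_assoc]
          refine mul_le_mul ?_ (hS ξ) (norm_nonneg _) (by positivity)
          rw [← Real.exp_add, ← Real.exp_add]
          refine Real.exp_le_exp.2 ?_
          have h1 : |x| ≤ |x - ξ| + |ξ| := by simpa using abs_add_le (x - ξ) ξ
          have h2 : δ * |x| ≤ δ * |x - ξ| + δ * R := by
            nlinarith [not_lt.1 hξ]
          nlinarith [abs_nonneg (x - ξ)]
    _ = _ := by
        rw [integral_mul_const, he]
        field_simp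
        ring

/-! ### Wave numbers of the modes. -/

section

/-- The wave number of the `m`-th mode: `green β μ m = expGreen (waveNumber β μ m)`. -/
def waveNumber (β μ : ℝ) (m : ℤ) : ℂ :=
  if m = 0 then -(Complex.I * kZero β μ) else if m = -1 then (μ : ℂ) else (kExp β μ m : ℂ)

lemma green_eq (β μ : ℝ) (m : ℤ) : green β μ m = expGreen (waveNumber β μ m) := by
  funext x
  unfold green expGreen waveNumber
  split_ifs
  · congr 1
    · rw [mul_neg, div_neg, mul_left_comm, one_div, mul_inv, Complex.inv_I]
      ring
    · congr 1
      ring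
  · push_cast
    rfl
  · push_cast
    rfl

section

variable {β μ : ℝ}

lemma sq_lt_of_lt_sqrt (hμ : 0 < μ) (hμ' : μ < √(1 - 2 * β)) : μ ^ 2 < 1 - 2 * β :=
  (Real.lt_sqrt hμ.le).1 hμ'

lemma kZero_pos (hμ : 0 < μ) (hμ' : μ < √(1 - 2 * β)) : 0 < kZero β μ :=
  Real.sqrt_pos.2 (by linarith [sq_lt_of_lt_sqrt hμ hμ'])

lemma kZero_sq (hμ : 0 < μ) (hμ' : μ < √(1 - 2 * β)) : kZero β μ ^ 2 = 1 - 2 * β - μ ^ 2 :=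
  Real.sq_sqrt (by linarith [sq_lt_of_lt_sqrt hμ hμ'])

/-- The right side equals `(m - 1 + 2β)(m + 1) + μ²`, whose first term is positive for integers `m ≠
0, -1`. It is at least `β(1+m)²` for `m ≥ 1` and at least `2(1+|m|)²/9` for `m ≤ -2`; the square of
`2β/3` lies below both constants. Since `μ²` is dropped, the bound is uniform in `μ`. -/
lemma mul_sq_le_kExp_arg (hβ : 0 < β) (hβ' : β < 1 / 2) {m : ℤ} (h0 : m ≠ 0) (h1 : m ≠ -1) :
    (2 * β / 3 * (1 + |(m : ℝ)|)) ^ 2 ≤ (β + m) ^ 2 - omegaSq β μ := by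
  unfold omegaSq
  rcases lt_or_gt_of_ne h0 with h | h
  · have h2 : m ≤ -2 := by omega
    have h2' : (m : ℝ) ≤ -2 := by exact_mod_cast h2
    rw [abs_of_neg (by linarith)]
    have e : 2 / 9 * (1 + -(m : ℝ)) ^ 2 ≤ (-m + 1 - 2 * β) * (-m - 1) := by nlinarith
    have e2 : (2 * β / 3 * (1 + -(m : ℝ))) ^ 2 ≤ 2 / 9 * (1 + -(m : ℝ)) ^ 2 := by
      rw [mul_pow]
      refine mul_le_mul_of_nonneg_right ?_ (sq_nonneg _)
      nlinarith
    nlinarith [sq_nonneg μ]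
  · have h2' : (1 : ℝ) ≤ m := by exact_mod_cast h
    rw [abs_of_pos (by linarith)]
    have e : β * (1 + (m : ℝ)) ^ 2 ≤ (m - 1 + 2 * β) * (m + 1) := by
      nlinarith [mul_nonneg (mul_nonneg (sub_nonneg.2 h2') (by linarith : 0 ≤ 1 - β))
        (by linarith : (0 : ℝ) ≤ m + 1)]
    have e2 : (2 * β / 3 * (1 + (m : ℝ))) ^ 2 ≤ β * (1 + (m : ℝ)) ^ 2 := by
      rw [mul_pow]
      refine mul_le_mul_of_nonneg_right ?_ (sq_nonneg _)
      nlinarith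
    nlinarith [sq_nonneg μ]

lemma le_kExp (hβ : 0 < β) (hβ' : β < 1 / 2) {m : ℤ} (h0 : m ≠ 0) (h1 : m ≠ -1) :
    2 * β / 3 * (1 + |(m : ℝ)|) ≤ kExp β μ m :=
  Real.le_sqrt_of_sq_le (mul_sq_le_kExp_arg hβ hβ' h0 h1)

/-- The three branches are square roots of the same expression; at `m = -1` this is the definition
of `ω²`, and at `m = 0` the square is `-k₀²`. -/
lemma waveNumber_sq (hβ : 0 < β) (hβ' : β < 1 / 2) (hμ : 0 < μ) (hμ' : μ < √(1 - 2 * β)) (m : ℤ) :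
    waveNumber β μ m ^ 2 = ((β : ℂ) + m) ^ 2 - omegaSq β μ := by
  unfold waveNumber
  split_ifs with h0 h1
  · have e : (kZero β μ : ℂ) ^ 2 = 1 - 2 * β - μ ^ 2 := by
      exact_mod_cast congrArg (fun x : ℝ => (x : ℂ)) (kZero_sq hμ hμ')
    subst h0
    rw [neg_sq, mul_pow, e, Complex.I_sq, omegaSq]
    push_cast
    ring
  · subst h1
    rw [omegaSq]
    push_cast
    ring
  · have h2 := (sq_nonneg _).trans (mul_sq_le_kExp_arg (μ := μ) hβ hβ' h0 h1)
    have e := congrArg (fun x : ℝ => (x : ℂ)) (Real.sq_sqrt h2)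
    push_cast at e
    rw [kExp]
    exact e

lemma waveNumber_ne_zero (hβ : 0 < β) (hβ' : β < 1 / 2) (hμ : 0 < μ) (hμ' : μ < √(1 - 2 * β))
    (m : ℤ) : waveNumber β μ m ≠ 0 := by
  unfold waveNumber
  split_ifs with h0 h1
  · exact neg_ne_zero.2 (mul_ne_zero Complex.I_ne_zero
      (by exact_mod_cast (kZero_pos hμ hμ').ne'))
  · exact_mod_cast hμ.ne'
  · have := le_kExp (μ := μ) hβ hβ' h0 h1
    have h3 : 0 < 2 * β / 3 * (1 + |(m : ℝ)|) := by positivity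
    exact_mod_cast (h3.trans_le this).ne'

lemma waveNumber_zero : waveNumber β μ 0 = -(Complex.I * kZero β μ) := if_pos rfl

lemma norm_waveNumber {m : ℤ} (hμ : 0 < μ) (h0 : m ≠ 0) :
    ‖waveNumber β μ m‖ = (waveNumber β μ m).re := by
  unfold waveNumber
  rw [if_neg h0]
  split_ifs
  · rw [Complex.norm_real, Complex.ofReal_re, Real.norm_of_nonneg hμ.le]
  · rw [Complex.norm_real, Complex.ofReal_re, kExp, Real.norm_of_nonneg (Real.sqrt_nonneg _)]

lemma re_waveNumber_nonneg (hμ : 0 < μ) (m : ℤ) : 0 ≤ (waveNumber β μ m).re := by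
  by_cases h0 : m = 0
  · rw [h0, waveNumber_zero]
    simp
  · rw [← norm_waveNumber hμ h0]
    exact norm_nonneg _

lemma exists_le_re_waveNumber (hβ : 0 < β) (hβ' : β < 1 / 2) (hμ : 0 < μ) :
    ∃ c > 0, ∀ m : ℤ, m ≠ 0 → c * (1 + |(m : ℝ)|) ≤ (waveNumber β μ m).re := by
  -- For `m = -1` the weight `1 + |m|` is `2`, hence `μ/2`.
  refine ⟨min (2 * β / 3) (μ / 2), by positivity, fun m h0 => ?_⟩
  unfold waveNumber
  rw [if_neg h0]
  split_ifs with h1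
  · subst h1
    rw [Complex.ofReal_re]
    have := min_le_right (2 * β / 3) (μ / 2)
    norm_num
    linarith
  · rw [Complex.ofReal_re]
    exact (mul_le_mul_of_nonneg_right (min_le_left _ _) (by positivity)).trans
      (le_kExp hβ hβ' h0 h1)

end

/-! ### Fourier coefficients of `f`. -/

variable (p : Perturbation)

lemma coeff_eq_zero (j : ℤ) {x : ℝ} (hx : p.R < |x|) : p.coeff j x = 0 := by
  simp [Perturbation.coeff, p.vanish x _ hx]

/-- Continuity along `t ↦ (t x, y)`, `t ↓ 1`, extends the vanishing to `|x| = R`. This makes the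
sources `A_m`, extended by zero, continuous on the line, so that `G_m * A_m` is of class `C²`. -/
lemma f_eq_zero {x : ℝ} (hx : p.R ≤ |x|) (y : ℝ) : p.f (x, y) = 0 := by
  rcases hx.lt_or_eq with h | h
  · exact p.vanish x y h
  have hc : Continuous fun t : ℝ => p.f (t * x, y) :=
    p.smooth.continuous.comp (by fun_prop)
  have h1 : Tendsto (fun t : ℝ => p.f (t * x, y)) (𝓝[>] 1) (𝓝 (p.f (1 * x, y))) :=
    (hc.tendsto 1).mono_left nhdsWithin_le_nhds
  have h2 : (fun t : ℝ => p.f (t * x, y)) =ᶠ[𝓝[>] 1] fun _ => 0 := by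
    filter_upwards [self_mem_nhdsWithin] with t ht
    have ht' : 1 < t := ht
    refine p.vanish _ _ ?_
    rw [abs_mul, abs_of_pos (by linarith), ← h]
    nlinarith [p.R_pos]
  have h3 := tendsto_nhds_unique h1 (tendsto_const_nhds.congr' h2.symm)
  rwa [one_mul] at h3

lemma coeff_eq_zero' (j : ℤ) {x : ℝ} (hx : p.R ≤ |x|) : p.coeff j x = 0 := by
  simp [Perturbation.coeff, f_eq_zero p hx]

lemma summable_norm_coeff (x : ℝ) : Summable fun j : ℤ => ‖p.coeff j x‖ := by
  by_cases hx : x ∈ Icc (-p.R) p.R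
  · exact Summable.of_nonneg_of_le (fun _ => norm_nonneg _)
      (fun j => (coeffC p j).norm_coe_le_norm ⟨x, hx⟩) (summable_norm_coeffC p)
  · have : p.R < |x| := by
      by_contra h
      exact hx (abs_le.1 (not_lt.1 h))
    simp [coeff_eq_zero p _ this, summable_zero]

/-- The Fourier series of `f` in `y`. -/
lemma hasSum_fourier_f (x y : ℝ) :
    HasSum (fun j : ℤ => p.coeff j x * Complex.exp (Complex.I * j * y)) (2 * π * p.f (x, y)) := by
  have hT : Fact (0 < 2 * π) := ⟨by positivity⟩
  have hper : Function.Periodic (fun y => (p.f (x, y) : ℂ)) (2 * π) := fun y => by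
    simp only [p.periodic]
  have hcont : Continuous hper.lift := by
    refine continuous_coinduced_dom.2 ?_
    have hc : Continuous fun y => (p.f (x, y) : ℂ) :=
      Complex.continuous_ofReal.comp (p.smooth.continuous.comp (by fun_prop))
    exact hc
  let F : C(AddCircle (2 * π), ℂ) := ⟨hper.lift, hcont⟩
  -- `coeff` omits the normalising factor `1/(2π)`, whence the `2π` in the sum of the series.
  have hco : ∀ j, fourierCoeff F j = (1 / (2 * π) : ℂ) * p.coeff j x := by
    intro j
    rw [fourierCoeff_eq_intervalIntegral _ _ 0, zero_add, Perturbation.coeff, Complex.real_smul]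
    push_cast
    congr 1
    refine intervalIntegral.integral_congr fun t _ => ?_
    simp only [fourier_coe_apply, smul_eq_mul]
    have : F (t : AddCircle (2 * π)) = p.f (x, t) := Function.Periodic.lift_coe hper t
    rw [this]
    congr 2
    have hpi : (π : ℂ) ≠ 0 := by exact_mod_cast Real.pi_ne_zero
    push_cast
    field_simp
  have hs : Summable (fourierCoeff F) := by
    rw [show fourierCoeff F = _ from funext hco]
    exact (summable_norm_coeff p x).of_norm.mul_left _
  have h := (has_pointwise_sum_fourier_series_of_summable hs (y : AddCircle (2 * π))).mul_left
    (2 * π : ℂ)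
  have e : F (y : AddCircle (2 * π)) = p.f (x, y) := Function.Periodic.lift_coe hper y
  rw [e] at h
  refine h.congr_fun fun j => ?_
  have hpi : (π : ℂ) ≠ 0 := by exact_mod_cast Real.pi_ne_zero
  rw [hco, fourier_coe_apply, smul_eq_mul]
  field_simp
  congr 2
  push_cast
  field_simp

end

/-! ### Zero extension, linear functionals, and the fixed-point equation in modes. -/

section

variable {p : Perturbation}

lemma zeroExt_of_mem (a : Comp p) {x : ℝ} (hx : x ∈ Icc (-p.R) p.R) : zeroExt a x = a ⟨x, hx⟩ :=
  dif_pos hx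

lemma zeroExt_of_notMem (a : Comp p) {x : ℝ} (hx : x ∉ Icc (-p.R) p.R) : zeroExt a x = 0 :=
  dif_neg hx

lemma zeroExt_of_lt (a : Comp p) {x : ℝ} (hx : p.R < |x|) : zeroExt a x = 0 :=
  zeroExt_of_notMem a fun h => hx.not_ge (abs_le.2 h)

lemma zeroExt_eq_indicator (a : Comp p) :
    zeroExt a = (Icc (-p.R) p.R).indicator
      (IccExtend (by linarith [p.R_pos] : -p.R ≤ p.R) a) := by
  funext x
  by_cases hx : x ∈ Icc (-p.R) p.R
  · rw [indicator_of_mem hx, zeroExt_of_mem a hx, IccExtend_of_mem _ _ hx]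
  · rw [indicator_of_notMem hx, zeroExt_of_notMem a hx]

lemma norm_zeroExt_le (a : Comp p) (x : ℝ) : ‖zeroExt a x‖ ≤ ‖a‖ := by
  by_cases hx : x ∈ Icc (-p.R) p.R
  · rw [zeroExt_of_mem a hx]
    exact a.norm_coe_le_norm _
  · rw [zeroExt_of_notMem a hx, norm_zero]
    exact norm_nonneg _

lemma integrable_zeroExt_mul (a : Comp p) {g : ℝ → ℂ} (hg : Continuous g) :
    Integrable fun x => zeroExt a x * g x := by
  rw [zeroExt_eq_indicator]
  simp_rw [← indicator_mul_left]
  rw [integrable_indicator_iff measurableSet_Icc]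
  exact (a.continuous.Icc_extend'.mul hg).continuousOn.integrableOn_compact isCompact_Icc

lemma zeroExt_add (a b : Comp p) (x : ℝ) : zeroExt (a + b) x = zeroExt a x + zeroExt b x := by
  by_cases hx : x ∈ Icc (-p.R) p.R
  · simp [zeroExt_of_mem _ hx]
  · simp [zeroExt_of_notMem _ hx]

lemma zeroExt_smul (c : ℂ) (a : Comp p) (x : ℝ) : zeroExt (c • a) x = c * zeroExt a x := by
  by_cases hx : x ∈ Icc (-p.R) p.R
  · simp [zeroExt_of_mem _ hx]
  · simp [zeroExt_of_notMem _ hx]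

/-- `a ↦ ∫ a(x) g(x) dx` as a continuous functional on `C[-R, R]`. -/
def pairing (g : ℝ → ℂ) (hg : Continuous g) : Comp p →L[ℂ] ℂ :=
  LinearMap.mkContinuous
    { toFun := fun a => ∫ x : ℝ, zeroExt a x * g x
      map_add' := fun a b => by
        simp_rw [zeroExt_add, add_mul]
        exact integral_add (integrable_zeroExt_mul a hg) (integrable_zeroExt_mul b hg)
      map_smul' := fun c a => by
        simp_rw [zeroExt_smul, mul_assoc]
        exact integral_const_mul _ _ }
    (∫ x in Icc (-p.R) p.R, ‖g x‖) fun a => by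
      rw [← integral_mul_const, ← integral_indicator measurableSet_Icc]
      refine norm_integral_le_of_norm_le ?_ (Eventually.of_forall fun x => ?_)
      · rw [integrable_indicator_iff measurableSet_Icc]
        exact (hg.norm.mul_const _).continuousOn.integrableOn_compact isCompact_Icc
      · by_cases hx : x ∈ Icc (-p.R) p.R
        · rw [indicator_of_mem hx, norm_mul, mul_comm]
          exact mul_le_mul_of_nonneg_left (norm_zeroExt_le a x) (norm_nonneg _)
        · rw [indicator_of_notMem hx, zeroExt_of_notMem a hx, zero_mul, norm_zero]

lemma pairing_apply {g : ℝ → ℂ} (hg : Continuous g) (a : Comp p) :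
    pairing g hg a = ∫ x : ℝ, zeroExt a x * g x := rfl

lemma avg_eq_pairing (a : Comp p) : avg a = pairing (fun _ => 1) continuous_const a := by
  simp [pairing_apply, avg]

lemma avgExp_eq_pairing (k : ℝ) (a : Comp p) :
    avgExp k a = pairing (fun x : ℝ => Complex.exp (Complex.I * k * x)) (by fun_prop) a := rfl

lemma continuous_zeroExt {a : Comp p}
    (ha : ∀ x : Icc (-p.R) p.R, |(x : ℝ)| = p.R → a x = 0) : Continuous (zeroExt a) := by
  rw [zeroExt_eq_indicator]
  refine a.continuous.Icc_extend'.indicator fun x hx => ?_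
  rw [frontier_Icc (by linarith [p.R_pos] : -p.R ≤ p.R)] at hx
  have hR := p.R_pos
  have hx' : x ∈ Icc (-p.R) p.R := by
    rcases hx with rfl | rfl
    · exact ⟨le_rfl, by linarith⟩
    · exact ⟨by linarith, le_rfl⟩
  rw [IccExtend_of_mem _ _ hx']
  refine ha _ ?_
  rcases hx with rfl | rfl
  · simp [hR.le]
  · simp [hR.le]

lemma conv_green (β μ : ℝ) (m : ℤ) (a : Comp p) :
    conv (green β μ m) a = gconv (waveNumber β μ m) (zeroExt a) := by
  funext x
  rw [conv, gconv, green_eq]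

lemma kernelH_of_ne {β μ : ℝ} {n : ℤ} (hn : n ≠ -1) : kernelH β μ n = green β μ n := by
  funext x
  rw [kernelH, if_neg hn]

/-- The singular part of `G_{-1}` is the constant `1/(2μ)`, and convolution with a constant sees
only the average. This is the origin of the rank-one term with `g⁽²⁾`. -/
lemma conv_green_neg_one {β μ : ℝ} (a : Comp p) (x : ℝ) :
    conv (green β μ (-1)) a x = conv (kernelH β μ (-1)) a x + avg a / (2 * μ) := by
  have h1 : ∀ y, green β μ (-1) y = kernelH β μ (-1) y + 1 / (2 * μ) := by
    intro y
    simp only [green, kernelH, if_true]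
    norm_num
    ring
  have hk : Integrable fun ξ => zeroExt a ξ * kernelH β μ (-1) (x - ξ) :=
    integrable_zeroExt_mul a ((continuous_kernelH β μ (-1)).comp (by fun_prop))
  have hc : Integrable fun ξ => zeroExt a ξ * (1 / (2 * μ) : ℂ) :=
    integrable_zeroExt_mul a continuous_const
  simp only [conv, h1, avg]
  rw [← integral_div, ← integral_add]
  · congr 1
    funext ξ
    ring
  · simpa only [mul_comm] using hk
  · simpa only [mul_one_div] using hc

/-- `G_n * a` as an element of `C[-R, R]`. -/
def convG (β μ : ℝ) (n : ℤ) (a : Comp p) : Comp p :=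
  ⟨fun x => conv (green β μ n) a x,
    (continuous_conv (continuous_green β μ n) a).comp continuous_subtype_val⟩

lemma convG_of_ne {β μ : ℝ} {n : ℤ} (hn : n ≠ -1) (a : Comp p) : convG β μ n a = convH β μ n a := by
  ext x
  simp only [convG, convH, kernelH_of_ne hn]

lemma convG_neg_one {β μ : ℝ} (a : Comp p) :
    convG β μ (-1) a = convH β μ (-1) a + (avg a / (2 * μ)) • (1 : Comp p) := by
  ext x
  simp [convG, convH, conv_green_neg_one]

variable (p)

lemma norm_tsum_le_of_norm_le {E : Type*} [NormedAddCommGroup E] [NormedSpace ℂ E]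
    [CompleteSpace E] {u : ℤ → ℝ} (hu : Summable u) {S : ℤ → E →L[ℂ] E} (h : ∀ j, ‖S j‖ ≤ u j) :
    ‖∑' j, S j‖ ≤ ∑' j, u j :=
  tsum_of_norm_bounded hu.hasSum h

/-- The operator of multiplication by the Fourier series of `f`. -/
lemma exists_mulOp : ∃ L : Space p →L[ℂ] Space p, ‖L‖ ≤ ∑' j, ‖coeffC p j‖ ∧
    ∀ B m, HasSum (fun n => B n * coeffC p (m - n)) (L B m) := by
  obtain ⟨S, hSS⟩ := Classical.axiom_of_choice fun j : ℤ => exists_shiftMul (coeffC p j) j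
  have hsum : Summable S := summable_of_norm_le (summable_norm_coeffC p) fun j => (hSS j).1
  have hb := norm_tsum_le_of_norm_le (summable_norm_coeffC p) fun j => (hSS j).1
  have hap := fun B m => hasSum_apply hsum B m
  generalize ∑' j, S j = L at hb hap
  refine ⟨L, hb, fun B m => ?_⟩
  refine ((Equiv.subLeft m).hasSum_iff.2 (hap B m)).congr_fun fun n => ?_
  rw [Function.comp_apply, (hSS _).2, Equiv.subLeft_apply, sub_sub_cancel]

lemma hasSum_opT (β μ : ℝ) (A : Space p) (m : ℤ) :
    HasSum (fun n => (2 * gam β μ : ℂ) • (convH β μ n (A n) * coeffC p (m - n)))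
      (opT p β μ A m) := by
  obtain ⟨T, hT⟩ := exists_opT p β μ
  have : opT p β μ A m = ∑' n, (2 * gam β μ : ℂ) • (convH β μ n (A n) * coeffC p (m - n)) := rfl
  rw [this]
  exact (hT A m).summable.hasSum

variable {p}

/-- Writes `g⁽¹⁾` and `g⁽²⁾` as series over `n` with the single term `n = 0` or `n = -1`, so that
they can be added to the series of `T̂`. -/
lemma hasSum_single_smul_mul (c : ℂ) (b : Comp p) (m k : ℤ) :
    HasSum (fun n => c • ((if n = k then b else 0) * coeffC p (m - n)))
      (c • (b * coeffC p (m - k))) := by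
  convert hasSum_single (f := fun n => c • ((if n = k then b else 0) * coeffC p (m - n))) k ?_
  · simp
  · intro n hn
    ext x
    simp [hn]

/-- The equation `A = ε T̂ A + 2εγ (b g⁽¹⁾ + (⟨A₋₁⟩ / 2μ) g⁽²⁾)` says that
`A_m = 2εγ ∑ₙ f_{m-n} Ψ_n` with `Ψ_n = G_n * A_n + b δ_{n0} e^{ik₀x}`. -/
lemma hasSum_of_eq {β ε μ : ℝ} {A : Space p} {b : ℂ}
    (hA : A = (ε : ℂ) • opT p β μ A + (2 * ε * gam β μ : ℂ) •
      (b • gOne p β μ + (avg (A (-1)) / (2 * μ)) • gTwo p)) (m : ℤ) :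
    HasSum (fun n => (2 * ε * gam β μ : ℂ) •
      ((convG β μ n (A n) + b • if n = 0 then expC p (kZero β μ) else 0) * coeffC p (m - n)))
      (A m) := by
  have h1 := (hasSum_opT p β μ A m).const_smul (ε : ℂ)
  have h2 := hasSum_single_smul_mul (2 * ε * gam β μ * b : ℂ) (expC p (kZero β μ)) m 0
  have h3 := hasSum_single_smul_mul (2 * ε * gam β μ * (avg (A (-1)) / (2 * μ)) : ℂ)
    (1 : Comp p) m (-1)
  have h4 := (h1.add h2).add h3
  have e : A m = (ε : ℂ) • opT p β μ A m +
      (2 * ε * gam β μ * b : ℂ) • (expC p (kZero β μ) * coeffC p (m - 0)) +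
      (2 * ε * gam β μ * (avg (A (-1)) / (2 * μ)) : ℂ) • (1 * coeffC p (m - -1)) := by
    have e1 : A m = (ε : ℂ) • opT p β μ A m + (2 * ε * gam β μ : ℂ) •
        (b • (expC p (kZero β μ) * coeffC p m) + (avg (A (-1)) / (2 * μ)) • coeffC p (m + 1)) :=
      congrArg (fun B : Space p => B m) hA
    rw [e1]
    ext x
    simp only [ContinuousMap.add_apply, ContinuousMap.smul_apply, ContinuousMap.mul_apply,
      ContinuousMap.one_apply, smul_eq_mul, sub_zero, sub_neg_eq_add]
    ring
  rw [← e] at h4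
  refine h4.congr_fun fun n => ?_
  ext x
  by_cases hn : n = -1
  · subst hn
    rw [convG_neg_one]
    simp
    ring
  · rw [convG_of_ne hn, if_neg hn]
    generalize (if n = 0 then expC p (kZero β μ) else 0) = w
    simp
    ring

/-- Conversely, `A_m = 2εγ ∑ₙ f_{m-n} (G_n * A_n)` says that
`A = ε T̂ A + 2εγ (⟨A₋₁⟩ / 2μ) g⁽²⁾`. -/
lemma eq_of_hasSum {β ε μ : ℝ} {A : Space p}
    (h : ∀ m, HasSum (fun n => (2 * ε * gam β μ : ℂ) • (convG β μ n (A n) * coeffC p (m - n)))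
      (A m)) :
    A = (ε : ℂ) • opT p β μ A + (2 * ε * gam β μ * (avg (A (-1)) / (2 * μ)) : ℂ) • gTwo p := by
  ext m : 2
  have h1 := (hasSum_opT p β μ A m).const_smul (ε : ℂ)
  have h3 := hasSum_single_smul_mul (2 * ε * gam β μ * (avg (A (-1)) / (2 * μ)) : ℂ)
    (1 : Comp p) m (-1)
  have h4 := h1.add h3
  rw [sub_neg_eq_add, one_mul] at h4
  refine (h m).unique (h4.congr_fun fun n => ?_)
  ext x
  by_cases hn : n = -1
  · subst hn
    rw [convG_neg_one]
    simp
    ring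
  · rw [convG_of_ne hn, if_neg hn]
    simp
    ring

/-- Every term carries a factor `f_{m-n}`, which is zero at `|x| = R`, and evaluation at a point is
continuous. -/
lemma vanish_of_hasSum {c : ℂ} {W : ℤ → Comp p} {a : Comp p} {m : ℤ}
    (h : HasSum (fun n => c • (W n * coeffC p (m - n))) a) (x : Icc (-p.R) p.R)
    (hx : |(x : ℝ)| = p.R) : a x = 0 := by
  have h1 := h.mapL (ContinuousMap.evalCLM ℂ x)
  refine (hasSum_zero.congr_fun fun n => ?_).unique h1 |>.symm
  have : coeffC p (m - n) x = 0 := coeff_eq_zero' p _ hx.ge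
  simp [this]

/-- Young's inequality `ℓ¹ * ℓ¹ ⊂ ℓ¹`, by reindexing the double series with the shear `(m, n) ↦ (n,
m - n)`. -/
lemma summable_norm_of_hasSum_mul {E : Type*} [NormedRing E] [NormedAlgebra ℂ E] {c : ℂ}
    {W φ a : ℤ → E} (hW : Summable fun n => ‖W n‖) (hφ : Summable fun n => ‖φ n‖)
    (h : ∀ m, HasSum (fun n => c • (W n * φ (m - n))) (a m)) : Summable fun m => ‖a m‖ := by
  have h1 : Summable fun q : ℤ × ℤ => ‖W q.1‖ * ‖φ q.2‖ :=
    hW.mul_of_nonneg hφ (fun _ => norm_nonneg _) fun _ => norm_nonneg _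
  let e : ℤ × ℤ ≃ ℤ × ℤ :=
    { toFun := fun q => (q.2, q.1 - q.2)
      invFun := fun q => (q.2 + q.1, q.1)
      left_inv := fun q => by simp
      right_inv := fun q => by simp }
  have h2 : Summable fun q : ℤ × ℤ => ‖c‖ * (‖W q.2‖ * ‖φ (q.1 - q.2)‖) :=
    ((e.summable_iff.2 h1)).mul_left _
  refine Summable.of_nonneg_of_le (fun _ => norm_nonneg _) (fun m => ?_) h2.prod
  refine (h m).norm_le_of_bounded (h2.prod_factor m).hasSum fun n => ?_
  rw [norm_smul]
  exact mul_le_mul_of_nonneg_left (norm_mul_le _ _) (norm_nonneg _)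

lemma summable_norm_of_hasSum {c : ℂ} {W : ℤ → Comp p} {a : ℤ → Comp p}
    (hW : Summable fun n => ‖W n‖)
    (h : ∀ m, HasSum (fun n => c • (W n * coeffC p (m - n))) (a m)) :
    Summable fun m => ‖a m‖ :=
  summable_norm_of_hasSum_mul hW (summable_norm_coeffC p) h

end

/-! ### The vector `A`: self-consistency and summability. -/

section

variable {p : Perturbation} {β ε μ : ℝ}

lemma resolvent_eq (hu : IsUnit (1 - (ε : ℂ) • opT p β μ)) (v : Space p) :
    resolvent p β ε μ v = v + (ε : ℂ) • opT p β μ (resolvent p β ε μ v) := by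
  have h1 : (1 - (ε : ℂ) • opT p β μ) * resolvent p β ε μ = 1 := Ring.mul_inverse_cancel _ hu
  have h2 := congrArg (fun T : Space p →L[ℂ] Space p => T v) h1
  exact (sub_eq_iff_eq_add.1 h2).trans rfl

lemma eq_resolvent_of_eq (hu : IsUnit (1 - (ε : ℂ) • opT p β μ)) {A v : Space p}
    (h : A = (ε : ℂ) • opT p β μ A + v) : A = resolvent p β ε μ v := by
  have h1 : resolvent p β ε μ * (1 - (ε : ℂ) • opT p β μ) = 1 := Ring.inverse_mul_cancel _ hu
  have h2 := congrArg (fun T : Space p →L[ℂ] Space p => T A) h1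
  have h3 : (1 - (ε : ℂ) • opT p β μ) A = v := sub_eq_iff_eq_add'.2 h
  rw [← h3]
  exact h2.symm

/-- Averages and Fourier integrals are both of the form `pairing`, so this one expansion yields the
formulas for `C`, `ℛ` and `𝒯`. -/
lemma pairing_vecA {g : ℝ → ℂ} (hg : Continuous g) (m : ℤ) :
    pairing g hg (vecA p β ε μ m) = 2 * ε * gam β μ *
      (pairing g hg (resolvent p β ε μ (gOne p β μ) m) +
        constC p β ε μ / (2 * μ) * pairing g hg (resolvent p β ε μ (gTwo p) m)) := by
  have e : vecA p β ε μ m = (2 * ε * gam β μ : ℂ) • (resolvent p β ε μ (gOne p β μ) m +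
      (constC p β ε μ / (2 * μ)) • resolvent p β ε μ (gTwo p) m) := by
    rw [vecA, gVec, map_add, map_smul]
    rfl
  rw [e, map_smul, map_add, map_smul]
  rfl

/-- The constant `C` is made for this: it solves the self-consistency equation `C = 2εγ (Q + (C/2μ)
F)`. -/
lemma avg_vecA (hμ : 0 < μ) (hd : disp p β ε μ ≠ 0) :
    avg (vecA p β ε μ (-1)) = constC p β ε μ := by
  have hμ' : (μ : ℂ) ≠ 0 := by exact_mod_cast hμ.ne'
  rw [avg_eq_pairing, pairing_vecA, ← avg_eq_pairing, ← avg_eq_pairing]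
  change 2 * ε * gam β μ * (quantQ p β ε μ + constC p β ε μ / (2 * μ) * quantF p β ε μ) = _
  rw [constC]
  field_simp
  rw [disp]
  ring

lemma vecA_eq (hμ : 0 < μ) (hu : IsUnit (1 - (ε : ℂ) • opT p β μ)) (hd : disp p β ε μ ≠ 0) :
    vecA p β ε μ = (ε : ℂ) • opT p β μ (vecA p β ε μ) + (2 * ε * gam β μ : ℂ) •
      ((1 : ℂ) • gOne p β μ + (avg (vecA p β ε μ (-1)) / (2 * μ)) • gTwo p) := by
  rw [avg_vecA hμ hd, one_smul]
  change vecA p β ε μ = (ε : ℂ) • opT p β μ (vecA p β ε μ) + (2 * ε * gam β μ : ℂ) • gVec p β ε μ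
  conv_lhs => rw [vecA, resolvent_eq hu]
  rw [vecA, map_smul, smul_add, add_comm, smul_comm]

/-- `Ψ_m` as an element of `C[-R, R]`. -/
def psiC (p : Perturbation) (β ε μ : ℝ) (m : ℤ) : Comp p :=
  convG β μ m (vecA p β ε μ m) + (1 : ℂ) • if m = 0 then expC p (kZero β μ) else 0

lemma psiC_apply (m : ℤ) (x : Icc (-p.R) p.R) :
    psiC p β ε μ m x = psiComp p β ε μ m x := by
  rw [psiC, psiComp, one_smul, add_comm, ContinuousMap.add_apply]
  congr 1
  split_ifs <;> rfl

lemma hasSum_vecA (hμ : 0 < μ) (hu : IsUnit (1 - (ε : ℂ) • opT p β μ)) (hd : disp p β ε μ ≠ 0)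
    (m : ℤ) : HasSum (fun n => (2 * ε * gam β μ : ℂ) • (psiC p β ε μ n * coeffC p (m - n)))
      (vecA p β ε μ m) :=
  hasSum_of_eq (vecA_eq hμ hu hd) m

lemma continuous_zeroExt_vecA (hμ : 0 < μ) (hu : IsUnit (1 - (ε : ℂ) • opT p β μ))
    (hd : disp p β ε μ ≠ 0) (m : ℤ) : Continuous (zeroExt (vecA p β ε μ m)) :=
  continuous_zeroExt (vanish_of_hasSum (hasSum_vecA hμ hu hd m))

lemma norm_gconv_zeroExt_le {k : ℂ} {a : Comp p} (ha : Continuous (zeroExt a)) {δ : ℝ}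
    (hk : 0 < k.re) (hδ : 0 ≤ δ) (hδk : 2 * δ ≤ k.re) (x : ℝ) :
    ‖gconv k (zeroExt a) x‖ ≤
        2 / (‖k‖ * k.re) * (Real.exp (δ * p.R) * ‖a‖ * Real.exp (-(δ * |x|))) ∧
      ‖gconvDeriv k (zeroExt a) x‖ ≤
        2 / k.re * (Real.exp (δ * p.R) * ‖a‖ * Real.exp (-(δ * |x|))) := by
  have h := integral_exp_mul_norm_le (fun x => zeroExt_of_lt a) (norm_zeroExt_le a) hδ hk hδk x
  have hk0 : 0 < ‖k‖ := hk.trans_le (Complex.re_le_norm k)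
  constructor
  · refine (norm_gconv_le ha (fun x => zeroExt_of_lt a) x).trans
      ((mul_le_mul_of_nonneg_left h (by positivity)).trans (le_of_eq ?_))
    field_simp
    norm_num
  · refine (norm_gconvDeriv_le ha (fun x => zeroExt_of_lt a) x).trans
      ((mul_le_mul_of_nonneg_left h (by positivity)).trans (le_of_eq ?_))
    field_simp
    ring

lemma norm_zeroExt_le_exp (a : Comp p) {δ : ℝ} (hδ : 0 ≤ δ) (x : ℝ) :
    ‖zeroExt a x‖ ≤ Real.exp (δ * p.R) * ‖a‖ * Real.exp (-(δ * |x|)) := by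
  by_cases hx : p.R < |x|
  · rw [zeroExt_of_lt a hx, norm_zero]
    positivity
  · have h1 : 1 ≤ Real.exp (δ * p.R) * Real.exp (-(δ * |x|)) := by
      rw [← Real.exp_add]
      refine Real.one_le_exp ?_
      nlinarith [not_lt.1 hx]
    calc ‖zeroExt a x‖ ≤ ‖a‖ := norm_zeroExt_le a x
      _ ≤ ‖a‖ * (Real.exp (δ * p.R) * Real.exp (-(δ * |x|))) :=
        le_mul_of_one_le_right (norm_nonneg _) h1
      _ = _ := by ring

/-- The norms `‖A_m‖` are merely bounded by `‖A‖` here, and the gain comes from the Green function,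
whose convolution costs `2/k_m² ≤ 2/(c m)²`. The single mode `m = 0` does not affect summability. -/
lemma summable_norm_psiC (hβ : 0 < β) (hβ' : β < 1 / 2) (hμ : 0 < μ)
    (hu : IsUnit (1 - (ε : ℂ) • opT p β μ)) (hd : disp p β ε μ ≠ 0) :
    Summable fun n => ‖psiC p β ε μ n‖ := by
  obtain ⟨c, hc, hck⟩ := exists_le_re_waveNumber hβ hβ' hμ
  have h1 : Summable fun m : ℤ => 2 / c ^ 2 * ‖vecA p β ε μ‖ * (1 / (m : ℝ) ^ 2) :=
    (Real.summable_one_div_int_pow.2 (by norm_num)).mul_left _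
  refine Summable.of_norm_bounded_eventually h1 ?_
  rw [eventually_cofinite]
  refine (finite_singleton (0 : ℤ)).subset fun m hm => ?_
  by_contra h0
  rw [mem_singleton_iff] at h0
  refine hm ?_
  rw [norm_norm, ContinuousMap.norm_le _ (by positivity)]
  intro x
  have hm1 : 0 < |(m : ℝ)| := by simpa using h0
  have hk := hck m h0
  have hk0 : 0 < (waveNumber β μ m).re := lt_of_lt_of_le (by positivity) hk
  rw [psiC_apply, psiComp, if_neg h0, zero_add, conv_green]
  refine (norm_gconv_zeroExt_le (continuous_zeroExt_vecA hμ hu hd m) hk0 le_rfl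
    (by simpa using hk0.le) x).1.trans ?_
  have h2 : ‖vecA p β ε μ m‖ ≤ ‖vecA p β ε μ‖ := lp.norm_apply_le_norm (by norm_num) _ m
  simp only [zero_mul, neg_zero, Real.exp_zero, one_mul, mul_one]
  rw [norm_waveNumber hμ h0]
  have h3 : c ^ 2 * (m : ℝ) ^ 2 ≤ (waveNumber β μ m).re * (waveNumber β μ m).re := by
    rw [← mul_pow, ← sq]
    refine sq_le_sq' ?_ ?_
    · have := neg_le_abs (m : ℝ)
      nlinarith
    · have := le_abs_self (m : ℝ)
      nlinarith
  have hm2 : 0 < (m : ℝ) ^ 2 := by rw [← sq_abs]; positivity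
  calc _ ≤ 2 / (c ^ 2 * (m : ℝ) ^ 2) * ‖vecA p β ε μ‖ := by gcongr
    _ = _ := by field_simp

/-- Bootstrap from `ℓ²` to `ℓ¹`: by the fixed-point equation `A` is the convolution of the summable
sequences `Ψ_n` and `f_j`. -/
lemma summable_norm_vecA (hβ : 0 < β) (hβ' : β < 1 / 2) (hμ : 0 < μ)
    (hu : IsUnit (1 - (ε : ℂ) • opT p β μ)) (hd : disp p β ε μ ≠ 0) :
    Summable fun n => ‖vecA p β ε μ n‖ :=
  summable_norm_of_hasSum (summable_norm_psiC hβ hβ' hμ hu hd) (hasSum_vecA hμ hu hd)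

/-- Since `C/(2μ) = εγQ/(μ - εγF)`, the bracket in `ℛ` is linear in the two resolvent vectors with
the weights of `A`. The result is the amplitude of `G_0 * A_0` to the left of the support. -/
lemma reflCoeff_eq (hμ : 0 < μ) (hk : 0 < kZero β μ) (hd : disp p β ε μ ≠ 0) :
    reflCoeff p β ε μ =
      Complex.I / (2 * kZero β μ) * avgExp (kZero β μ) (vecA p β ε μ 0) := by
  have hμ' : (μ : ℂ) ≠ 0 := by exact_mod_cast hμ.ne'
  have hk' : (kZero β μ : ℂ) ≠ 0 := by exact_mod_cast hk.ne'
  rw [avgExp_eq_pairing, pairing_vecA, ← avgExp_eq_pairing, ← avgExp_eq_pairing]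
  change _ = Complex.I / (2 * kZero β μ) * (2 * ε * gam β μ *
    (quantPplus p β ε μ + constC p β ε μ / (2 * μ) * quantRplus p β ε μ))
  rw [reflCoeff, constC]
  field_simp

lemma transCoeff_eq (hμ : 0 < μ) (hk : 0 < kZero β μ) (hd : disp p β ε μ ≠ 0) :
    transCoeff p β ε μ =
      1 + Complex.I / (2 * kZero β μ) * avgExp (-kZero β μ) (vecA p β ε μ 0) := by
  have hμ' : (μ : ℂ) ≠ 0 := by exact_mod_cast hμ.ne'
  have hk' : (kZero β μ : ℂ) ≠ 0 := by exact_mod_cast hk.ne'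
  rw [avgExp_eq_pairing, pairing_vecA, ← avgExp_eq_pairing, ← avgExp_eq_pairing]
  change _ = 1 + Complex.I / (2 * kZero β μ) * (2 * ε * gam β μ *
    (quantPminus p β ε μ + constC p β ε μ / (2 * μ) * quantRminus p β ε μ))
  rw [transCoeff, constC]
  field_simp

end

/-! ### Series of transversal modes and their derivatives. -/

/-- The series `∑ₙ a_n(x) e^{i(β+n)y}`. -/
def modeSum (β : ℝ) (a : ℤ → ℝ → ℂ) (q : ℝ × ℝ) : ℂ :=
  ∑' n : ℤ, a n q.1 * Complex.exp (Complex.I * (β + n) * q.2)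

lemma norm_modeExp (β : ℝ) (n : ℤ) (y : ℝ) : ‖Complex.exp (Complex.I * (β + n) * y)‖ = 1 := by
  rw [Complex.norm_exp]
  simp

lemma dX_eq_of_hasFDerivAt {u : ℝ × ℝ → ℂ} {L : ℝ × ℝ →L[ℝ] ℂ} {q : ℝ × ℝ}
    (h : HasFDerivAt u L q) : dX u q = L (1, 0) :=
  (h.comp_hasDerivAt q.1 ((hasDerivAt_id q.1).prodMk (hasDerivAt_const q.1 q.2))).deriv

lemma dY_eq_of_hasFDerivAt {u : ℝ × ℝ → ℂ} {L : ℝ × ℝ →L[ℝ] ℂ} {q : ℝ × ℝ}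
    (h : HasFDerivAt u L q) : dY u q = L (0, 1) :=
  (h.comp_hasDerivAt q.2 ((hasDerivAt_const q.2 q.1).prodMk (hasDerivAt_id q.2))).deriv

section

variable {β : ℝ} {a a' a'' : ℤ → ℝ → ℂ} {b : ℤ → ℝ}

lemma summable_mode (hb : Summable b) (h : ∀ n x, ‖a n x‖ ≤ b n) (q : ℝ × ℝ) :
    Summable fun n : ℤ => a n q.1 * Complex.exp (Complex.I * (β + n) * q.2) :=
  Summable.of_norm_bounded hb fun n => by
    rw [norm_mul, norm_modeExp, mul_one]
    exact h n q.1

lemma continuous_modeSum (hb : Summable b) (ha : ∀ n, Continuous (a n))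
    (h : ∀ n x, ‖a n x‖ ≤ b n) : Continuous (modeSum β a) := by
  refine continuous_tsum (fun n => ?_) hb fun n q => ?_
  · exact ((ha n).comp continuous_fst).mul (by fun_prop)
  · rw [norm_mul, norm_modeExp, mul_one]
    exact h n q.1

lemma norm_modeSum_le {q : ℝ × ℝ} {w : ℝ} (hb : Summable b) (h : ∀ n, ‖a n q.1‖ ≤ b n * w) :
    ‖modeSum β a q‖ ≤ (∑' n, b n) * w := by
  rw [← tsum_mul_right]
  refine tsum_of_norm_bounded (hb.mul_right w).hasSum fun n => ?_
  rw [norm_mul, norm_modeExp, mul_one]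
  exact h n

lemma norm_mul_modeFactor_le (hβ : |β| ≤ 1) (n : ℤ) (z : ℂ) :
    ‖Complex.I * (β + n) * z‖ ≤ (1 + |(n : ℝ)|) * ‖z‖ := by
  rw [norm_mul, norm_mul, Complex.norm_I, one_mul]
  refine mul_le_mul_of_nonneg_right ((norm_add_le _ _).trans ?_) (norm_nonneg _)
  rw [Complex.norm_real, Complex.norm_intCast]
  exact add_le_add hβ le_rfl

/-- Termwise differentiation: the factor `β + n` produced by the `y` derivative is at most `1 +
|n|`, which is the weight in the bound on `a n`. -/
lemma hasFDerivAt_modeSum (hβ : |β| ≤ 1) (hb : Summable b)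
    (hd : ∀ n x, HasDerivAt (a n) (a' n x) x)
    (h : ∀ (n : ℤ) x, (1 + |(n : ℝ)|) * ‖a n x‖ ≤ b n) (h' : ∀ n x, ‖a' n x‖ ≤ b n) (q : ℝ × ℝ) :
    HasFDerivAt (modeSum β a)
      ((ContinuousLinearMap.fst ℝ ℝ ℝ).smulRight (modeSum β a' q) +
        (ContinuousLinearMap.snd ℝ ℝ ℝ).smulRight
          (modeSum β (fun n x => Complex.I * (β + n) * a n x) q)) q := by
  have h0 : ∀ n x, ‖a n x‖ ≤ b n := fun n x =>
    (le_mul_of_one_le_left (norm_nonneg _) (by linarith [abs_nonneg (n : ℝ)])).trans (h n x)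
  have h1 : ∀ n x, ‖Complex.I * (β + n) * a n x‖ ≤ b n := fun n x =>
    (norm_mul_modeFactor_le hβ n _).trans (h n x)
  have s1 := (summable_mode (β := β) hb h' q).hasSum
  have s2 := (summable_mode (β := β) hb h1 q).hasSum
  have s3 := (s1.mapL (ContinuousLinearMap.smulRightL ℝ (ℝ × ℝ) ℂ
    (ContinuousLinearMap.fst ℝ ℝ ℝ))).add (s2.mapL (ContinuousLinearMap.smulRightL ℝ (ℝ × ℝ) ℂ
    (ContinuousLinearMap.snd ℝ ℝ ℝ)))
  refine HasFDerivAt.congr_fderiv ?_ s3.tsum_eq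
  refine hasFDerivAt_tsum (u := fun n => 2 * b n) (f := fun (n : ℤ) (q : ℝ × ℝ) =>
    a n q.1 * Complex.exp (Complex.I * (β + n) * q.2))
    (f' := fun (n : ℤ) (q : ℝ × ℝ) => (ContinuousLinearMap.fst ℝ ℝ ℝ).smulRight
      (a' n q.1 * Complex.exp (Complex.I * (β + n) * q.2)) +
      (ContinuousLinearMap.snd ℝ ℝ ℝ).smulRight
        (Complex.I * (β + n) * a n q.1 * Complex.exp (Complex.I * (β + n) * q.2)))
    (hb.mul_left 2) (fun n q => ?_) (fun n q => ?_) (summable_mode hb h0 q) q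
  · have e1 : HasFDerivAt (fun q : ℝ × ℝ => a n q.1)
        ((ContinuousLinearMap.fst ℝ ℝ ℝ).smulRight (a' n q.1)) q :=
      ((hd n q.1).hasFDerivAt.comp q hasFDerivAt_fst).congr_fderiv (by ext <;> simp)
    have e2 : HasFDerivAt (fun q : ℝ × ℝ => Complex.exp (Complex.I * (β + n) * q.2))
        ((ContinuousLinearMap.snd ℝ ℝ ℝ).smulRight
          (Complex.I * (β + n) * Complex.exp (Complex.I * (β + n) * q.2))) q :=
      ((hasDerivAt_cexp_mul (Complex.I * (β + n)) q.2).hasFDerivAt.comp q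
        hasFDerivAt_snd).congr_fderiv (by ext <;> simp)
    refine (e1.mul e2).congr_fderiv ?_
    ext <;> simp <;> ring
  · refine (norm_add_le _ _).trans ?_
    rw [ContinuousLinearMap.norm_smulRight_apply, ContinuousLinearMap.norm_smulRight_apply,
      norm_mul, norm_mul, norm_modeExp, mul_one, mul_one, two_mul]
    refine add_le_add ?_ ?_
    · exact (mul_le_of_le_one_left (norm_nonneg _) (ContinuousLinearMap.norm_fst_le ℝ ℝ ℝ)).trans
        (h' n _)
    · exact (mul_le_of_le_one_left (norm_nonneg _) (ContinuousLinearMap.norm_snd_le ℝ ℝ ℝ)).trans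
        (h1 n _)

lemma dX_modeSum (hβ : |β| ≤ 1) (hb : Summable b) (hd : ∀ n x, HasDerivAt (a n) (a' n x) x)
    (h : ∀ (n : ℤ) x, (1 + |(n : ℝ)|) * ‖a n x‖ ≤ b n) (h' : ∀ n x, ‖a' n x‖ ≤ b n) :
    dX (modeSum β a) = modeSum β a' := by
  funext q
  rw [dX_eq_of_hasFDerivAt (hasFDerivAt_modeSum hβ hb hd h h' q)]
  simp

lemma dY_modeSum (hβ : |β| ≤ 1) (hb : Summable b) (hd : ∀ n x, HasDerivAt (a n) (a' n x) x)
    (h : ∀ (n : ℤ) x, (1 + |(n : ℝ)|) * ‖a n x‖ ≤ b n) (h' : ∀ n x, ‖a' n x‖ ≤ b n) :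
    dY (modeSum β a) = modeSum β fun n x => Complex.I * (β + n) * a n x := by
  funext q
  rw [dY_eq_of_hasFDerivAt (hasFDerivAt_modeSum hβ hb hd h h' q)]
  simp

lemma contDiff_one_modeSum (hβ : |β| ≤ 1) (hb : Summable b)
    (hd : ∀ n x, HasDerivAt (a n) (a' n x) x) (hc : ∀ n, Continuous (a' n))
    (h : ∀ (n : ℤ) x, (1 + |(n : ℝ)|) * ‖a n x‖ ≤ b n) (h' : ∀ n x, ‖a' n x‖ ≤ b n) :
    ContDiff ℝ 1 (modeSum β a) := by
  refine contDiff_one_iff_hasFDerivAt.2 ⟨_, ?_, hasFDerivAt_modeSum hβ hb hd h h'⟩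
  have c1 : Continuous (modeSum β a') := continuous_modeSum hb hc h'
  have c2 : Continuous (modeSum β fun n x => Complex.I * (β + n) * a n x) :=
    continuous_modeSum hb (fun n => continuous_const.mul
      (continuous_iff_continuousAt.2 fun x => (hd n x).continuousAt)) fun n x =>
      (norm_mul_modeFactor_le hβ n _).trans (h n x)
  exact ((ContinuousLinearMap.smulRightL ℝ (ℝ × ℝ) ℂ _).continuous.comp c1).add
    ((ContinuousLinearMap.smulRightL ℝ (ℝ × ℝ) ℂ _).continuous.comp c2)

/-- Two derivatives of the coefficients `a_n`, with bounds that make `∑ₙ a_n(x) e^{i(β+n)y}` of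
class `C²` with decay `e^{-δ|x|}`. -/
structure ModeBounds (a a' a'' : ℤ → ℝ → ℂ) (b : ℤ → ℝ) (δ : ℝ) : Prop where
  summable : Summable b
  hasDerivAt : ∀ n x, HasDerivAt (a n) (a' n x) x
  hasDerivAt' : ∀ n x, HasDerivAt (a' n) (a'' n x) x
  continuous : ∀ n, Continuous (a'' n)
  nonneg : 0 ≤ δ
  bound : ∀ (n : ℤ) x, (1 + |(n : ℝ)|) ^ 2 * ‖a n x‖ ≤ b n * Real.exp (-(δ * |x|))
  bound' : ∀ (n : ℤ) x, (1 + |(n : ℝ)|) * ‖a' n x‖ ≤ b n * Real.exp (-(δ * |x|))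
  bound'' : ∀ n x, ‖a'' n x‖ ≤ b n * Real.exp (-(δ * |x|))

namespace ModeBounds

variable {δ : ℝ}

lemma b_nonneg (h : ModeBounds a a' a'' b δ) (n : ℤ) : 0 ≤ b n :=
  nonneg_of_mul_nonneg_left ((norm_nonneg _).trans (h.bound'' n 0)) (Real.exp_pos _)

lemma mul_exp_le (h : ModeBounds a a' a'' b δ) (n : ℤ) (x : ℝ) : b n * Real.exp (-(δ * |x|)) ≤ b n :=
  mul_le_of_le_one_right (h.b_nonneg n)
    (Real.exp_le_one_iff.2 (neg_nonpos.2 (mul_nonneg h.nonneg (abs_nonneg x))))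

lemma bound_one (h : ModeBounds a a' a'' b δ) (n : ℤ) (x : ℝ) :
    (1 + |(n : ℝ)|) * ‖a n x‖ ≤ b n * Real.exp (-(δ * |x|)) := by
  refine le_trans ?_ (h.bound n x)
  have := abs_nonneg (n : ℝ)
  refine mul_le_mul_of_nonneg_right ?_ (norm_nonneg _)
  nlinarith

lemma bound_zero (h : ModeBounds a a' a'' b δ) (n : ℤ) (x : ℝ) : ‖a n x‖ ≤ b n * Real.exp (-(δ * |x|)) :=
  (le_mul_of_one_le_left (norm_nonneg _) (by linarith [abs_nonneg (n : ℝ)])).trans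
    (h.bound_one n x)

lemma bound'_zero (h : ModeBounds a a' a'' b δ) (n : ℤ) (x : ℝ) : ‖a' n x‖ ≤ b n * Real.exp (-(δ * |x|)) :=
  (le_mul_of_one_le_left (norm_nonneg _) (by linarith [abs_nonneg (n : ℝ)])).trans
    (h.bound' n x)

lemma bound_modeFactor (h : ModeBounds a a' a'' b δ) (hβ : |β| ≤ 1) (n : ℤ) (x : ℝ) :
    (1 + |(n : ℝ)|) * ‖Complex.I * (β + n) * a n x‖ ≤ b n * Real.exp (-(δ * |x|)) := by
  refine le_trans ?_ (h.bound n x)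
  have hn := abs_nonneg (n : ℝ)
  refine (mul_le_mul_of_nonneg_left (norm_mul_modeFactor_le hβ n (a n x))
    (by linarith : 0 ≤ 1 + |(n : ℝ)|)).trans (le_of_eq (by ring))

lemma dX_eq (h : ModeBounds a a' a'' b δ) (hβ : |β| ≤ 1) : dX (modeSum β a) = modeSum β a' :=
  dX_modeSum hβ h.summable h.hasDerivAt
    (fun n x => (h.bound_one n x).trans (h.mul_exp_le n x))
    fun n x => (h.bound'_zero n x).trans (h.mul_exp_le n x)

lemma dX_dX_eq (h : ModeBounds a a' a'' b δ) (hβ : |β| ≤ 1) : dX (dX (modeSum β a)) = modeSum β a'' := by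
  rw [h.dX_eq hβ]
  exact dX_modeSum hβ h.summable h.hasDerivAt'
    (fun n x => (h.bound' n x).trans (h.mul_exp_le n x))
    fun n x => (h.bound'' n x).trans (h.mul_exp_le n x)

lemma norm_modeFactor_deriv_le (h : ModeBounds a a' a'' b δ) (hβ : |β| ≤ 1) (n : ℤ) (x : ℝ) :
    ‖Complex.I * (β + n) * a' n x‖ ≤ b n :=
  (norm_mul_modeFactor_le hβ n _).trans ((h.bound' n x).trans (h.mul_exp_le n x))

lemma dY_eq (h : ModeBounds a a' a'' b δ) (hβ : |β| ≤ 1) :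
    dY (modeSum β a) = modeSum β fun n x => Complex.I * (β + n) * a n x :=
  dY_modeSum hβ h.summable h.hasDerivAt
    (fun n x => (h.bound_one n x).trans (h.mul_exp_le n x))
    fun n x => (h.bound'_zero n x).trans (h.mul_exp_le n x)

lemma dY_dY_eq (h : ModeBounds a a' a'' b δ) (hβ : |β| ≤ 1) : dY (dY (modeSum β a)) =
    modeSum β fun n x => Complex.I * (β + n) * (Complex.I * (β + n) * a n x) := by
  rw [h.dY_eq hβ]
  exact dY_modeSum hβ h.summable (fun n x => (h.hasDerivAt n x).const_mul _)
    (fun n x => (h.bound_modeFactor hβ n x).trans (h.mul_exp_le n x))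
    (h.norm_modeFactor_deriv_le hβ)

lemma contDiff_two (h : ModeBounds a a' a'' b δ) (hβ : |β| ≤ 1) : ContDiff ℝ 2 (modeSum β a) := by
  have hc' : ∀ n, Continuous (a' n) := fun n =>
    continuous_iff_continuousAt.2 fun x => (h.hasDerivAt' n x).continuousAt
  have c1 : ContDiff ℝ 1 (modeSum β a') := contDiff_one_modeSum hβ h.summable h.hasDerivAt'
    h.continuous (fun n x => (h.bound' n x).trans (h.mul_exp_le n x))
    fun n x => (h.bound'' n x).trans (h.mul_exp_le n x)
  have c2 : ContDiff ℝ 1 (modeSum β fun n x => Complex.I * (β + n) * a n x) :=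
    contDiff_one_modeSum hβ h.summable (fun n x => (h.hasDerivAt n x).const_mul _)
      (fun n => continuous_const.mul (hc' n))
      (fun n x => (h.bound_modeFactor hβ n x).trans (h.mul_exp_le n x))
      (h.norm_modeFactor_deriv_le hβ)
  -- The total derivative is assembled from the two first partial derivatives, which are mode series
  -- of class `C¹` by `c1` and `c2`.
  rw [show (2 : ℕ∞ω) = ((1 : ℕ) : ℕ∞ω) + 1 by norm_num, contDiff_succ_iff_hasFDerivAt]
  refine ⟨_, ?_, hasFDerivAt_modeSum hβ h.summable h.hasDerivAt
    (fun n x => (h.bound_one n x).trans (h.mul_exp_le n x))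
    fun n x => (h.bound'_zero n x).trans (h.mul_exp_le n x)⟩
  exact ((ContinuousLinearMap.smulRightL ℝ (ℝ × ℝ) ℂ _).contDiff.comp c1).add
    ((ContinuousLinearMap.smulRightL ℝ (ℝ × ℝ) ℂ _).contDiff.comp c2)

lemma norm_le (h : ModeBounds a a' a'' b δ) (q : ℝ × ℝ) : ‖modeSum β a q‖ ≤ (∑' n, b n) * Real.exp (-(δ * |q.1|)) :=
  norm_modeSum_le h.summable fun n => h.bound_zero n q.1

lemma norm_dX_le (h : ModeBounds a a' a'' b δ) (hβ : |β| ≤ 1) (q : ℝ × ℝ) :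
    ‖dX (modeSum β a) q‖ ≤ (∑' n, b n) * Real.exp (-(δ * |q.1|)) := by
  rw [h.dX_eq hβ]
  exact norm_modeSum_le h.summable fun n => h.bound'_zero n q.1

lemma norm_dY_le (h : ModeBounds a a' a'' b δ) (hβ : |β| ≤ 1) (q : ℝ × ℝ) :
    ‖dY (modeSum β a) q‖ ≤ (∑' n, b n) * Real.exp (-(δ * |q.1|)) := by
  rw [h.dY_eq hβ]
  exact norm_modeSum_le h.summable fun n =>
    (norm_mul_modeFactor_le hβ n _).trans (h.bound_one n q.1)

end ModeBounds

lemma modeSum_add_two_pi (β : ℝ) (a : ℤ → ℝ → ℂ) (x y : ℝ) :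
    modeSum β a (x, y + 2 * π) = Complex.exp (2 * π * Complex.I * β) * modeSum β a (x, y) := by
  simp only [modeSum]
  rw [← tsum_mul_left]
  refine tsum_congr fun n => ?_
  rw [mul_left_comm, ← Complex.exp_add]
  congr 1
  rw [Complex.exp_eq_exp_iff_exists_int]
  refine ⟨n, ?_⟩
  push_cast
  ring

/-- Quasiperiodicity on the whole plane can be differentiated in `y`, which gives the condition on
`u_y` for free. -/
lemma quasiBC_of_forall {u : ℝ × ℝ → ℂ}
    (h : ∀ x y, u (x, y + 2 * π) = Complex.exp (2 * π * Complex.I * β) * u (x, y)) :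
    QuasiBC β u := by
  intro x
  have h0 := h x 0
  rw [zero_add] at h0
  refine ⟨h0, ?_⟩
  have e : (fun s => u (x, s + 2 * π)) = fun s => Complex.exp (2 * π * Complex.I * β) * u (x, s) :=
    funext fun s => h x s
  have e2 := congrArg (fun g => deriv g 0) e
  rw [deriv_comp_add_const (fun s => u (x, s)), zero_add, deriv_const_mul_field] at e2
  exact e2

end

/-! ### The leading part at infinity and decay bounds for the modes. -/

lemma exists_exp_bound {g : ℝ → ℂ} (hg : Continuous g) (hs : HasCompactSupport g) (δ : ℝ) :
    ∃ B, ∀ x, ‖g x‖ ≤ B * Real.exp (-(δ * |x|)) := by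
  have hc : Continuous fun x => (Real.exp (δ * |x|) : ℂ) * g x := by fun_prop
  obtain ⟨B, hB⟩ := hc.bounded_above_of_compact_support hs.mul_left
  refine ⟨B, fun x => ?_⟩
  have h1 := hB x
  rw [norm_mul, Complex.norm_real, Real.norm_of_nonneg (Real.exp_pos _).le] at h1
  rw [Real.exp_neg, ← div_eq_mul_inv, le_div_iff₀ (Real.exp_pos _), mul_comm]
  exact h1

/-- The leading part at infinity of the mode `n = 0`. -/
def leadingMode (β μ : ℝ) (r t : ℂ) (x : ℝ) : ℂ :=
  (Real.smoothTransition x : ℂ) * (t * Complex.exp (Complex.I * kZero β μ * x)) +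
    (Real.smoothTransition (-x) : ℂ) * (Complex.exp (Complex.I * kZero β μ * x) +
      r * Complex.exp (-(Complex.I * kZero β μ * x)))

lemma leading_eq (β μ : ℝ) (r t : ℂ) (q : ℝ × ℝ) :
    leading β μ r t q = leadingMode β μ r t q.1 * Complex.exp (Complex.I * β * q.2) := by
  simp only [leading, leadingMode, Complex.exp_add, sub_eq_add_neg]
  ring

lemma contDiff_smoothTransition_ofReal :
    ContDiff ℝ ∞ fun x : ℝ => (Real.smoothTransition x : ℂ) :=
  Complex.ofRealCLM.contDiff.comp Real.smoothTransition.contDiff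

lemma contDiff_cexp_mul (k : ℂ) : ContDiff ℝ ∞ fun x : ℝ => Complex.exp (k * x) :=
  (contDiff_const.mul Complex.ofRealCLM.contDiff).cexp

lemma contDiff_leadingMode (β μ : ℝ) (r t : ℂ) : ContDiff ℝ ∞ (leadingMode β μ r t) := by
  have h1 := contDiff_smoothTransition_ofReal
  have h2 : ContDiff ℝ ∞ fun x : ℝ => (Real.smoothTransition (-x) : ℂ) := h1.comp contDiff_neg
  have h3 := contDiff_cexp_mul (Complex.I * kZero β μ)
  have h4 : ContDiff ℝ ∞ fun x : ℝ => Complex.exp (-(Complex.I * kZero β μ * x)) := by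
    simpa only [neg_mul] using contDiff_cexp_mul (-(Complex.I * kZero β μ))
  exact (h1.mul (contDiff_const.mul h3)).add (h2.mul (h3.add (contDiff_const.mul h4)))

lemma contDiff_leading (β μ : ℝ) (r t : ℂ) : ContDiff ℝ ∞ (leading β μ r t) := by
  rw [show leading β μ r t = _ from funext (leading_eq β μ r t)]
  exact ((contDiff_leadingMode β μ r t).comp contDiff_fst).mul
    ((contDiff_cexp_mul (Complex.I * β)).comp contDiff_snd)

lemma leadingMode_of_one_le (β μ : ℝ) (r t : ℂ) {x : ℝ} (hx : 1 ≤ x) :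
    leadingMode β μ r t x = t * Complex.exp (Complex.I * kZero β μ * x) := by
  rw [leadingMode, Real.smoothTransition.one_of_one_le hx,
    Real.smoothTransition.zero_of_nonpos (by linarith)]
  simp

lemma leadingMode_of_le_neg_one (β μ : ℝ) (r t : ℂ) {x : ℝ} (hx : x ≤ -1) :
    leadingMode β μ r t x = Complex.exp (Complex.I * kZero β μ * x) +
      r * Complex.exp (-(Complex.I * kZero β μ * x)) := by
  rw [leadingMode, Real.smoothTransition.zero_of_nonpos (by linarith),
    Real.smoothTransition.one_of_one_le (by linarith)]
  simp

/-- For `n ≠ 0` the weights `1 + |n|` are absorbed by `k_n ≥ c (1 + |n|)`, which gives `2/c²` and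
`2/c`; in the second derivative `k_n² (G_n * A_n) - A_n` the two terms cost `2 + 1 = 3`. Mode `0`
has no decay from its Green function, so its bound `B` is an input. The lemma serves `Ψ` with `δ =
0` and the remainder with `δ > 0`. -/
lemma modeBounds_of_gconv {p : Perturbation} {β μ c δ B : ℝ} {A : ℤ → Comp p}
    {a a' a'' : ℤ → ℝ → ℂ} (hμ : 0 < μ) (hc : 0 < c)
    (hck : ∀ m : ℤ, m ≠ 0 → c * (1 + |(m : ℝ)|) ≤ (waveNumber β μ m).re)
    (hδ : 0 ≤ δ) (hδc : 2 * δ ≤ c) (hA : ∀ n, Continuous (zeroExt (A n)))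
    (hs : Summable fun n => ‖A n‖)
    (hd : ∀ n x, HasDerivAt (a n) (a' n x) x) (hd' : ∀ n x, HasDerivAt (a' n) (a'' n x) x)
    (hcont : ∀ n, Continuous (a'' n))
    (ha : ∀ n x, n ≠ 0 → a n x = gconv (waveNumber β μ n) (zeroExt (A n)) x)
    (ha' : ∀ n x, n ≠ 0 → a' n x = gconvDeriv (waveNumber β μ n) (zeroExt (A n)) x)
    (ha'' : ∀ n x, n ≠ 0 → a'' n x =
      waveNumber β μ n ^ 2 * gconv (waveNumber β μ n) (zeroExt (A n)) x - zeroExt (A n) x)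
    (h0 : ∀ x, ‖a 0 x‖ ≤ B * Real.exp (-(δ * |x|)) ∧ ‖a' 0 x‖ ≤ B * Real.exp (-(δ * |x|)) ∧
      ‖a'' 0 x‖ ≤ B * Real.exp (-(δ * |x|))) :
    ModeBounds a a' a'' (fun n => (if n = 0 then B else 0) +
      Real.exp (δ * p.R) * (2 / c ^ 2 + 2 / c + 3) * ‖A n‖) δ := by
  have hD : ∀ n, 0 ≤ Real.exp (δ * p.R) * (2 / c ^ 2 + 2 / c + 3) * ‖A n‖ := fun n => by
    positivity
  have key : ∀ (n : ℤ) x, n ≠ 0 →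
      (1 + |(n : ℝ)|) ^ 2 * ‖a n x‖ ≤
        Real.exp (δ * p.R) * (2 / c ^ 2) * ‖A n‖ * Real.exp (-(δ * |x|)) ∧
      (1 + |(n : ℝ)|) * ‖a' n x‖ ≤
        Real.exp (δ * p.R) * (2 / c) * ‖A n‖ * Real.exp (-(δ * |x|)) ∧
      ‖a'' n x‖ ≤ Real.exp (δ * p.R) * 3 * ‖A n‖ * Real.exp (-(δ * |x|)) := by
    intro n x hn
    have hk := hck n hn
    have hn1 : 1 ≤ 1 + |(n : ℝ)| := by linarith [abs_nonneg (n : ℝ)]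
    have hk0 : 0 < (waveNumber β μ n).re := lt_of_lt_of_le (by positivity) hk
    have hδk : 2 * δ ≤ (waveNumber β μ n).re := by nlinarith
    obtain ⟨b1, b2⟩ := norm_gconv_zeroExt_le (hA n) hk0 hδ hδk x
    have b3 := norm_zeroExt_le_exp (A n) hδ x
    rw [norm_waveNumber hμ hn] at b1
    rw [ha n x hn, ha' n x hn, ha'' n x hn]
    have hW : 0 ≤ Real.exp (δ * p.R) * ‖A n‖ * Real.exp (-(δ * |x|)) := by positivity
    have r1 : ∀ z : ℝ, Real.exp (δ * p.R) * z * ‖A n‖ * Real.exp (-(δ * |x|)) =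
        z * (Real.exp (δ * p.R) * ‖A n‖ * Real.exp (-(δ * |x|))) := fun z => by ring
    rw [r1, r1, r1]
    generalize Real.exp (δ * p.R) * ‖A n‖ * Real.exp (-(δ * |x|)) = W at b1 b2 b3 hW
    have hk' := norm_waveNumber (β := β) hμ hn
    generalize waveNumber β μ n = k at *
    generalize 1 + |(n : ℝ)| = s at *
    have e1 : s / k.re ≤ 1 / c := by
      rw [div_le_div_iff₀ hk0 hc]
      linarith
    have hs0 : 0 ≤ s / k.re := by positivity
    refine ⟨?_, ?_, ?_⟩
    · calc s ^ 2 * ‖gconv k (zeroExt (A n)) x‖ ≤ s ^ 2 * (2 / (k.re * k.re) * W) := by gcongr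
        _ = (s / k.re) ^ 2 * (2 * W) := by field_simp
        _ ≤ (1 / c) ^ 2 * (2 * W) := by gcongr
        _ = _ := by field_simp
    · calc s * ‖gconvDeriv k (zeroExt (A n)) x‖ ≤ s * (2 / k.re * W) := by gcongr
        _ = s / k.re * (2 * W) := by field_simp
        _ ≤ 1 / c * (2 * W) := by gcongr
        _ = _ := by field_simp
    · calc ‖k ^ 2 * gconv k (zeroExt (A n)) x - zeroExt (A n) x‖
          ≤ ‖k ^ 2 * gconv k (zeroExt (A n)) x‖ + ‖zeroExt (A n) x‖ := norm_sub_le _ _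
        _ = k.re ^ 2 * ‖gconv k (zeroExt (A n)) x‖ + ‖zeroExt (A n) x‖ := by
          rw [norm_mul, norm_pow, hk']
        _ ≤ k.re ^ 2 * (2 / (k.re * k.re) * W) + W := by gcongr
        _ = 3 * W := by field_simp; ring
  have fin : ∀ (n : ℤ) x (u v : ℝ), 0 ≤ v → v ≤ 2 / c ^ 2 + 2 / c + 3 →
      (n = 0 → u ≤ B * Real.exp (-(δ * |x|))) →
      (n ≠ 0 → u ≤ Real.exp (δ * p.R) * v * ‖A n‖ * Real.exp (-(δ * |x|))) →
      u ≤ ((if n = 0 then B else 0) + Real.exp (δ * p.R) * (2 / c ^ 2 + 2 / c + 3) * ‖A n‖) *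
        Real.exp (-(δ * |x|)) := by
    intro n x u v hv hv' h1 h2
    by_cases hn : n = 0
    · rw [if_pos hn]
      refine (h1 hn).trans (mul_le_mul_of_nonneg_right ?_ (Real.exp_pos _).le)
      linarith [hD n]
    · rw [if_neg hn, zero_add]
      refine (h2 hn).trans ?_
      gcongr
  have c1 : 0 ≤ 2 / c ^ 2 := by positivity
  have c2 : 0 ≤ 2 / c := by positivity
  refine ⟨?_, hd, hd', hcont, hδ, fun n x => ?_, fun n x => ?_, fun n x => ?_⟩
  · exact (hasSum_ite_eq 0 B).summable.add (hs.mul_left _)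
  · refine fin n x _ _ c1 (by linarith) ?_ fun hn => (key n x hn).1
    rintro rfl
    simpa using (h0 x).1
  · refine fin n x _ _ c2 (by linarith) ?_ fun hn => (key n x hn).2.1
    rintro rfl
    simpa using (h0 x).2.1
  · refine fin n x _ 3 (by norm_num) (by linarith) ?_ fun hn => (key n x hn).2.2
    rintro rfl
    exact (h0 x).2.2

/-! ### `Ψ` is a classical solution, with its asymptotics. -/

section

variable {p : Perturbation} {β ε μ : ℝ}

lemma psiComp_eq (n : ℤ) (x : ℝ) : psiComp p β ε μ n x =
    (if n = 0 then Complex.exp (-(waveNumber β μ n * x)) else 0) +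
      gconv (waveNumber β μ n) (zeroExt (vecA p β ε μ n)) x := by
  rw [psiComp, conv_green]
  congr 1
  split_ifs with h
  · rw [h, waveNumber_zero, neg_mul, neg_neg]
  · rfl

/-- The derivative of `Ψ_n`. -/
def psiDeriv (p : Perturbation) (β ε μ : ℝ) (n : ℤ) (x : ℝ) : ℂ :=
  (if n = 0 then -(waveNumber β μ n * Complex.exp (-(waveNumber β μ n * x))) else 0) +
    gconvDeriv (waveNumber β μ n) (zeroExt (vecA p β ε μ n)) x

/-- The second derivative of `Ψ_n`. -/
def psiDerivTwo (p : Perturbation) (β ε μ : ℝ) (n : ℤ) (x : ℝ) : ℂ :=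
  waveNumber β μ n ^ 2 * psiComp p β ε μ n x - zeroExt (vecA p β ε μ n) x

lemma hasDerivAt_psiComp (hβ : 0 < β) (hβ' : β < 1 / 2) (hμ : 0 < μ) (hμ' : μ < √(1 - 2 * β))
    (hA : ∀ n, Continuous (zeroExt (vecA p β ε μ n))) (n : ℤ) (x : ℝ) :
    HasDerivAt (psiComp p β ε μ n) (psiDeriv p β ε μ n x) x := by
  rw [show psiComp p β ε μ n = _ from funext (psiComp_eq n), psiDeriv]
  have h := hasDerivAt_gconv (waveNumber_ne_zero hβ hβ' hμ hμ' n) (hA n)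
    (fun x => zeroExt_of_lt (vecA p β ε μ n)) x
  refine HasDerivAt.add ?_ h
  split_ifs
  · exact hasDerivAt_cexp_neg_mul _ x
  · exact hasDerivAt_const x 0

lemma hasDerivAt_psiDeriv (hA : ∀ n, Continuous (zeroExt (vecA p β ε μ n))) (n : ℤ) (x : ℝ) :
    HasDerivAt (psiDeriv p β ε μ n) (psiDerivTwo p β ε μ n x) x := by
  have h := hasDerivAt_gconvDeriv (k := waveNumber β μ n) (hA n)
    (fun x => zeroExt_of_lt (vecA p β ε μ n)) x
  rw [psiDerivTwo, psiComp_eq, mul_add, add_sub_assoc]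
  refine HasDerivAt.add ?_ h
  split_ifs
  · refine ((hasDerivAt_cexp_neg_mul _ x).const_mul (waveNumber β μ n)).neg.congr_deriv ?_
    ring
  · rw [mul_zero]
    exact hasDerivAt_const x 0

lemma continuous_psiDerivTwo (hβ : 0 < β) (hβ' : β < 1 / 2) (hμ : 0 < μ) (hμ' : μ < √(1 - 2 * β))
    (hA : ∀ n, Continuous (zeroExt (vecA p β ε μ n))) (n : ℤ) :
    Continuous (psiDerivTwo p β ε μ n) := by
  have : Continuous (psiComp p β ε μ n) := continuous_iff_continuousAt.2 fun x =>
    (hasDerivAt_psiComp hβ hβ' hμ hμ' hA n x).continuousAt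
  exact (this.const_mul _).sub (hA n)

lemma psi_eq_modeSum : psi p β ε μ = modeSum β (psiComp p β ε μ) := by
  funext q
  rw [psi, modeSum, ← tsum_mul_left]
  refine tsum_congr fun n => ?_
  rw [mul_left_comm, ← Complex.exp_add]
  congr 2
  ring

/-- The rate is `0` because mode `0` propagates and is only bounded. -/
lemma exists_modeBounds_psiComp (hβ : 0 < β) (hβ' : β < 1 / 2) (hμ : 0 < μ)
    (hμ' : μ < √(1 - 2 * β)) (hu : IsUnit (1 - (ε : ℂ) • opT p β μ)) (hd : disp p β ε μ ≠ 0) :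
    ∃ b, ModeBounds (psiComp p β ε μ) (psiDeriv p β ε μ) (psiDerivTwo p β ε μ) b 0 := by
  obtain ⟨c, hc, hck⟩ := exists_le_re_waveNumber hβ hβ' hμ
  have hA := continuous_zeroExt_vecA hμ hu hd
  have hre : (waveNumber β μ 0).re = 0 := by rw [waveNumber_zero]; simp
  have he : ∀ x : ℝ, ‖Complex.exp (-(waveNumber β μ 0 * x))‖ = 1 := fun x => by
    rw [Complex.norm_exp]
    simp [hre]
  have g1 := fun x => norm_gconv_le (k := waveNumber β μ 0) (hA 0)
    (fun x => zeroExt_of_lt (vecA p β ε μ 0)) x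
  have g2 := fun x => norm_gconvDeriv_le (k := waveNumber β μ 0) (hA 0)
    (fun x => zeroExt_of_lt (vecA p β ε μ 0)) x
  simp only [hre, zero_mul, neg_zero, Real.exp_zero, one_mul] at g1 g2
  set J := ∫ ξ, ‖zeroExt (vecA p β ε μ 0) ξ‖
  set κ := ‖waveNumber β μ 0‖ with hκ
  have hJ : 0 ≤ J := integral_nonneg fun _ => norm_nonneg _
  have hκ0 : 0 ≤ κ := norm_nonneg _
  have f0 : ∀ x, ‖psiComp p β ε μ 0 x‖ ≤ 1 + 1 / (2 * κ) * J := fun x => by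
    rw [psiComp_eq, if_pos rfl]
    refine (norm_add_le _ _).trans (add_le_add (he x).le (g1 x))
  have f1 : ∀ x, ‖psiDeriv p β ε μ 0 x‖ ≤ κ + 1 / 2 * J := fun x => by
    rw [psiDeriv, if_pos rfl]
    refine (norm_add_le _ _).trans (add_le_add ?_ (g2 x))
    rw [norm_neg, norm_mul, he, mul_one]
  have f2 : ∀ x, ‖psiDerivTwo p β ε μ 0 x‖ ≤
      κ ^ 2 * (1 + 1 / (2 * κ) * J) + ‖vecA p β ε μ 0‖ := fun x => by
    rw [psiDerivTwo]
    refine (norm_sub_le _ _).trans (add_le_add ?_ (norm_zeroExt_le _ x))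
    rw [norm_mul, norm_pow]
    exact mul_le_mul_of_nonneg_left (f0 x) (sq_nonneg _)
  have p0 : 0 ≤ 1 + 1 / (2 * κ) * J := by positivity
  have p1 : 0 ≤ κ + 1 / 2 * J := by positivity
  have p2 : 0 ≤ κ ^ 2 * (1 + 1 / (2 * κ) * J) + ‖vecA p β ε μ 0‖ := by positivity
  -- `B` is the sum of the three nonnegative bounds, hence dominates each.
  refine ⟨_, modeBounds_of_gconv (δ := 0) (B := (1 + 1 / (2 * κ) * J) + (κ + 1 / 2 * J) +
    (κ ^ 2 * (1 + 1 / (2 * κ) * J) + ‖vecA p β ε μ 0‖)) hμ hc hck le_rfl (by linarith) hA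
    (summable_norm_vecA hβ hβ' hμ hu hd) (hasDerivAt_psiComp hβ hβ' hμ hμ' hA)
    (hasDerivAt_psiDeriv hA) (continuous_psiDerivTwo hβ hβ' hμ hμ' hA)
    (fun n x hn => ?_) (fun n x hn => ?_) (fun n x hn => ?_) fun x => ?_⟩
  · rw [psiComp_eq, if_neg hn, zero_add]
  · rw [psiDeriv, if_neg hn, zero_add]
  · rw [psiDerivTwo, psiComp_eq, if_neg hn, zero_add]
  · simp only [zero_mul, neg_zero, Real.exp_zero, mul_one]
    exact ⟨by linarith [f0 x], by linarith [f1 x], by linarith [f2 x]⟩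

/-- The mode `n` of `Ψ` minus its leading part. -/
def restComp (p : Perturbation) (β ε μ : ℝ) (n : ℤ) (x : ℝ) : ℂ :=
  psiComp p β ε μ n x - if n = 0 then
    leadingMode β μ (reflCoeff p β ε μ) (transCoeff p β ε μ) x else 0

/-- Right of the support `G_0 * A_0` is a multiple of `e^{ik₀x}`; adding the incident wave produces
the `1` in `𝒯`. -/
lemma psiComp_zero_of_right (hμ : 0 < μ) (hμ' : μ < √(1 - 2 * β))
    (hu : IsUnit (1 - (ε : ℂ) • opT p β μ)) (hd : disp p β ε μ ≠ 0) {x : ℝ} (hx : p.R ≤ x) :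
    psiComp p β ε μ 0 x = transCoeff p β ε μ * Complex.exp (Complex.I * kZero β μ * x) := by
  have hk := kZero_pos hμ hμ'
  have hk' : (kZero β μ : ℂ) ≠ 0 := by exact_mod_cast hk.ne'
  rw [psiComp_eq, if_pos rfl, gconv_of_right (continuous_zeroExt_vecA hμ hu hd 0)
    (fun x => zeroExt_of_lt _) hx, transCoeff_eq hμ hk hd, avgExp, waveNumber_zero]
  have e : ∫ ξ : ℝ, Complex.exp (-(Complex.I * kZero β μ) * ξ) * zeroExt (vecA p β ε μ 0) ξ =
      ∫ x : ℝ, zeroExt (vecA p β ε μ 0) x *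
        Complex.exp (Complex.I * ((-kZero β μ : ℝ) : ℂ) * x) := by
    refine integral_congr_ae (Eventually.of_forall fun ξ => ?_)
    simp only
    rw [mul_comm]
    congr 2
    push_cast
    ring
  rw [e, neg_mul, neg_neg]
  have hI : 1 / (2 * -(Complex.I * kZero β μ)) = Complex.I / (2 * kZero β μ) := by
    rw [div_eq_div_iff (by simp [hk']) (by simp [hk'])]
    linear_combination (2 * (kZero β μ : ℂ)) * Complex.I_sq
  rw [hI]
  ring

lemma psiComp_zero_of_left (hμ : 0 < μ) (hμ' : μ < √(1 - 2 * β))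
    (hu : IsUnit (1 - (ε : ℂ) • opT p β μ)) (hd : disp p β ε μ ≠ 0) {x : ℝ} (hx : x < -p.R) :
    psiComp p β ε μ 0 x = Complex.exp (Complex.I * kZero β μ * x) +
      reflCoeff p β ε μ * Complex.exp (-(Complex.I * kZero β μ * x)) := by
  have hk := kZero_pos hμ hμ'
  have hk' : (kZero β μ : ℂ) ≠ 0 := by exact_mod_cast hk.ne'
  rw [psiComp_eq, if_pos rfl, gconv_of_left (continuous_zeroExt_vecA hμ hu hd 0)
    (fun x => zeroExt_of_lt _) hx, reflCoeff_eq hμ hk hd, avgExp, waveNumber_zero]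
  have e : ∫ ξ : ℝ, Complex.exp (-(-(Complex.I * kZero β μ) * ξ)) * zeroExt (vecA p β ε μ 0) ξ =
      ∫ x : ℝ, zeroExt (vecA p β ε μ 0) x * Complex.exp (Complex.I * (kZero β μ : ℂ) * x) := by
    refine integral_congr_ae (Eventually.of_forall fun ξ => ?_)
    simp only
    rw [mul_comm, neg_mul, neg_neg]
  rw [e, neg_mul, neg_neg]
  have hI : 1 / (2 * -(Complex.I * kZero β μ)) = Complex.I / (2 * kZero β μ) := by
    rw [div_eq_div_iff (by simp [hk']) (by simp [hk'])]
    linear_combination (2 * (kZero β μ : ℂ)) * Complex.I_sq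
  rw [hI]
  ring

lemma hasCompactSupport_restComp (hμ : 0 < μ) (hμ' : μ < √(1 - 2 * β))
    (hu : IsUnit (1 - (ε : ℂ) • opT p β μ)) (hd : disp p β ε μ ≠ 0) :
    HasCompactSupport (restComp p β ε μ 0) := by
  -- `R + 1` exceeds both `R`, beyond which the mode is explicit, and `1`, beyond which `χ` is
  -- constant.
  refine HasCompactSupport.intro (isCompact_Icc (a := -(p.R + 1)) (b := p.R + 1)) fun x hx => ?_
  have hR := p.R_pos
  have hx' : p.R + 1 < |x| := by
    by_contra h
    exact hx (abs_le.1 (not_lt.1 h))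
  rw [restComp, if_pos rfl]
  rcases lt_abs.1 hx' with h | h
  · rw [psiComp_zero_of_right hμ hμ' hu hd (by linarith), leadingMode_of_one_le _ _ _ _ (by linarith),
      sub_self]
  · rw [psiComp_zero_of_left hμ hμ' hu hd (by linarith),
      leadingMode_of_le_neg_one _ _ _ _ (by linarith), sub_self]

/-- Subtracting the leading part leaves mode `0` with compact support, so it satisfies a bound with
any rate. The other modes decay at rate at least `c`, and `δ = c/2` is the largest value with `2δ ≤
c`. -/
lemma exists_modeBounds_restComp (hβ : 0 < β) (hβ' : β < 1 / 2) (hμ : 0 < μ)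
    (hμ' : μ < √(1 - 2 * β)) (hu : IsUnit (1 - (ε : ℂ) • opT p β μ)) (hd : disp p β ε μ ≠ 0) :
    ∃ a' a'' b, ∃ δ > 0, ModeBounds (restComp p β ε μ) a' a'' b δ := by
  obtain ⟨c, hc, hck⟩ := exists_le_re_waveNumber hβ hβ' hμ
  have hA := continuous_zeroExt_vecA hμ hu hd
  set ℓ := leadingMode β μ (reflCoeff p β ε μ) (transCoeff p β ε μ) with hℓ
  have l0 : ContDiff ℝ ∞ ℓ := contDiff_leadingMode _ _ _ _
  have l1 : ContDiff ℝ ∞ (deriv ℓ) := (contDiff_infty_iff_deriv.1 l0).2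
  have l2 : ContDiff ℝ ∞ (deriv (deriv ℓ)) := (contDiff_infty_iff_deriv.1 l1).2
  let a' : ℤ → ℝ → ℂ := fun n x => psiDeriv p β ε μ n x - if n = 0 then deriv ℓ x else 0
  let a'' : ℤ → ℝ → ℂ := fun n x =>
    psiDerivTwo p β ε μ n x - if n = 0 then deriv (deriv ℓ) x else 0
  have d0 : ∀ n x, HasDerivAt (restComp p β ε μ n) (a' n x) x := fun n x => by
    refine (hasDerivAt_psiComp hβ hβ' hμ hμ' hA n x).sub ?_
    split_ifs
    · exact (l0.differentiable (by simp) x).hasDerivAt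
    · exact hasDerivAt_const x 0
  have d1 : ∀ n x, HasDerivAt (a' n) (a'' n x) x := fun n x => by
    refine (hasDerivAt_psiDeriv hA n x).sub ?_
    split_ifs
    · exact (l1.differentiable (by simp) x).hasDerivAt
    · exact hasDerivAt_const x 0
  have d2 : ∀ n, Continuous (a'' n) := fun n => by
    refine (continuous_psiDerivTwo hβ hβ' hμ hμ' hA n).sub ?_
    split_ifs
    · exact l2.continuous
    · exact continuous_const
  have s0 := hasCompactSupport_restComp hμ hμ' hu hd
  have s1 : HasCompactSupport (a' 0) := by
    have := s0.deriv
    rwa [show deriv (restComp p β ε μ 0) = a' 0 from funext fun x => (d0 0 x).deriv] at this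
  have s2 : HasCompactSupport (a'' 0) := by
    have := s1.deriv
    rwa [show deriv (a' 0) = a'' 0 from funext fun x => (d1 0 x).deriv] at this
  obtain ⟨B0, h0⟩ := exists_exp_bound
    (continuous_iff_continuousAt.2 fun x => (d0 0 x).continuousAt) s0 (c / 2)
  obtain ⟨B1, h1⟩ := exists_exp_bound
    (continuous_iff_continuousAt.2 fun x => (d1 0 x).continuousAt) s1 (c / 2)
  obtain ⟨B2, h2⟩ := exists_exp_bound (d2 0) s2 (c / 2)
  have hB : ∀ x, Real.exp (-(c / 2 * |x|)) > 0 := fun x => Real.exp_pos _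
  refine ⟨a', a'', _, c / 2, by positivity, modeBounds_of_gconv (B := max B0 (max B1 B2)) hμ hc hck
    (by positivity) (by linarith) hA (summable_norm_vecA hβ hβ' hμ hu hd) d0 d1 d2
    (fun n x hn => ?_) (fun n x hn => ?_) (fun n x hn => ?_) fun x => ⟨?_, ?_, ?_⟩⟩
  · rw [restComp, if_neg hn, sub_zero, psiComp_eq, if_neg hn, zero_add]
  · simp only [a']
    rw [if_neg hn, sub_zero, psiDeriv, if_neg hn, zero_add]
  · simp only [a'']
    rw [if_neg hn, sub_zero, psiDerivTwo, psiComp_eq, if_neg hn, zero_add]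
  · exact (h0 x).trans (mul_le_mul_of_nonneg_right (le_max_left _ _) (hB x).le)
  · exact (h1 x).trans (mul_le_mul_of_nonneg_right
      ((le_max_left _ _).trans (le_max_right _ _)) (hB x).le)
  · exact (h2 x).trans (mul_le_mul_of_nonneg_right
      ((le_max_right _ _).trans (le_max_right _ _)) (hB x).le)

lemma psi_sub_leading (hβ : 0 < β) (hβ' : β < 1 / 2) (hμ : 0 < μ)
    (hμ' : μ < √(1 - 2 * β)) (hu : IsUnit (1 - (ε : ℂ) • opT p β μ)) (hd : disp p β ε μ ≠ 0) :
    psi p β ε μ - leading β μ (reflCoeff p β ε μ) (transCoeff p β ε μ) =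
      modeSum β (restComp p β ε μ) := by
  obtain ⟨b, hb⟩ := exists_modeBounds_psiComp hβ hβ' hμ hμ' hu hd
  funext q
  have h1 := (summable_mode (β := β) hb.summable
    (fun n x => (hb.bound_zero n x).trans (hb.mul_exp_le n x)) q).hasSum
  have h2 := hasSum_ite_eq (0 : ℤ) (leading β μ (reflCoeff p β ε μ) (transCoeff p β ε μ) q)
  rw [Pi.sub_apply, psi_eq_modeSum, modeSum, ← (h1.sub h2).tsum_eq, modeSum]
  refine tsum_congr fun n => ?_
  rw [restComp, sub_mul]
  congr 1
  split_ifs with hn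
  · rw [leading_eq, hn]
    simp
  · rw [zero_mul]

/-- The product of two absolutely convergent series, summed along `m = n + j`. -/
lemma hasSum_conv_mul {u v g : ℤ → ℂ} {c U V : ℂ} (hu : Summable fun n => ‖u n‖)
    (hv : Summable fun n => ‖v n‖) (hU : HasSum u U) (hV : HasSum v V)
    (hg : ∀ m, HasSum (fun n => c * (u n * v (m - n))) (g m)) : HasSum g (c * (U * V)) := by
  have h1 : HasSum (fun q : ℤ × ℤ => c * (u q.1 * v q.2)) (c * (U * V)) :=
    (hU.mul hV (summable_mul_of_summable_norm hu hv)).mul_left c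
  let e : ℤ × ℤ ≃ ℤ × ℤ :=
    { toFun := fun q => (q.2, q.1 - q.2)
      invFun := fun q => (q.2 + q.1, q.1)
      left_inv := fun q => by simp
      right_inv := fun q => by simp }
  exact (e.hasSum_iff.2 h1).prod_fiberwise hg

/-- At a fixed point this is the product of the absolutely convergent series of `Ψ` and of `2πf`,
summed along `m = n + j`; the constants combine as `2εγ · 2π = ω² ε`. For `|x| > R` both sides are
zero. -/
lemma hasSum_source (hβ : 0 < β) (hβ' : β < 1 / 2) (hμ : 0 < μ) (hμ' : μ < √(1 - 2 * β))
    (hu : IsUnit (1 - (ε : ℂ) • opT p β μ)) (hd : disp p β ε μ ≠ 0) (q : ℝ × ℝ) :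
    HasSum (fun m : ℤ => zeroExt (vecA p β ε μ m) q.1 * Complex.exp (Complex.I * (β + m) * q.2))
      (omegaSq β μ * ε * p.f q * psi p β ε μ q) := by
  by_cases hq : q.1 ∈ Icc (-p.R) p.R
  · obtain ⟨b, hb⟩ := exists_modeBounds_psiComp hβ hβ' hμ hμ' hu hd
    have s1 : Summable fun n : ℤ =>
        ‖psiComp p β ε μ n q.1 * Complex.exp (Complex.I * (β + n) * q.2)‖ := by
      refine Summable.of_nonneg_of_le (fun _ => norm_nonneg _) (fun n => ?_) hb.summable
      rw [norm_mul, norm_modeExp, mul_one]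
      exact (hb.bound_zero n _).trans (hb.mul_exp_le n _)
    have s2 : Summable fun j : ℤ => ‖p.coeff j q.1 * Complex.exp (Complex.I * j * q.2)‖ := by
      refine (summable_norm_coeff p q.1).congr fun j => ?_
      have := norm_modeExp 0 j q.2
      rw [Complex.ofReal_zero, zero_add] at this
      rw [norm_mul, this, mul_one]
    have h := hasSum_conv_mul (c := 2 * ε * gam β μ)
      (g := fun m : ℤ => zeroExt (vecA p β ε μ m) q.1 * Complex.exp (Complex.I * (β + m) * q.2))
      s1 s2 s1.of_norm.hasSum (hasSum_fourier_f p q.1 q.2) fun m => ?_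
    · convert h using 1
      change _ = 2 * ε * gam β μ * (modeSum β (psiComp p β ε μ) q * (2 * π * p.f q))
      rw [psi_eq_modeSum, gam]
      generalize modeSum β (psiComp p β ε μ) q = S
      have hpi : (π : ℂ) ≠ 0 := by exact_mod_cast Real.pi_ne_zero
      push_cast
      field_simp
      norm_num
    · have h1 := ((hasSum_vecA hμ hu hd m).mapL (ContinuousMap.evalCLM ℂ ⟨q.1, hq⟩)).mul_right
        (Complex.exp (Complex.I * (β + m) * q.2))
      rw [zeroExt_of_mem _ hq]
      refine h1.congr_fun fun n => ?_
      have e1 : coeffC p (m - n) ⟨q.1, hq⟩ = p.coeff (m - n) q.1 := rfl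
      have e2 : Complex.exp (Complex.I * (β + m) * q.2) = Complex.exp (Complex.I * (β + n) * q.2) *
          Complex.exp (Complex.I * ((m - n : ℤ) : ℂ) * q.2) := by
        rw [← Complex.exp_add]
        congr 1
        push_cast
        ring
      rw [e2]
      simp [psiC_apply, e1]
      ring
  · have h0 : p.f q = 0 := by
      refine p.vanish q.1 q.2 ?_
      by_contra h
      exact hq (abs_le.1 (not_lt.1 h))
    simp only [zeroExt_of_notMem _ hq, zero_mul, h0]
    simp

lemma isClassicalSolution_psi (hβ : 0 < β) (hβ' : β < 1 / 2) (hμ : 0 < μ)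
    (hμ' : μ < √(1 - 2 * β)) (hu : IsUnit (1 - (ε : ℂ) • opT p β μ)) (hd : disp p β ε μ ≠ 0) :
    IsClassicalSolution p β ε μ (psi p β ε μ) := by
  obtain ⟨b, hb⟩ := exists_modeBounds_psiComp hβ hβ' hμ hμ' hu hd
  have hβ1 : |β| ≤ 1 := by rw [abs_of_pos hβ]; linarith
  refine ⟨?_, ?_, fun q => ?_⟩
  · rw [psi_eq_modeSum]
    exact hb.contDiff_two hβ1
  · rw [psi_eq_modeSum]
    exact quasiBC_of_forall fun x y => modeSum_add_two_pi β _ x y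
  · have hs := hasSum_source hβ hβ' hμ hμ' hu hd q
    rw [psi_eq_modeSum] at hs ⊢
    rw [hb.dX_dX_eq hβ1, hb.dY_dY_eq hβ1]
    have h0 := (summable_mode (β := β) hb.summable
      (fun n x => (hb.bound_zero n x).trans (hb.mul_exp_le n x)) q).hasSum
    have h1 := (summable_mode (β := β) hb.summable
      (fun n x => (hb.bound'' n x).trans (hb.mul_exp_le n x)) q).hasSum
    have h2 := (summable_mode (β := β)
      (a := fun n x => Complex.I * (β + n) * (Complex.I * (β + n) * psiComp p β ε μ n x))
      hb.summable (fun n x => (norm_mul_modeFactor_le hβ1 n _).trans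
        ((hb.bound_modeFactor hβ1 n x).trans (hb.mul_exp_le n x))) q).hasSum
    -- Both sides of the equation are now series, and they agree term by term by the mode equation
    -- `-Ψ_n'' + (β+n)² Ψ_n = ω² Ψ_n + A_n`.
    have h3 := (h1.add h2).neg
    have h4 := (h0.mul_left (omegaSq β μ : ℂ)).add hs
    have e := h3.unique (h4.congr_fun fun n => ?_)
    · change -(∑' n, _ + ∑' n, _) = _
      rw [e, modeSum]
      ring
    · rw [psiDerivTwo, waveNumber_sq hβ hβ' hμ hμ']
      linear_combination (-((β : ℂ) + n) ^ 2 * psiComp p β ε μ n q.1 *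
        Complex.exp (Complex.I * (β + n) * q.2)) * Complex.I_sq

end

/-! ### Partial derivatives and integration by parts on the strip. -/

section

variable {u v : ℝ × ℝ → ℂ}

lemma hasDerivAt_dX (hu : Differentiable ℝ u) (q : ℝ × ℝ) :
    HasDerivAt (fun s => u (s, q.2)) (dX u q) q.1 := by
  have h := (hu q).hasFDerivAt.comp_hasDerivAt q.1
    ((hasDerivAt_id q.1).prodMk (hasDerivAt_const q.1 q.2))
  exact h.differentiableAt.hasDerivAt

lemma hasDerivAt_dY (hu : Differentiable ℝ u) (q : ℝ × ℝ) :
    HasDerivAt (fun s => u (q.1, s)) (dY u q) q.2 := by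
  have h := (hu q).hasFDerivAt.comp_hasDerivAt q.2
    ((hasDerivAt_const q.2 q.1).prodMk (hasDerivAt_id q.2))
  exact h.differentiableAt.hasDerivAt

lemma dX_eq_fderiv (hu : Differentiable ℝ u) : dX u = fun q => fderiv ℝ u q (1, 0) :=
  funext fun q => dX_eq_of_hasFDerivAt (hu q).hasFDerivAt

lemma dY_eq_fderiv (hu : Differentiable ℝ u) : dY u = fun q => fderiv ℝ u q (0, 1) :=
  funext fun q => dY_eq_of_hasFDerivAt (hu q).hasFDerivAt

lemma contDiff_dX {m n : ℕ∞ω} (hu : ContDiff ℝ n u) (hmn : m + 1 ≤ n) : ContDiff ℝ m (dX u) := by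
  rw [dX_eq_fderiv (hu.differentiable (by rintro rfl; simp at hmn))]
  exact (hu.fderiv_right hmn).clm_apply contDiff_const

lemma contDiff_dY {m n : ℕ∞ω} (hu : ContDiff ℝ n u) (hmn : m + 1 ≤ n) : ContDiff ℝ m (dY u) := by
  rw [dY_eq_fderiv (hu.differentiable (by rintro rfl; simp at hmn))]
  exact (hu.fderiv_right hmn).clm_apply contDiff_const

lemma dX_mul (hu : Differentiable ℝ u) (hv : Differentiable ℝ v) (q : ℝ × ℝ) :
    dX (fun q => u q * v q) q = dX u q * v q + u q * dX v q :=
  ((hasDerivAt_dX hu q).mul (hasDerivAt_dX hv q)).deriv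

lemma dY_mul (hu : Differentiable ℝ u) (hv : Differentiable ℝ v) (q : ℝ × ℝ) :
    dY (fun q => u q * v q) q = dY u q * v q + u q * dY v q :=
  ((hasDerivAt_dY hu q).mul (hasDerivAt_dY hv q)).deriv

lemma dX_sub (hu : Differentiable ℝ u) (hv : Differentiable ℝ v) : dX (u - v) = dX u - dX v :=
  funext fun q => ((hasDerivAt_dX hu q).sub (hasDerivAt_dX hv q)).deriv

lemma dY_sub (hu : Differentiable ℝ u) (hv : Differentiable ℝ v) : dY (u - v) = dY u - dY v :=
  funext fun q => ((hasDerivAt_dY hu q).sub (hasDerivAt_dY hv q)).deriv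

lemma hasDerivAt_conj {g : ℝ → ℂ} {g' : ℂ} {x : ℝ} (h : HasDerivAt g g' x) :
    HasDerivAt (fun x => conj (g x)) (conj g') x := by
  exact Complex.conjCLE.toContinuousLinearMap.hasFDerivAt.comp_hasDerivAt x h

lemma dX_conj (hu : Differentiable ℝ u) (q : ℝ × ℝ) :
    dX (fun q => conj (u q)) q = conj (dX u q) := (hasDerivAt_conj (hasDerivAt_dX hu q)).deriv

lemma dY_conj (hu : Differentiable ℝ u) (q : ℝ × ℝ) :
    dY (fun q => conj (u q)) q = conj (dY u q) := (hasDerivAt_conj (hasDerivAt_dY hu q)).deriv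

lemma contDiff_conj {n : ℕ∞ω} (hu : ContDiff ℝ n u) : ContDiff ℝ n fun q => conj (u q) :=
  Complex.conjCLE.contDiff.comp hu

lemma dX_vanish {M : ℝ} (h : ∀ x y, M < |x| → u (x, y) = 0) (x y : ℝ) (hx : M < |x|) :
    dX u (x, y) = 0 := by
  have h1 : (fun s => u (s, y)) =ᶠ[𝓝 x] fun _ => 0 := by
    filter_upwards [(isOpen_lt continuous_const continuous_abs).mem_nhds hx] with s hs
    exact h s y hs
  rw [dX, h1.deriv_eq, deriv_const]

lemma dY_vanish {M : ℝ} (h : ∀ x y, M < |x| → u (x, y) = 0) (x y : ℝ) (hx : M < |x|) :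
    dY u (x, y) = 0 := by
  simp [dY, h x _ hx]

end

lemma stripMeasure_eq :
    stripMeasure = (volume : Measure ℝ).prod (volume.restrict (Ioo 0 (2 * π))) := by
  rw [stripMeasure, Measure.volume_eq_prod, ← Measure.prod_restrict, Measure.restrict_univ]

lemma ae_strip : ∀ᵐ q ∂stripMeasure, q.2 ∈ Ioo 0 (2 * π) := by
  rw [stripMeasure]
  filter_upwards [ae_restrict_mem (MeasurableSet.univ.prod measurableSet_Ioo)] with q hq
  exact hq.2

lemma memLp_exp_neg_abs {δ : ℝ} (hδ : 0 < δ) :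
    MemLp (fun q : ℝ × ℝ => Real.exp (-(δ * |q.1|))) 2 stripMeasure ∧
      Integrable (fun q : ℝ × ℝ => Real.exp (-(δ * |q.1|))) stripMeasure := by
  rw [stripMeasure_eq]
  have h1 : ∀ κ : ℝ, 0 < κ → Integrable fun x : ℝ => Real.exp (-(κ * |x|)) := fun κ hκ => by
    simpa using (integral_exp_neg_mul_abs_sub hκ 0).1
  refine ⟨MemLp.comp_fst (f := fun x : ℝ => Real.exp (-(δ * |x|))) ?_ _,
    Integrable.comp_fst (h1 δ hδ) _⟩
  rw [memLp_two_iff_integrable_sq (by fun_prop)]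
  refine (h1 (2 * δ) (by positivity)).congr (Eventually.of_forall fun x => ?_)
  simp only
  rw [← Real.exp_nat_mul]
  congr 1
  push_cast
  ring

lemma memLp_strip_of_le {g : ℝ × ℝ → ℂ} (hg : AEStronglyMeasurable g stripMeasure) {B δ : ℝ}
    (hδ : 0 < δ) (h : ∀ᵐ q ∂stripMeasure, ‖g q‖ ≤ B * Real.exp (-(δ * |q.1|))) :
    MemLp g 2 stripMeasure ∧ Integrable g stripMeasure :=
  ⟨MemLp.of_le_mul (memLp_exp_neg_abs hδ).1 hg (by
      filter_upwards [h] with q hq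
      rwa [Real.norm_of_nonneg (Real.exp_pos _).le]),
    Integrable.mono' ((memLp_exp_neg_abs hδ).2.const_mul B) hg h⟩

lemma strip_of_vanish {g : ℝ × ℝ → ℂ} (hg : Continuous g) {M : ℝ}
    (h : ∀ x y, M < |x| → g (x, y) = 0) :
    MemLp g 2 stripMeasure ∧ Integrable g stripMeasure := by
  obtain ⟨B, hB⟩ := (isCompact_Icc.prod isCompact_Icc : IsCompact
    (Icc (-M) M ×ˢ Icc (0 : ℝ) (2 * π))).exists_bound_of_continuousOn hg.continuousOn
  refine memLp_strip_of_le hg.aestronglyMeasurable one_pos (B := |B| * Real.exp M) ?_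
  filter_upwards [ae_strip] with q hq
  by_cases hx : M < |q.1|
  · rw [h q.1 q.2 hx, norm_zero]
    positivity
  · rw [mul_assoc, ← Real.exp_add]
    refine ((hB q ⟨abs_le.1 (not_lt.1 hx), Ioo_subset_Icc_self hq⟩).trans (le_abs_self B)).trans
      (le_mul_of_one_le_right (abs_nonneg _) (Real.one_le_exp ?_))
    linarith [not_lt.1 hx]

lemma integral_dX_eq_zero {g : ℝ × ℝ → ℂ} (hg : ContDiff ℝ 1 g) {M : ℝ}
    (h : ∀ x y, M < |x| → g (x, y) = 0) : ∫ q, dX g q ∂stripMeasure = 0 := by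
  have hc : Continuous (dX g) := (contDiff_dX (m := 0) hg (by simp)).continuous
  have hi := (strip_of_vanish hc (dX_vanish h)).2
  rw [stripMeasure_eq] at hi ⊢
  rw [integral_prod_symm _ hi]
  refine integral_eq_zero_of_ae (Eventually.of_forall fun y => ?_)
  refine integral_eq_zero_of_hasDerivAt_of_integrable (f := fun x => g (x, y))
    (fun x => hasDerivAt_dX (hg.differentiable (by simp)) (x, y)) ?_ ?_
  · exact Continuous.integrable_of_hasCompactSupport (by fun_prop)
      (hasCompactSupport_of_vanish fun x hx => dX_vanish h x y hx)
  · have := hg.continuous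
    exact Continuous.integrable_of_hasCompactSupport (by fun_prop)
      (hasCompactSupport_of_vanish fun x hx => h x y hx)

lemma integral_dY_eq_zero {g : ℝ × ℝ → ℂ} (hg : ContDiff ℝ 1 g) {M : ℝ}
    (h : ∀ x y, M < |x| → g (x, y) = 0) (hp : ∀ x, g (x, 2 * π) = g (x, 0)) :
    ∫ q, dY g q ∂stripMeasure = 0 := by
  have hc : Continuous (dY g) := (contDiff_dY (m := 0) hg (by simp)).continuous
  have hi := (strip_of_vanish hc (dY_vanish h)).2
  rw [stripMeasure_eq] at hi ⊢
  rw [integral_prod _ hi]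
  refine integral_eq_zero_of_ae (Eventually.of_forall fun x => ?_)
  simp only
  rw [← integral_Ioc_eq_integral_Ioo, ← intervalIntegral.integral_of_le (by positivity),
    intervalIntegral.integral_eq_sub_of_hasDerivAt (f := fun y => g (x, y))
      (fun y _ => hasDerivAt_dY (hg.differentiable (by simp)) (x, y))
      (Continuous.intervalIntegrable (by fun_prop) _ _), hp, sub_self]
  rfl

/-- Integration by parts in `x` against a function vanishing for large `|x|`. -/
lemma integral_mul_dX {u v : ℝ × ℝ → ℂ} (hu : ContDiff ℝ 1 u) (hv : ContDiff ℝ 1 v) {M : ℝ}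
    (h : ∀ x y, M < |x| → v (x, y) = 0) :
    ∫ q, dX u q * v q ∂stripMeasure = -∫ q, u q * dX v q ∂stripMeasure := by
  have hu' := hu.differentiable (by simp)
  have hv' := hv.differentiable (by simp)
  have cu : Continuous (dX u) := (contDiff_dX (m := 0) hu (by simp)).continuous
  have cv : Continuous (dX v) := (contDiff_dX (m := 0) hv (by simp)).continuous
  have i1 := (strip_of_vanish (g := fun q => dX u q * v q) (cu.mul hv.continuous)
    (fun x y hx => by rw [h x y hx, mul_zero])).2
  have i2 := (strip_of_vanish (g := fun q => u q * dX v q) (hu.continuous.mul cv)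
    (fun x y hx => by rw [dX_vanish h x y hx, mul_zero])).2
  have h0 := integral_dX_eq_zero (g := fun q => u q * v q) (M := M) (hu.mul hv) (fun x y hx => by
    simp only [h x y hx, mul_zero])
  simp_rw [dX_mul hu' hv'] at h0
  rw [integral_add i1 i2] at h0
  exact eq_neg_of_add_eq_zero_left h0

/-- Integration by parts in `y` on the strip. -/
lemma integral_mul_dY {u v : ℝ × ℝ → ℂ} (hu : ContDiff ℝ 1 u) (hv : ContDiff ℝ 1 v) {M : ℝ}
    (h : ∀ x y, M < |x| → v (x, y) = 0)
    (hp : ∀ x, u (x, 2 * π) * v (x, 2 * π) = u (x, 0) * v (x, 0)) :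
    ∫ q, dY u q * v q ∂stripMeasure = -∫ q, u q * dY v q ∂stripMeasure := by
  have hu' := hu.differentiable (by simp)
  have hv' := hv.differentiable (by simp)
  have cu : Continuous (dY u) := (contDiff_dY (m := 0) hu (by simp)).continuous
  have cv : Continuous (dY v) := (contDiff_dY (m := 0) hv (by simp)).continuous
  have i1 := (strip_of_vanish (g := fun q => dY u q * v q) (cu.mul hv.continuous)
    (fun x y hx => by rw [h x y hx, mul_zero])).2
  have i2 := (strip_of_vanish (g := fun q => u q * dY v q) (hu.continuous.mul cv)
    (fun x y hx => by rw [dY_vanish h x y hx, mul_zero])).2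
  have h0 := integral_dY_eq_zero (g := fun q => u q * v q) (M := M) (hu.mul hv) (fun x y hx => by
    simp only [h x y hx, mul_zero]) hp
  simp_rw [dY_mul hu' hv'] at h0
  rw [integral_add i1 i2] at h0
  exact eq_neg_of_add_eq_zero_left h0

/-- The phase has modulus one, so the boundary terms at `y = 0` and `y = 2π` cancel in products `u ·
conj φ` of quasiperiodic functions. -/
lemma conj_phase_mul (β : ℝ) (a b : ℂ) : Complex.exp (2 * π * Complex.I * β) * a *
    conj (Complex.exp (2 * π * Complex.I * β) * b) = a * conj b := by
  have e : Complex.exp (2 * π * Complex.I * β) * conj (Complex.exp (2 * π * Complex.I * β)) = 1 := by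
    rw [← Complex.exp_conj, ← Complex.exp_add]
    simp [map_ofNat]
  rw [map_mul]
  linear_combination (a * conj b) * e

/-- A classical solution satisfies the weak formulation. -/
lemma weak_of_classical {p : Perturbation} {β ε μ : ℝ} {u : ℝ × ℝ → ℂ}
    (hu : IsClassicalSolution p β ε μ u) {φ : ℝ × ℝ → ℂ} (hφ : IsTest β φ) :
    ∫ q, (dX u q * conj (dX φ q) + dY u q * conj (dY φ q)) ∂stripMeasure =
      omegaSq β μ * ∫ q, (1 + ε * p.f q : ℂ) * u q * conj (φ q) ∂stripMeasure := by
  obtain ⟨hc, hbc, heq⟩ := hu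
  obtain ⟨hφc, hφb, M, hM⟩ := hφ
  have hφ1 : ContDiff ℝ 1 φ := hφc.of_le (by exact_mod_cast le_top)
  have hφd := hφ1.differentiable (by simp)
  have hψ := contDiff_conj hφ1
  have hψ0 : ∀ x y, M < |x| → conj (φ (x, y)) = 0 := fun x y hx => by rw [hM x y hx, map_zero]
  have cX : ContDiff ℝ 1 (dX u) := contDiff_dX hc (by norm_num)
  have cY : ContDiff ℝ 1 (dY u) := contDiff_dY hc (by norm_num)
  have cXX : Continuous (dX (dX u)) := (contDiff_dX (m := 0) cX (by simp)).continuous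
  have cYY : Continuous (dY (dY u)) := (contDiff_dY (m := 0) cY (by simp)).continuous
  have e1 := integral_mul_dX cX hψ hψ0
  have e2 := integral_mul_dY cY hψ hψ0 fun x => by
    rw [(hbc x).2, (hφb x).1, conj_phase_mul]
  simp_rw [dX_conj hφd] at e1
  simp_rw [dY_conj hφd] at e2
  have i1 := (strip_of_vanish (g := fun q => dX u q * conj (dX φ q)) (M := M)
    (cX.continuous.mul (contDiff_conj (contDiff_dX (m := 0) hφ1 (by simp))).continuous)
    fun x y hx => by rw [dX_vanish hM x y hx, map_zero, mul_zero]).2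
  have i2 := (strip_of_vanish (g := fun q => dY u q * conj (dY φ q)) (M := M)
    (cY.continuous.mul (contDiff_conj (contDiff_dY (m := 0) hφ1 (by simp))).continuous)
    fun x y hx => by rw [dY_vanish hM x y hx, map_zero, mul_zero]).2
  have i3 := (strip_of_vanish (g := fun q => dX (dX u) q * conj (φ q)) (M := M)
    (cXX.mul hψ.continuous) fun x y hx => by rw [hψ0 x y hx, mul_zero]).2
  have i4 := (strip_of_vanish (g := fun q => dY (dY u) q * conj (φ q)) (M := M)
    (cYY.mul hψ.continuous) fun x y hx => by rw [hψ0 x y hx, mul_zero]).2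
  rw [integral_add i1 i2, ← integral_const_mul]
  rw [← neg_eq_iff_eq_neg] at e1 e2
  rw [← e1, ← e2, ← neg_add, ← integral_add i3 i4, ← integral_neg]
  refine integral_congr_ae (Eventually.of_forall fun q => ?_)
  simp only
  linear_combination conj (φ q) * heq q

/-! ### Mollification and cut-off: membership in `H₁^β`. -/

/-- A smooth bump on the plane with support of radius `1 / (k + 1)`. -/
def mollifier (k : ℕ) : ContDiffBump (0 : ℝ × ℝ) where
  rIn := 1 / (2 * ((k : ℝ) + 1))
  rOut := 1 / ((k : ℝ) + 1)
  rIn_pos := by positivity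
  rIn_lt_rOut := by
    rw [div_lt_div_iff₀ (by positivity) (by positivity)]
    linarith [(Nat.cast_nonneg k : (0 : ℝ) ≤ k)]

/-- The convolution with the mollifier. -/
def mollify (k : ℕ) (v : ℝ × ℝ → ℂ) (q : ℝ × ℝ) : ℂ :=
  ∫ t, (mollifier k).normed volume t • v (q - t)

lemma mollify_eq (k : ℕ) (v : ℝ × ℝ → ℂ) : mollify k v =
    MeasureTheory.convolution ((mollifier k).normed volume) v
      (ContinuousLinearMap.lsmul ℝ ℝ) volume := rfl

section

variable {v : ℝ × ℝ → ℂ}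

lemma contDiff_mollify (k : ℕ) (hv : Continuous v) : ContDiff ℝ ∞ (mollify k v) := by
  rw [mollify_eq]
  exact (mollifier k).hasCompactSupport_normed.contDiff_convolution_left _
    (mollifier k).contDiff_normed hv.locallyIntegrable

lemma tendsto_mollify (hv : Continuous v) (q : ℝ × ℝ) :
    Tendsto (fun k => mollify k v q) atTop (𝓝 (v q)) :=
  ContDiffBump.convolution_tendsto_right_of_continuous (φ := mollifier)
    tendsto_one_div_add_atTop_nhds_zero_nat hv q

lemma mollifier_eq_zero (k : ℕ) {t : ℝ × ℝ} (ht : 1 ≤ ‖t‖) : (mollifier k).normed volume t = 0 := by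
  by_contra h
  have h1 : t ∈ Function.support ((mollifier k).normed volume) := h
  rw [ContDiffBump.support_normed_eq, Metric.mem_ball, dist_zero_right] at h1
  have h2 : (mollifier k).rOut ≤ 1 := by
    change 1 / ((k : ℝ) + 1) ≤ 1
    rw [div_le_one (by positivity)]
    linarith [(Nat.cast_nonneg k : (0 : ℝ) ≤ k)]
  linarith

/-- All mollifiers live in the unit ball, so the argument shifts by at most one unit and the bound
loses a factor `e^δ`, independent of `k`. -/
lemma norm_mollify_le (k : ℕ) {B δ : ℝ} (hδ : 0 ≤ δ)
    (h : ∀ q, ‖v q‖ ≤ B * Real.exp (-(δ * |q.1|))) (q : ℝ × ℝ) :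
    ‖mollify k v q‖ ≤ B * Real.exp δ * Real.exp (-(δ * |q.1|)) := by
  have hB : 0 ≤ B := by simpa using (norm_nonneg _).trans (h 0)
  have h1 : ∫ t, (mollifier k).normed volume t * (B * Real.exp δ * Real.exp (-(δ * |q.1|))) =
      B * Real.exp δ * Real.exp (-(δ * |q.1|)) := by
    rw [integral_mul_const, ContDiffBump.integral_normed, one_mul]
  rw [← h1]
  refine norm_integral_le_of_norm_le ((mollifier k).integrable_normed.mul_const _)
    (Eventually.of_forall fun t => ?_)
  rw [norm_smul, Real.norm_of_nonneg ((mollifier k).nonneg_normed t)]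
  by_cases ht : 1 ≤ ‖t‖
  · rw [mollifier_eq_zero k ht]
    simp
  · refine mul_le_mul_of_nonneg_left ((h _).trans ?_) ((mollifier k).nonneg_normed t)
    rw [mul_assoc, ← Real.exp_add]
    refine mul_le_mul_of_nonneg_left (Real.exp_le_exp.2 ?_) hB
    have h2 : |t.1| ≤ 1 := (norm_fst_le t).trans (not_le.1 ht).le
    have h3 : |q.1| ≤ |(q - t).1| + |t.1| := by
      have := abs_add_le (q - t).1 t.1
      simpa using this
    nlinarith

lemma integrable_mollifier_smul (k : ℕ) {g : ℝ × ℝ → ℂ} (hg : Continuous g) :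
    Integrable fun t => (mollifier k).normed volume t • g t :=
  (((mollifier k).continuous_normed).smul hg).integrable_of_hasCompactSupport
    (mollifier k).hasCompactSupport_normed.smul_right

/-- The derivative is placed on `v` and not on the bump, so that the derivatives of the
mollifications converge to `dX v`. -/
lemma hasDerivAt_mollify_fst (k : ℕ) (hv : ContDiff ℝ 1 v) {B : ℝ} (h : ∀ q, ‖dX v q‖ ≤ B)
    (q : ℝ × ℝ) : HasDerivAt (fun s => mollify k v (s, q.2)) (mollify k (dX v) q) q.1 := by
  have hc := hv.continuous
  have hc' : Continuous (dX v) := (contDiff_dX (m := 0) hv (by simp)).continuous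
  have hd := hv.differentiable (by simp)
  refine (hasDerivAt_integral_of_dominated_loc_of_deriv_le (s := univ)
    (F := fun (s : ℝ) t => (mollifier k).normed volume t • v ((s, q.2) - t))
    (F' := fun (s : ℝ) t => (mollifier k).normed volume t • dX v ((s, q.2) - t))
    (bound := fun t => (mollifier k).normed volume t * B) univ_mem
    (Eventually.of_forall fun s => ?_) ?_ ?_ ?_ ?_ ?_).2
  · exact (integrable_mollifier_smul k (by fun_prop)).aestronglyMeasurable
  · exact integrable_mollifier_smul k (by fun_prop)
  · exact (integrable_mollifier_smul k (by fun_prop)).aestronglyMeasurable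
  · refine Eventually.of_forall fun t s _ => ?_
    rw [norm_smul, Real.norm_of_nonneg ((mollifier k).nonneg_normed t)]
    exact mul_le_mul_of_nonneg_left (h _) ((mollifier k).nonneg_normed t)
  · exact (mollifier k).integrable_normed.mul_const _
  · refine Eventually.of_forall fun t s _ => ?_
    have := (hasDerivAt_dX hd ((s, q.2) - t)).comp_sub_const s t.1
    exact this.const_smul ((mollifier k).normed volume t)

lemma hasDerivAt_mollify_snd (k : ℕ) (hv : ContDiff ℝ 1 v) {B : ℝ} (h : ∀ q, ‖dY v q‖ ≤ B)
    (q : ℝ × ℝ) : HasDerivAt (fun s => mollify k v (q.1, s)) (mollify k (dY v) q) q.2 := by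
  have hc := hv.continuous
  have hc' : Continuous (dY v) := (contDiff_dY (m := 0) hv (by simp)).continuous
  have hd := hv.differentiable (by simp)
  refine (hasDerivAt_integral_of_dominated_loc_of_deriv_le (s := univ)
    (F := fun (s : ℝ) t => (mollifier k).normed volume t • v ((q.1, s) - t))
    (F' := fun (s : ℝ) t => (mollifier k).normed volume t • dY v ((q.1, s) - t))
    (bound := fun t => (mollifier k).normed volume t * B) univ_mem
    (Eventually.of_forall fun s => ?_) ?_ ?_ ?_ ?_ ?_).2
  · exact (integrable_mollifier_smul k (by fun_prop)).aestronglyMeasurable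
  · exact integrable_mollifier_smul k (by fun_prop)
  · exact (integrable_mollifier_smul k (by fun_prop)).aestronglyMeasurable
  · refine Eventually.of_forall fun t s _ => ?_
    rw [norm_smul, Real.norm_of_nonneg ((mollifier k).nonneg_normed t)]
    exact mul_le_mul_of_nonneg_left (h _) ((mollifier k).nonneg_normed t)
  · exact (mollifier k).integrable_normed.mul_const _
  · refine Eventually.of_forall fun t s _ => ?_
    have := (hasDerivAt_dY hd ((q.1, s) - t)).comp_sub_const s t.2
    exact this.const_smul ((mollifier k).normed volume t)

/-- Convolution over the whole plane commutes with translations, so mollified functions satisfy the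
boundary conditions exactly. -/
lemma mollify_add_two_pi (k : ℕ) {c : ℂ} (h : ∀ x y, v (x, y + 2 * π) = c * v (x, y)) (x y : ℝ) :
    mollify k v (x, y + 2 * π) = c * mollify k v (x, y) := by
  rw [mollify, mollify, ← integral_const_mul]
  congr 1
  funext t
  have : (x, y + 2 * π) - t = (x - t.1, y - t.2 + 2 * π) := by
    ext <;> simp
    ring
  rw [this, h, mul_smul_comm]
  rfl

end

/-- A smooth bump on the line, `1` on `[-1, 1]` and `0` outside `(-2, 2)`. -/
def lineBump : ContDiffBump (0 : ℝ) := ⟨1, 2, one_pos, one_lt_two⟩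

/-- A smooth cut-off, `1` for `|x| ≤ N` and `0` for `|x| ≥ 2N`. -/
def cutoff (N x : ℝ) : ℂ := (lineBump (x / N) : ℂ)

lemma contDiff_lineBump : ContDiff ℝ ∞ fun x : ℝ => (lineBump x : ℂ) :=
  Complex.ofRealCLM.contDiff.comp lineBump.contDiff

lemma contDiff_cutoff (N : ℝ) : ContDiff ℝ ∞ (cutoff N) :=
  contDiff_lineBump.comp (contDiff_id.div_const N)

lemma cutoff_eq_one {N x : ℝ} (hN : 0 < N) (hx : |x| ≤ N) : cutoff N x = 1 := by
  rw [cutoff, lineBump.one_of_mem_closedBall, Complex.ofReal_one]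
  rw [mem_closedBall_zero_iff, Real.norm_eq_abs, abs_div, abs_of_pos hN]
  exact (div_le_one hN).2 hx

lemma cutoff_eq_zero {N x : ℝ} (hN : 0 < N) (hx : 2 * N ≤ |x|) : cutoff N x = 0 := by
  rw [cutoff, lineBump.zero_of_le_dist, Complex.ofReal_zero]
  rw [dist_zero_right, Real.norm_eq_abs, abs_div, abs_of_pos hN]
  exact (le_div_iff₀ hN).2 hx

lemma norm_cutoff_le (N x : ℝ) : ‖cutoff N x‖ ≤ 1 := by
  rw [cutoff, Complex.norm_real, Real.norm_of_nonneg lineBump.nonneg]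
  exact lineBump.le_one

lemma hasCompactSupport_lineBump : HasCompactSupport fun x : ℝ => (lineBump x : ℂ) :=
  lineBump.hasCompactSupport.comp_left Complex.ofReal_zero

lemma deriv_cutoff (N : ℝ) :
    deriv (cutoff N) = fun x => (N : ℂ)⁻¹ * deriv (fun x : ℝ => (lineBump x : ℂ)) (x / N) := by
  funext x
  have h1 := (contDiff_lineBump.differentiable (by simp) (x / N)).hasDerivAt
  have h2 := h1.scomp x ((hasDerivAt_id x).div_const N)
  refine h2.deriv.trans ?_
  rw [one_div, Complex.real_smul, Complex.ofReal_inv]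

lemma deriv_deriv_cutoff (N : ℝ) : deriv (deriv (cutoff N)) = fun x =>
    (N : ℂ)⁻¹ * ((N : ℂ)⁻¹ * deriv (deriv (fun x : ℝ => (lineBump x : ℂ))) (x / N)) := by
  funext x
  rw [deriv_cutoff]
  have h0 := (contDiff_infty_iff_deriv.1 contDiff_lineBump).2
  have h1 := (h0.differentiable (by simp) (x / N)).hasDerivAt
  have h2 := (h1.scomp x ((hasDerivAt_id x).div_const N)).const_mul (N : ℂ)⁻¹
  refine h2.deriv.trans ?_
  rw [one_div, Complex.real_smul, Complex.ofReal_inv]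

/-- Each derivative of the rescaled bump costs `1/N`; for `N ≥ 1` the `1/N²` of the second one is
weakened to `1/N`. -/
lemma exists_deriv_cutoff_bound : ∃ D, 0 ≤ D ∧ ∀ N : ℝ, 1 ≤ N → ∀ x,
    ‖deriv (cutoff N) x‖ ≤ D / N ∧ ‖deriv (deriv (cutoff N)) x‖ ≤ D / N := by
  have h1 := (contDiff_infty_iff_deriv.1 contDiff_lineBump).2
  have h2 := (contDiff_infty_iff_deriv.1 h1).2
  obtain ⟨D1, hD1⟩ := h1.continuous.bounded_above_of_compact_support
    hasCompactSupport_lineBump.deriv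
  obtain ⟨D2, hD2⟩ := h2.continuous.bounded_above_of_compact_support
    hasCompactSupport_lineBump.deriv.deriv
  have p1 := (norm_nonneg _).trans (hD1 0)
  have p2 := (norm_nonneg _).trans (hD2 0)
  refine ⟨D1 + D2, add_nonneg p1 p2, fun N hN x => ⟨?_, ?_⟩⟩
  · rw [deriv_cutoff, norm_mul, norm_inv, Complex.norm_real, Real.norm_of_nonneg (by linarith),
      inv_mul_eq_div]
    gcongr
    linarith [hD1 (x / N)]
  · rw [deriv_deriv_cutoff, norm_mul, norm_mul, norm_inv, Complex.norm_real,
      Real.norm_of_nonneg (by linarith), inv_mul_eq_div]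
    gcongr
    refine (mul_le_of_le_one_left (norm_nonneg _) (inv_le_one_of_one_le₀ hN)).trans ?_
    linarith [hD2 (x / N)]

lemma tendsto_eLpNorm_two_of_dominated {α : Type*} [MeasurableSpace α] {m : Measure α}
    {F : ℕ → α → ℂ} {f : α → ℂ} {w : α → ℝ} (hF : ∀ k, AEStronglyMeasurable (F k - f) m)
    (hw : MemLp w 2 m) (hb : ∀ k q, ‖F k q - f q‖ ≤ w q)
    (hlim : ∀ q, Tendsto (fun k => F k q) atTop (𝓝 (f q))) :
    Tendsto (fun k => eLpNorm (F k - f) 2 m) atTop (𝓝 0) := by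
  have e : ∀ k, eLpNorm (F k - f) 2 m = (∫⁻ q, ‖F k q - f q‖ₑ ^ (2 : ℝ) ∂m) ^ (1 / 2 : ℝ) := by
    intro k
    rw [eLpNorm_eq_lintegral_rpow_enorm_toReal (by norm_num) (by norm_num)]
    simp
  simp_rw [e]
  have h1 : Tendsto (fun k => ∫⁻ q, ‖F k q - f q‖ₑ ^ (2 : ℝ) ∂m) atTop (𝓝 (∫⁻ _, 0 ∂m)) := by
    refine tendsto_lintegral_of_dominated_convergence' (fun q => ‖w q‖ₑ ^ (2 : ℝ))
      (fun k => ((hF k).enorm).pow_const _) (fun k => Eventually.of_forall fun q => ?_) ?_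
      (Eventually.of_forall fun q => ?_)
    · refine ENNReal.rpow_le_rpow ?_ (by norm_num)
      rw [enorm_le_iff_norm_le]
      exact (hb k q).trans (le_abs_self _)
    · have := hw.eLpNorm_lt_top
      rw [eLpNorm_eq_lintegral_rpow_enorm_toReal (by norm_num) (by norm_num)] at this
      have h2 := (ENNReal.rpow_lt_top_iff_of_pos (by norm_num)).1 this
      simpa using h2.ne
    · have h3 : Tendsto (fun k => F k q - f q) atTop (𝓝 0) := by
        simpa using (hlim q).sub_const (f q)
      have h4 := h3.enorm
      rw [enorm_zero] at h4
      have h5 := h4.ennrpow_const (2 : ℝ)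
      simpa using h5
  rw [lintegral_zero] at h1
  simpa using h1.ennrpow_const (1 / 2 : ℝ)

/-- A quasiperiodic `C¹` function with exponentially decaying value and gradient belongs to
`H₁^β(Π)`. -/
lemma isH1_of_decay {β B δ : ℝ} {v : ℝ × ℝ → ℂ} (hδ : 0 < δ) (hv : ContDiff ℝ 1 v)
    (hp : ∀ x y, v (x, y + 2 * π) = Complex.exp (2 * π * Complex.I * β) * v (x, y))
    (h0 : ∀ q, ‖v q‖ ≤ B * Real.exp (-(δ * |q.1|)))
    (hX : ∀ q, ‖dX v q‖ ≤ B * Real.exp (-(δ * |q.1|)))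
    (hY : ∀ q, ‖dY v q‖ ≤ B * Real.exp (-(δ * |q.1|))) : IsH1 β v (dX v) (dY v) := by
  have cX : Continuous (dX v) := (contDiff_dX (m := 0) hv (by simp)).continuous
  have cY : Continuous (dY v) := (contDiff_dY (m := 0) hv (by simp)).continuous
  have hB : 0 ≤ B := by simpa using (norm_nonneg _).trans (h0 0)
  have hle : ∀ q : ℝ × ℝ, B * Real.exp (-(δ * |q.1|)) ≤ B := fun q =>
    mul_le_of_le_one_right hB (Real.exp_le_one_iff.2 (neg_nonpos.2 (by positivity)))
  obtain ⟨D, hD0, hD⟩ := exists_deriv_cutoff_bound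
  let N : ℕ → ℝ := fun k => (k : ℝ) + 1
  have hN1 : ∀ k, 1 ≤ N k := fun k => by simp [N]
  have hN0 : ∀ k, 0 < N k := fun k => zero_lt_one.trans_le (hN1 k)
  -- The cut-off depends on `x` alone and does not disturb quasiperiodicity in `y`; widening it and
  -- refining the mollifier are tied to the same index.
  let φ : ℕ → ℝ × ℝ → ℂ := fun k q => cutoff (N k) q.1 * mollify k v q
  have hφX : ∀ k q, dX (φ k) q =
      deriv (cutoff (N k)) q.1 * mollify k v q + cutoff (N k) q.1 * mollify k (dX v) q := by
    intro k q
    have h1 := ((contDiff_cutoff (N k)).differentiable (by simp) q.1).hasDerivAt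
    exact (h1.mul (hasDerivAt_mollify_fst k hv (fun q => (hX q).trans (hle q)) q)).deriv
  have hφY : ∀ k q, dY (φ k) q = cutoff (N k) q.1 * mollify k (dY v) q := fun k q =>
    ((hasDerivAt_mollify_snd k hv (fun q => (hY q).trans (hle q)) q).const_mul (cutoff (N k) q.1)).deriv
  have hsm : ∀ k, ContDiff ℝ ∞ (φ k) := fun k =>
    ((contDiff_cutoff (N k)).comp contDiff_fst).mul (contDiff_mollify k hv.continuous)
  have cφX : ∀ k, Continuous (dX (φ k)) := fun k =>
    (contDiff_dX (m := 0) (hsm k) (by simp)).continuous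
  have cφY : ∀ k, Continuous (dY (φ k)) := fun k =>
    (contDiff_dY (m := 0) (hsm k) (by simp)).continuous
  have hcut : ∀ x, Tendsto (fun k => cutoff (N k) x) atTop (𝓝 1) := fun x => by
    obtain ⟨K, hK⟩ := exists_nat_ge |x|
    refine tendsto_const_nhds.congr' ?_
    filter_upwards [eventually_ge_atTop K] with k hk
    have hk' : (K : ℝ) ≤ k := by exact_mod_cast hk
    refine (cutoff_eq_one (hN0 k) ?_).symm
    simp only [N]
    linarith
  have hcut' : ∀ x, Tendsto (fun k => deriv (cutoff (N k)) x) atTop (𝓝 0) := fun x => by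
    refine squeeze_zero_norm (fun k => (hD (N k) (hN1 k) x).1) ?_
    have := (tendsto_one_div_add_atTop_nhds_zero_nat (𝕜 := ℝ)).const_mul D
    simpa [N, div_eq_mul_inv] using this
  set E := Real.exp δ with hE
  have hE0 : 0 < E := Real.exp_pos _
  have m0 := fun k => norm_mollify_le k hδ.le h0
  have mX := fun k => norm_mollify_le k hδ.le hX
  have mY := fun k => norm_mollify_le k hδ.le hY
  have hcm : ∀ k (q : ℝ × ℝ) (z : ℂ), ‖cutoff (N k) q.1 * z‖ ≤ ‖z‖ := fun k q z => by
    rw [norm_mul]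
    exact mul_le_of_le_one_left (norm_nonneg _) (norm_cutoff_le _ _)
  have hdm : ∀ k (q : ℝ × ℝ) (z : ℂ), ‖deriv (cutoff (N k)) q.1 * z‖ ≤ D * ‖z‖ := fun k q z => by
    rw [norm_mul]
    refine mul_le_mul_of_nonneg_right ((hD (N k) (hN1 k) _).1.trans ?_) (norm_nonneg _)
    exact div_le_self hD0 (hN1 k)
  have hw : ∀ C : ℝ, MemLp (fun q : ℝ × ℝ => C * Real.exp (-(δ * |q.1|))) 2 stripMeasure := fun C =>
    (memLp_exp_neg_abs hδ).1.const_mul C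
  refine ⟨(memLp_strip_of_le hv.continuous.aestronglyMeasurable hδ (Eventually.of_forall h0)).1,
    (memLp_strip_of_le cX.aestronglyMeasurable hδ (Eventually.of_forall hX)).1,
    (memLp_strip_of_le cY.aestronglyMeasurable hδ (Eventually.of_forall hY)).1, φ,
    fun k => ⟨hsm k, quasiBC_of_forall fun x y => ?_, 2 * N k, fun x y hx => ?_⟩, ?_, ?_, ?_⟩
  · simp only [φ, mollify_add_two_pi k hp]
    ring
  · simp only [φ]
    rw [cutoff_eq_zero (hN0 k) hx.le, zero_mul]
  · refine tendsto_eLpNorm_two_of_dominated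
      (fun k => ((hsm k).continuous.sub hv.continuous).aestronglyMeasurable) (hw (B * E + B))
      (fun k q => (norm_sub_le _ _).trans ?_) fun q => ?_
    · rw [add_mul]
      exact add_le_add ((hcm k q _).trans (m0 k q)) (h0 q)
    · simpa using (hcut q.1).mul (tendsto_mollify hv.continuous q)
  · refine tendsto_eLpNorm_two_of_dominated
      (fun k => ((cφX k).sub cX).aestronglyMeasurable) (hw (D * (B * E) + B * E + B))
      (fun k q => (norm_sub_le _ _).trans ?_) fun q => ?_
    · rw [add_mul, add_mul, mul_assoc D, hφX]
      refine add_le_add ((norm_add_le _ _).trans (add_le_add ((hdm k q _).trans ?_)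
        ((hcm k q _).trans (mX k q)))) (hX q)
      exact mul_le_mul_of_nonneg_left (m0 k q) hD0
    · simp_rw [hφX]
      simpa using ((hcut' q.1).mul (tendsto_mollify hv.continuous q)).add
        ((hcut q.1).mul (tendsto_mollify cX q))
  · refine tendsto_eLpNorm_two_of_dominated
      (fun k => ((cφY k).sub cY).aestronglyMeasurable) (hw (B * E + B))
      (fun k q => (norm_sub_le _ _).trans ?_) fun q => ?_
    · rw [add_mul, hφY]
      exact add_le_add ((hcm k q _).trans (mY k q)) (hY q)
    · simp_rw [hφY]
      simpa using (hcut q.1).mul (tendsto_mollify cY q)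

/-! ### `Ψ` solves the scattering problem. -/

section

variable {p : Perturbation} {β ε μ : ℝ}

lemma isScatteringSolution_psi (hβ : 0 < β) (hβ' : β < 1 / 2) (hμ : 0 < μ)
    (hμ' : μ < √(1 - 2 * β)) (hu : IsUnit (1 - (ε : ℂ) • opT p β μ)) (hd : disp p β ε μ ≠ 0) :
    IsScatteringSolution p β ε μ (psi p β ε μ) (reflCoeff p β ε μ) (transCoeff p β ε μ) := by
  obtain ⟨a', a'', b, δ, hδ, hb⟩ := exists_modeBounds_restComp hβ hβ' hμ hμ' hu hd
  have hβ1 : |β| ≤ 1 := by rw [abs_of_pos hβ]; linarith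
  have hcl := isClassicalSolution_psi hβ hβ' hμ hμ' hu hd
  have hψ := hcl.1.differentiable (by simp)
  have hℓ := (contDiff_leading β μ (reflCoeff p β ε μ) (transCoeff p β ε μ)).differentiable
    (by simp)
  have hsub := psi_sub_leading hβ hβ' hμ hμ' hu hd
  refine ⟨dX (modeSum β (restComp p β ε μ)), dY (modeSum β (restComp p β ε μ)), ?_, fun φ hφ => ?_⟩
  · rw [hsub]
    exact isH1_of_decay hδ ((hb.contDiff_two hβ1).of_le (by norm_num))
      (modeSum_add_two_pi β _) hb.norm_le (hb.norm_dX_le hβ1) (hb.norm_dY_le hβ1)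
  · rw [← weak_of_classical hcl hφ, ← hsub, dX_sub hψ hℓ, dY_sub hψ hℓ]
    simp

lemma summable_psi (hβ : 0 < β) (hβ' : β < 1 / 2) (hμ : 0 < μ)
    (hμ' : μ < √(1 - 2 * β)) (hu : IsUnit (1 - (ε : ℂ) • opT p β μ)) (hd : disp p β ε μ ≠ 0)
    (x y : ℝ) : Summable fun n : ℤ => psiComp p β ε μ n x * Complex.exp (Complex.I * n * y) := by
  obtain ⟨b, hb⟩ := exists_modeBounds_psiComp hβ hβ' hμ hμ' hu hd
  refine Summable.of_norm_bounded hb.summable fun n => ?_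
  have := norm_modeExp 0 n y
  rw [Complex.ofReal_zero, zero_add] at this
  rw [norm_mul, this, mul_one]
  exact (hb.bound_zero n x).trans (hb.mul_exp_le n x)

end

/-! ### Estimates uniform in `μ` and the Neumann series. -/

section

variable {p : Perturbation} {β μ ε : ℝ}

/-- The reason for the regularization: `(1 - e^{-μ|x|})/(2μ) ≤ |x|/2` stays bounded as `μ → 0`,
whereas `G_{-1}` grows like `1/(2μ)`. The restriction on `μ` keeps `k₀` away from zero, and the
other `k_m` are at least `2β/3`. -/
lemma exists_norm_kernelH_le (hβ : 0 < β) (hβ' : β < 1 / 2) {r : ℝ} (hr : 0 ≤ r) :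
    ∃ M, 0 ≤ M ∧ ∀ μ, 0 < μ → μ ^ 2 ≤ (1 - 2 * β) / 2 →
      ∀ n, ∀ x ∈ Icc (-r) r, ‖kernelH β μ n x‖ ≤ M := by
  have hs : 0 < √((1 - 2 * β) / 2) := Real.sqrt_pos.2 (by linarith)
  have h1 : 0 ≤ 1 / (2 * √((1 - 2 * β) / 2)) := by positivity
  have h2 : 0 ≤ 3 / (4 * β) := by positivity
  refine ⟨r / 2 + 1 / (2 * √((1 - 2 * β) / 2)) + 3 / (4 * β), by positivity,
    fun μ hμ hμ' n x hx => ?_⟩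
  have hx' : |x| ≤ r := abs_le.2 hx
  by_cases n1 : n = -1
  · simp only [kernelH, n1, if_true]
    rw [Complex.norm_real, norm_mul, Real.norm_eq_abs, Real.norm_eq_abs, abs_of_pos (by positivity),
      abs_of_nonpos (by
        rw [sub_nonpos, Real.exp_le_one_iff]
        have := abs_nonneg x
        nlinarith)]
    have h3 := Real.add_one_le_exp (-(μ * |x|))
    have h4 : 1 / (2 * μ) * -(Real.exp (-(μ * |x|)) - 1) ≤ 1 / (2 * μ) * (μ * |x|) :=
      mul_le_mul_of_nonneg_left (by linarith) (by positivity)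
    have h5 : 1 / (2 * μ) * (μ * |x|) = |x| / 2 := by field_simp
    linarith
  rw [kernelH_of_ne n1]
  by_cases n0 : n = 0
  · have hk : √((1 - 2 * β) / 2) ≤ kZero β μ := Real.sqrt_le_sqrt (by linarith)
    simp only [green, n0, if_true]
    rw [norm_mul, norm_div, Complex.norm_I, norm_mul, Complex.norm_real, Complex.norm_exp,
      Real.norm_of_nonneg (hs.le.trans hk)]
    have h3 : 1 / (2 * kZero β μ) ≤ 1 / (2 * √((1 - 2 * β) / 2)) :=
      one_div_le_one_div_of_le (by positivity) (by linarith)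
    simp
    simp at h3 h1 h2
    linarith
  · have hk := le_kExp (μ := μ) hβ hβ' n0 n1
    have hk' : 2 * β / 3 ≤ kExp β μ n := by
      have : 0 ≤ 2 * β / 3 * |(n : ℝ)| := by positivity
      linarith
    have hkp : 0 < kExp β μ n := lt_of_lt_of_le (by positivity) hk'
    simp only [green, n0, n1, if_false]
    rw [Complex.norm_real, norm_mul, Real.norm_eq_abs, Real.norm_eq_abs, Real.abs_exp,
      abs_of_pos (by positivity)]
    have e1 : Real.exp (-(kExp β μ n * |x|)) ≤ 1 := by
      rw [Real.exp_le_one_iff]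
      have := abs_nonneg x
      nlinarith
    have e2 : 1 / (2 * kExp β μ n) ≤ 3 / (4 * β) := by
      rw [div_le_div_iff₀ (by positivity) (by positivity)]
      linarith
    have := mul_le_mul e2 e1 (Real.exp_pos _).le h2
    linarith

lemma Space.norm_le_of_forall {A B : Space p} {c : ℝ} (hc : 0 ≤ c) (h : ∀ n, ‖B n‖ ≤ c * ‖A n‖) :
    ‖B‖ ≤ c * ‖A‖ := by
  refine lp.norm_le_of_forall_sum_le (by norm_num) (by positivity) fun s => ?_
  simp only [ENNReal.toReal_ofNat, Real.rpow_two]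
  have h3 := lp.sum_rpow_le_norm_rpow (p := 2) (by norm_num) A s
  simp only [ENNReal.toReal_ofNat, Real.rpow_two] at h3
  calc _ ≤ ∑ n ∈ s, c ^ 2 * ‖A n‖ ^ 2 := Finset.sum_le_sum fun n _ => by
        rw [← mul_pow]
        exact pow_le_pow_left₀ (norm_nonneg _) (h n) 2
    _ = c ^ 2 * ∑ n ∈ s, ‖A n‖ ^ 2 := by rw [Finset.mul_sum]
    _ ≤ _ := by
        rw [mul_pow c ‖A‖]
        exact mul_le_mul_of_nonneg_left h3 (by positivity)

/-- `T̂` is `2γ` times the diagonal convolution with the `H_n`, bounded by `M · 2R`, followed by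
multiplication by `f`, bounded by the sum of the norms of the `f_j`. -/
lemma norm_opT_apply_le {M : ℝ} (hM0 : 0 ≤ M)
    (hM : ∀ n, ∀ x ∈ Icc (-(2 * p.R)) (2 * p.R), ‖kernelH β μ n x‖ ≤ M) (A : Space p) :
    ‖opT p β μ A‖ ≤ 2 * |gam β μ| * ((∑' j, ‖coeffC p j‖) * (M * (2 * p.R))) * ‖A‖ := by
  have hR := p.R_pos
  obtain ⟨D, hD⟩ := exists_diag p β μ
  obtain ⟨L, hL, hLs⟩ := exists_mulOp p
  have h1 : opT p β μ A = (2 * gam β μ : ℂ) • L (D A) := by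
    ext m : 2
    refine (hasSum_opT p β μ A m).unique (((hLs (D A) m).const_smul (2 * gam β μ : ℂ)).congr_fun ?_)
    intro n
    rw [hD]
  have h2 : ‖D A‖ ≤ M * (2 * p.R) * ‖A‖ := Space.norm_le_of_forall (by positivity) fun n => by
    rw [hD]
    exact norm_convH_le β μ n (A n) hM0 (hM n)
  have h3 : ‖L (D A)‖ ≤ (∑' j, ‖coeffC p j‖) * (M * (2 * p.R) * ‖A‖) :=
    (L.le_opNorm _).trans (mul_le_mul hL h2 (norm_nonneg _) (tsum_nonneg fun _ => norm_nonneg _))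
  rw [h1, norm_smul]
  have h4 : ‖(2 * gam β μ : ℂ)‖ = 2 * |gam β μ| := by
    rw [norm_mul, Complex.norm_real, Real.norm_eq_abs]
    norm_num
  rw [h4, mul_assoc (2 * |gam β μ|)]
  refine mul_le_mul_of_nonneg_left (h3.trans_eq ?_) (by positivity)
  ring

lemma gam_le : gam β μ ≤ (1 - β) ^ 2 / (4 * π) :=
  div_le_div_of_nonneg_right (by unfold omegaSq; nlinarith) (by positivity)

/-- `ω² = (1-β)² - μ² ≥ (1-β)² - (1-2β) = β²`, a lower bound free of `μ`. -/
lemma le_gam (hμ : μ ^ 2 ≤ 1 - 2 * β) : β ^ 2 / (4 * π) ≤ gam β μ :=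
  div_le_div_of_nonneg_right (by unfold omegaSq; nlinarith) (by positivity)

lemma exists_norm_opT_le (p : Perturbation) (hβ : 0 < β) (hβ' : β < 1 / 2) :
    ∃ K, 0 < K ∧ ∀ μ, 0 < μ → μ ^ 2 ≤ (1 - 2 * β) / 2 → ‖opT p β μ‖ ≤ K := by
  have hR := p.R_pos
  obtain ⟨M, hM0, hM⟩ := exists_norm_kernelH_le hβ hβ' (r := 2 * p.R) (by positivity)
  have hS : 0 ≤ ∑' j, ‖coeffC p j‖ := tsum_nonneg fun _ => norm_nonneg _
  -- The summand `1` only ensures `K > 0`, so that `1/(2K)` can serve as a threshold for `ε`.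
  refine ⟨2 * ((1 - β) ^ 2 / (4 * π)) * ((∑' j, ‖coeffC p j‖) * (M * (2 * p.R))) + 1,
    by positivity, fun μ hμ hμ' => ?_⟩
  refine ContinuousLinearMap.opNorm_le_bound _ (by positivity) fun A => ?_
  refine (norm_opT_apply_le hM0 (hM μ hμ hμ') A).trans
    (mul_le_mul_of_nonneg_right ?_ (norm_nonneg _))
  have h1 : 0 ≤ gam β μ := le_trans (by positivity) (le_gam (by linarith))
  rw [abs_of_nonneg h1]
  have h2 := mul_le_mul_of_nonneg_right (mul_le_mul_of_nonneg_left (gam_le (β := β) (μ := μ))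
    zero_le_two) (mul_nonneg hS (mul_nonneg hM0 (by positivity : 0 ≤ 2 * p.R)))
  linarith

lemma isUnit_one_sub_smul {E : Type*} [NormedAddCommGroup E] [NormedSpace ℂ E] [CompleteSpace E]
    {T : E →L[ℂ] E} {K ε : ℝ} (hT : ‖T‖ ≤ K) (hε : 0 ≤ ε) (h : ε * K < 1) :
    IsUnit (1 - (ε : ℂ) • T) := by
  refine isUnit_one_sub_of_norm_lt_one (lt_of_le_of_lt ?_ h)
  rw [norm_smul, Complex.norm_real, Real.norm_of_nonneg hε]
  exact mul_le_mul_of_nonneg_left hT hε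

lemma norm_resolvent_apply_le {K : ℝ} (hT : ‖opT p β μ‖ ≤ K) (hε : 0 ≤ ε) (h : ε * K ≤ 1 / 2)
    (v : Space p) : ‖resolvent p β ε μ v‖ ≤ 2 * ‖v‖ := by
  have hu : IsUnit (1 - (ε : ℂ) • opT p β μ) := isUnit_one_sub_smul hT hε (by linarith)
  generalize hw : resolvent p β ε μ v = w
  have h1 := resolvent_eq hu v
  rw [hw] at h1
  have h2 : ‖w‖ ≤ ‖v‖ + ε * (K * ‖w‖) := by
    calc ‖w‖ = ‖v + (ε : ℂ) • opT p β μ w‖ := congrArg norm h1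
      _ ≤ ‖v‖ + ‖(ε : ℂ) • opT p β μ w‖ := norm_add_le _ _
      _ ≤ _ := by
        rw [norm_smul, Complex.norm_real, Real.norm_of_nonneg hε]
        gcongr
        exact (opT p β μ).le_of_opNorm_le hT w
  have h3 := mul_le_mul_of_nonneg_right h (norm_nonneg w)
  linarith

lemma norm_avg_le (a : Comp p) : ‖avg a‖ ≤ 2 * p.R * ‖a‖ := by
  have hR := p.R_pos
  have e : avg a = ∫ x in Icc (-p.R) p.R, IccExtend (by linarith [p.R_pos] : -p.R ≤ p.R) a x := by
    rw [avg, zeroExt_eq_indicator, integral_indicator measurableSet_Icc]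
  rw [e]
  refine (norm_setIntegral_le_of_norm_le_const (C := ‖a‖) (by simp) fun x _ =>
    a.norm_coe_le_norm _).trans_eq ?_
  rw [Real.volume_real_Icc_of_le (by linarith)]
  ring

/-- The expansion of `F` to second order in `ε`. -/
lemma norm_quantF_sub_le {K : ℝ} (hT : ‖opT p β μ‖ ≤ K) (hε : 0 ≤ ε) (h : ε * K ≤ 1 / 2) :
    ‖quantF p β ε μ - (avg (gTwo p (-1)) + ε * avg (opT p β μ (gTwo p) (-1)))‖ ≤
      ε ^ 2 * (2 * p.R * (K * (K * (2 * ‖gTwo p‖)))) := by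
  have hu : IsUnit (1 - (ε : ℂ) • opT p β μ) := isUnit_one_sub_smul hT hε (by linarith)
  have hb := norm_resolvent_apply_le hT hε h (gTwo p)
  have h1 := resolvent_eq hu (gTwo p)
  have hF : quantF p β ε μ = avg (resolvent p β ε μ (gTwo p) (-1)) := rfl
  generalize resolvent p β ε μ (gTwo p) = w at h1 hb hF
  generalize gTwo p = v at h1 hb
  have hR := p.R_pos
  have hK : 0 ≤ K := (opT p β μ).opNorm_nonneg.trans hT
  -- The resolvent equation `w = v + εT̂w` substituted into itself once.
  have h2 : w (-1) = v (-1) + (ε : ℂ) • opT p β μ v (-1) +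
      ((ε : ℂ) ^ 2) • opT p β μ (opT p β μ w) (-1) := by
    have e1 : opT p β μ w = opT p β μ v + (ε : ℂ) • opT p β μ (opT p β μ w) := by
      conv_lhs => rw [h1, map_add, map_smul]
    have e2 : w (-1) = v (-1) + (ε : ℂ) • opT p β μ w (-1) := congrArg (fun B : Space p => B (-1)) h1
    have e3 : opT p β μ w (-1) = opT p β μ v (-1) + (ε : ℂ) • opT p β μ (opT p β μ w) (-1) :=
      congrArg (fun B : Space p => B (-1)) e1
    rw [e2, e3]
    ext x
    simp
    ring
  rw [hF, h2]
  simp only [avg_eq_pairing, map_add, map_smul, smul_eq_mul]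
  rw [add_sub_cancel_left, ← avg_eq_pairing, norm_mul, norm_pow, Complex.norm_real,
    Real.norm_of_nonneg hε]
  refine mul_le_mul_of_nonneg_left ((norm_avg_le _).trans ?_) (by positivity)
  refine mul_le_mul_of_nonneg_left ?_ (by positivity)
  refine (lp.norm_apply_le_norm (by norm_num) _ _).trans ?_
  refine ((opT p β μ).le_of_opNorm_le hT _).trans (mul_le_mul_of_nonneg_left ?_ hK)
  exact ((opT p β μ).le_of_opNorm_le hT _).trans (mul_le_mul_of_nonneg_left hb hK)

end

/-! ### The imaginary part of `F`. -/

section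

variable {p : Perturbation} {β μ ε : ℝ}

lemma conj_coeff (p : Perturbation) (j : ℤ) (x : ℝ) : conj (p.coeff j x) = p.coeff (-j) x := by
  unfold Perturbation.coeff
  rw [intervalIntegral.integral_of_le (by positivity), intervalIntegral.integral_of_le (by positivity),
    ← integral_conj]
  congr 1
  funext y
  rw [map_mul, ← Complex.exp_conj]
  simp

lemma zeroExt_coeffC (p : Perturbation) (j : ℤ) : zeroExt (coeffC p j) = p.coeff j := by
  funext x
  by_cases hx : x ∈ Icc (-p.R) p.R
  · rw [zeroExt_of_mem _ hx]
    rfl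
  · rw [zeroExt_of_notMem _ hx, coeff_eq_zero p j]
    by_contra h
    exact hx (abs_le.1 (not_lt.1 h))

/-- The term of order zero in `F` is real because `f` is, so the sign of `Im F` is decided at order
`ε`. -/
lemma im_avg_coeffC_zero (p : Perturbation) : (avg (coeffC p 0)).im = 0 := by
  rw [← Complex.conj_eq_iff_im, avg, zeroExt_coeffC, ← integral_conj]
  simp only [conj_coeff, neg_zero]

/-- The quadratic form `∫ ā (H * a)`. -/
def convForm (H a : ℝ → ℂ) : ℂ := ∫ x : ℝ, conj (a x) * ∫ ξ : ℝ, H (x - ξ) * a ξ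

/-- Interchanging the two integrations swaps `x` and `ξ`, which an even kernel does not notice. A
real even kernel thus has a real form. -/
lemma conj_convForm {H a : ℝ → ℂ} {R : ℝ} (hH : Continuous H) (he : ∀ x, H (-x) = H x)
    (ha : Continuous a) (h0 : ∀ x, R < |x| → a x = 0) :
    conj (convForm H a) = convForm (fun x => conj (H x)) a := by
  unfold convForm
  rw [← integral_conj]
  simp_rw [map_mul, Complex.conj_conj, ← integral_conj, ← integral_const_mul]
  rw [integral_integral_swap_of_hasCompactSupport]
  · congr 1
    funext ξ
    congr 1
    funext x
    rw [map_mul, ← he (x - ξ), neg_sub]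
    ring
  · have hc : Continuous fun z : ℂ => conj z := Complex.continuous_conj
    simp only [Function.uncurry_def, map_mul]
    fun_prop
  · refine HasCompactSupport.intro
      ((isCompact_Icc (a := -R) (b := R)).prod (isCompact_Icc (a := -R) (b := R))) fun q hq => ?_
    by_cases h1 : R < |q.1|
    · simp [Function.uncurry_def, h0 _ h1]
    · have h2 : R < |q.2| := by
        by_contra h2
        exact hq ⟨abs_le.1 (not_lt.1 h1), abs_le.1 (not_lt.1 h2)⟩
      simp [Function.uncurry_def, h0 _ h2]

/-- `f_{-j} = conj f_j` since `f` is real, so the average is a quadratic form in `f_j`. -/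
lemma avg_convH_mul (n j : ℤ) :
    avg (convH β μ n (coeffC p j) * coeffC p (-j)) = convForm (kernelH β μ n) (p.coeff j) := by
  unfold avg convForm
  congr 1
  funext x
  by_cases hx : x ∈ Icc (-p.R) p.R
  · rw [zeroExt_of_mem _ hx, conj_coeff, ← zeroExt_coeffC p j]
    exact mul_comm _ _
  · rw [zeroExt_of_notMem _ hx, coeff_eq_zero p j, map_zero, zero_mul]
    by_contra h
    exact hx (abs_le.1 (not_lt.1 h))

lemma kernelH_neg (n : ℤ) (x : ℝ) : kernelH β μ n (-x) = kernelH β μ n x := by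
  simp only [kernelH, green, abs_neg]

lemma conj_kernelH {n : ℤ} (hn : n ≠ 0) (x : ℝ) : conj (kernelH β μ n x) = kernelH β μ n x := by
  simp only [kernelH, green, hn, if_false]
  split_ifs <;> exact Complex.conj_ofReal _

lemma im_convForm_of_ne_zero {n : ℤ} (hn : n ≠ 0) (j : ℤ) :
    (convForm (kernelH β μ n) (p.coeff j)).im = 0 := by
  rw [← Complex.conj_eq_iff_im, conj_convForm (continuous_kernelH β μ n) (kernelH_neg n)
    (continuous_coeff p j) fun x hx => coeff_eq_zero p j hx]
  simp only [conj_kernelH hn]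

/-- Two Green functions of the same operator differ by a solution of the homogeneous equation. It is
even and contains no `|x|`, so its convolution kernel is degenerate. -/
lemma expGreen_neg {k : ℂ} (hk : k ≠ 0) (x : ℝ) :
    expGreen k x = expGreen (-k) x +
      1 / (2 * k) * (Complex.exp (k * x) + Complex.exp (-(k * x))) := by
  unfold expGreen
  rcases le_total 0 x with h | h
  · rw [abs_of_nonneg h]
    field_simp
    simp
  · rw [abs_of_nonpos h]
    field_simp
    simp

lemma coeffHat_eq (p : Perturbation) (j : ℤ) (κ : ℝ) :
    p.coeffHat j κ = ∫ x : ℝ, Complex.exp (-(Complex.I * κ * x)) * p.coeff j x := rfl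

lemma integral_add_mul_add {g a b : ℝ → ℂ} (hg : Integrable g) (ha : Integrable a)
    (hb : Integrable b) (c d e : ℂ) :
    ∫ x, (g x + c * (d * a x + e * b x)) = (∫ x, g x) + c * (d * (∫ x, a x) + e * ∫ x, b x) := by
  have h1 : Integrable fun x => d * a x + e * b x := (ha.const_mul d).add (hb.const_mul e)
  rw [integral_add hg (h1.const_mul c), integral_const_mul,
    integral_add (ha.const_mul d) (hb.const_mul e), integral_const_mul, integral_const_mul]

/-- Subtracting the conjugate kernel from the outgoing one leaves `(i/2k₀)(e^{ik₀(x-ξ)} +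
e^{-ik₀(x-ξ)})`. Each exponential factors into a function of `x` and one of `ξ`, so the form splits
into squared moduli of Fourier transforms; half of it is the imaginary part. -/
lemma im_convForm_zero (hk : 0 < kZero β μ) (j : ℤ) :
    (convForm (kernelH β μ 0) (p.coeff j)).im =
      1 / (4 * kZero β μ) *
        (‖p.coeffHat j (kZero β μ)‖ ^ 2 + ‖p.coeffHat j (-kZero β μ)‖ ^ 2) := by
  set κ := kZero β μ with hκ
  have ha := continuous_coeff p j
  have h0 : ∀ x, p.R < |x| → p.coeff j x = 0 := fun x hx => coeff_eq_zero p j hx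
  have hk0 : (Complex.I * κ : ℂ) ≠ 0 :=
    mul_ne_zero Complex.I_ne_zero (by exact_mod_cast hk.ne')
  have hker : kernelH β μ 0 = expGreen (-(Complex.I * κ)) := by
    rw [kernelH_of_ne (by norm_num), green_eq, waveNumber_zero]
  have hconj : ∀ x, conj (kernelH β μ 0 x) = expGreen (Complex.I * κ) x := by
    intro x
    rw [hker]
    unfold expGreen
    rw [map_mul, ← Complex.exp_conj]
    simp [Complex.conj_ofNat]
  have h1 := conj_convForm (continuous_kernelH β μ 0) (kernelH_neg 0) ha h0
  simp only [hconj] at h1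
  have hcj : ∀ ξ : ℝ, conj (p.coeffHat j ξ) =
      ∫ x : ℝ, Complex.exp (Complex.I * ξ * x) * conj (p.coeff j x) := by
    intro ξ
    rw [coeffHat_eq, ← integral_conj]
    congr 1
    funext x
    rw [map_mul, ← Complex.exp_conj]
    simp
  have hinner : ∀ x : ℝ, ∫ ξ : ℝ, kernelH β μ 0 (x - ξ) * p.coeff j ξ =
      gconv (Complex.I * κ) (p.coeff j) x + Complex.I / (2 * κ) *
        (Complex.exp (Complex.I * κ * x) * p.coeffHat j κ +
          Complex.exp (Complex.I * (-κ : ℝ) * x) * p.coeffHat j (-κ)) := by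
    intro x
    have e : ∀ ξ : ℝ, kernelH β μ 0 (x - ξ) * p.coeff j ξ =
        expGreen (Complex.I * κ) (x - ξ) * p.coeff j ξ + Complex.I / (2 * κ) *
          (Complex.exp (Complex.I * κ * x) * (Complex.exp (-(Complex.I * κ * ξ)) * p.coeff j ξ) +
          Complex.exp (Complex.I * (-κ : ℝ) * x) *
            (Complex.exp (-(Complex.I * (-κ : ℝ) * ξ)) * p.coeff j ξ)) := by
      intro ξ
      have hκ' : (κ : ℂ) ≠ 0 := by exact_mod_cast hk.ne'
      have e1 : Complex.exp (Complex.I * κ * x) * Complex.exp (-(Complex.I * κ * ξ)) =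
          Complex.exp (Complex.I * κ * (x - ξ : ℝ)) := by
        rw [← Complex.exp_add]
        congr 1
        push_cast
        ring
      have e2 : Complex.exp (Complex.I * (-κ : ℝ) * x) * Complex.exp (-(Complex.I * (-κ : ℝ) * ξ)) =
          Complex.exp (-(Complex.I * κ * (x - ξ : ℝ))) := by
        rw [← Complex.exp_add]
        congr 1
        push_cast
        ring
      have e3 : (1 : ℂ) / (2 * (Complex.I * κ)) = -(Complex.I / (2 * κ)) := by
        field_simp
        simp
      rw [hker, ← mul_assoc, e1, ← mul_assoc, e2]
      have e4 := expGreen_neg hk0 (x - ξ)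
      rw [e3] at e4
      linear_combination -p.coeff j ξ * e4
    simp_rw [e]
    have i1 : ∀ κ : ℝ, Integrable fun ξ : ℝ =>
        Complex.exp (-(Complex.I * κ * ξ)) * p.coeff j ξ := fun κ =>
      integrable_mul_of_vanish ha h0 (by fun_prop)
    have i2 : Integrable fun ξ : ℝ => expGreen (Complex.I * κ) (x - ξ) * p.coeff j ξ :=
      integrable_mul_of_vanish ha h0 ((continuous_expGreen _).comp (by fun_prop))
    rw [integral_add_mul_add i2 (i1 κ) (i1 (-κ))]
    rfl
  have hca : Continuous fun x => conj (p.coeff j x) := Complex.continuous_conj.comp ha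
  have hc0 : ∀ x, p.R < |x| → conj (p.coeff j x) = 0 := fun x hx => by rw [h0 x hx, map_zero]
  have h2 : convForm (kernelH β μ 0) (p.coeff j) =
      convForm (expGreen (Complex.I * κ)) (p.coeff j) + Complex.I / (2 * κ) *
        (p.coeffHat j κ * conj (p.coeffHat j κ) + p.coeffHat j (-κ) * conj (p.coeffHat j (-κ))) := by
    have i1 : ∀ κ : ℝ, Integrable fun x : ℝ =>
        Complex.exp (Complex.I * κ * x) * conj (p.coeff j x) := fun κ =>
      integrable_mul_of_vanish hca hc0 (by fun_prop)
    have i2 : Integrable fun x : ℝ => gconv (Complex.I * κ) (p.coeff j) x * conj (p.coeff j x) :=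
      integrable_mul_of_vanish hca hc0 (continuous_gconv hk0 ha h0)
    have e : convForm (kernelH β μ 0) (p.coeff j) = ∫ x : ℝ,
        (gconv (Complex.I * κ) (p.coeff j) x * conj (p.coeff j x) + Complex.I / (2 * κ) *
          (p.coeffHat j κ * (Complex.exp (Complex.I * κ * x) * conj (p.coeff j x)) +
          p.coeffHat j (-κ) * (Complex.exp (Complex.I * (-κ : ℝ) * x) * conj (p.coeff j x)))) := by
      unfold convForm
      congr 1
      funext x
      rw [hinner]
      ring
    rw [e, integral_add_mul_add i2 (i1 κ) (i1 (-κ)), ← hcj, ← hcj]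
    congr 1
    unfold convForm gconv
    congr 1
    funext x
    ring
  rw [← h1, Complex.mul_conj', Complex.mul_conj'] at h2
  have h3 := congrArg Complex.im h2
  have e5 : Complex.I / (2 * κ) * ((‖p.coeffHat j κ‖ : ℂ) ^ 2 + (‖p.coeffHat j (-κ)‖ : ℂ) ^ 2) =
      ((1 / (2 * κ) * (‖p.coeffHat j κ‖ ^ 2 + ‖p.coeffHat j (-κ)‖ ^ 2) : ℝ) : ℂ) * Complex.I := by
    push_cast
    ring
  rw [e5, Complex.add_im, Complex.conj_im, Complex.mul_I_im, Complex.ofReal_re] at h3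
  have e6 : (1 : ℝ) / (4 * κ) = 1 / (2 * κ) / 2 := by
    field_simp
    norm_num
  rw [e6]
  linarith

/-- Of the series over `n` only the term of the propagating mode `n = 0` is not real; there `g⁽²⁾`
has the component `f_1`, which couples the modes `0` and `-1`. -/
lemma im_avg_opT_gTwo (hk : 0 < kZero β μ) :
    (avg (opT p β μ (gTwo p) (-1))).im = 2 * gam β μ * (1 / (4 * kZero β μ) *
        (‖p.coeffHat 1 (kZero β μ)‖ ^ 2 + ‖p.coeffHat 1 (-kZero β μ)‖ ^ 2)) := by
  have h1 := (hasSum_opT p β μ (gTwo p) (-1)).mapL (pairing (fun _ => 1) continuous_const)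
  simp only [← avg_eq_pairing] at h1
  have h2 := Complex.hasSum_im h1
  have e : ∀ n, (avg ((2 * gam β μ : ℂ) • (convH β μ n (gTwo p n) * coeffC p (-1 - n)))).im =
      2 * gam β μ * (convForm (kernelH β μ n) (p.coeff (n + 1))).im := by
    intro n
    have e1 : (-1 - n : ℤ) = -(n + 1) := by ring
    change (avg ((2 * gam β μ : ℂ) • (convH β μ n (coeffC p (n + 1)) * coeffC p (-1 - n)))).im = _
    rw [avg_eq_pairing, map_smul, ← avg_eq_pairing, e1, avg_convH_mul, smul_eq_mul]
    have : (2 * gam β μ : ℂ) = ((2 * gam β μ : ℝ) : ℂ) := by push_cast; rfl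
    rw [this, Complex.im_ofReal_mul]
  simp only [e] at h2
  rw [← im_convForm_zero hk]
  refine h2.unique (hasSum_single 0 fun n hn => ?_)
  rw [im_convForm_of_ne_zero hn, mul_zero]

lemma continuous_coeffHat (p : Perturbation) (j : ℤ) : Continuous (p.coeffHat j) := by
  have ha := continuous_coeff p j
  have hi : Integrable (p.coeff j) := ha.integrable_of_hasCompactSupport
    (hasCompactSupport_of_vanish (R := p.R) fun x hx => coeff_eq_zero p j hx)
  refine continuous_of_dominated (bound := fun x => ‖p.coeff j x‖)
    (fun ξ => Continuous.aestronglyMeasurable (by fun_prop))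
    (fun ξ => Eventually.of_forall fun x => ?_) hi.norm
    (Eventually.of_forall fun x => by fun_prop)
  rw [norm_mul, Complex.norm_exp]
  simp

/-- The hypothesis concerns `κ`, the value of `k₀` at `μ = 0`; continuity of the Fourier transform
and of `k₀` carries half of the bound over to small `μ`. -/
lemma exists_le_im_avg_opT_gTwo (hβ : 0 < β)
    (h : p.coeffHat 1 (√(1 - 2 * β)) ≠ 0 ∨ p.coeffHat 1 (-√(1 - 2 * β)) ≠ 0) :
    ∃ c > 0, ∃ μ₀ > 0, ∀ μ, 0 < μ → μ < μ₀ → μ < √(1 - 2 * β) →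
      c ≤ (avg (opT p β μ (gTwo p) (-1))).im := by
  set S : ℝ → ℝ := fun k => ‖p.coeffHat 1 k‖ ^ 2 + ‖p.coeffHat 1 (-k)‖ ^ 2 with hS
  have hSc : Continuous S := by
    have := continuous_coeffHat p 1
    fun_prop
  have hkc : Continuous (kZero β) := by
    unfold kZero
    fun_prop
  have hS0 : 0 < S (kZero β 0) := by
    have e : kZero β 0 = √(1 - 2 * β) := by simp [kZero]
    rw [e]
    rcases h with h | h
    · have := norm_pos_iff.2 h
      simp only [hS]
      positivity
    · have := norm_pos_iff.2 h
      simp only [hS]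
      positivity
  have hev : ∀ᶠ μ in 𝓝 0, S (kZero β 0) / 2 < S (kZero β μ) :=
    (hSc.comp hkc).continuousAt.eventually (lt_mem_nhds (half_lt_self hS0))
  obtain ⟨μ₀, hμ₀, hball⟩ := Metric.eventually_nhds_iff.1 hev
  -- The factors bound `2γ`, `1/(4k₀)` (because `k₀ ≤ 1`), and the sum of squares from below.
  refine ⟨2 * (β ^ 2 / (4 * π)) * (1 / 4 * (S (kZero β 0) / 2)), by positivity, μ₀, hμ₀,
    fun μ hμ hμ' hμ1 => ?_⟩
  have hk := kZero_pos hμ hμ1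
  have hk1 : kZero β μ ≤ 1 := Real.sqrt_le_one.2 (by nlinarith)
  rw [im_avg_opT_gTwo hk]
  have h1 : S (kZero β 0) / 2 < S (kZero β μ) := hball (by
    rw [Real.dist_eq, sub_zero, abs_of_pos hμ]
    exact hμ')
  have h2 := le_gam (sq_lt_of_lt_sqrt hμ hμ1).le
  have h3 : (1 : ℝ) / 4 ≤ 1 / (4 * kZero β μ) :=
    one_div_le_one_div_of_le (by positivity) (by linarith)
  have h4 : 0 ≤ β ^ 2 / (4 * π) := by positivity
  exact mul_le_mul (by linarith) (mul_le_mul h3 h1.le (by positivity) (by positivity))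
    (by positivity) (by linarith)

/-- `Im F ≥ ε (c - εB)`, where `c` bounds the first-order term from below and `B` the remainder. For
`ε < c/(B+1)` this is positive, so `μ - εγF` has negative imaginary part. -/
lemma exists_isUnit_and_disp_ne_zero (p : Perturbation) (hβ : 0 < β) (hβ' : β < 1 / 2) :
    ∃ ε₀ > 0, ∃ μ₀ > 0, μ₀ ≤ √(1 - 2 * β) ∧ ∀ ε μ : ℝ, 0 < ε → ε < ε₀ → 0 < μ → μ < μ₀ →
      IsUnit (1 - (ε : ℂ) • opT p β μ) ∧
        (p.coeffHat 1 (√(1 - 2 * β)) ≠ 0 ∨ p.coeffHat 1 (-√(1 - 2 * β)) ≠ 0 →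
          disp p β ε μ ≠ 0) := by
  obtain ⟨K, hK, hKb⟩ := exists_norm_opT_le p hβ hβ'
  have hκ : 0 < √((1 - 2 * β) / 2) := Real.sqrt_pos.2 (by linarith)
  have hκ' : √((1 - 2 * β) / 2) ≤ √(1 - 2 * β) := Real.sqrt_le_sqrt (by linarith)
  have hsq : ∀ μ, 0 < μ → μ < √((1 - 2 * β) / 2) → μ ^ 2 ≤ (1 - 2 * β) / 2 := fun μ h1 h2 =>
    ((Real.lt_sqrt h1.le).1 h2).le
  have hεK : ∀ ε, 0 < ε → ε < 1 / (2 * K) → ε * K ≤ 1 / 2 := fun ε _ h => by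
    rw [lt_div_iff₀ (by positivity)] at h
    linarith
  have hunit : ∀ ε μ : ℝ, 0 < ε → ε < 1 / (2 * K) → 0 < μ → μ < √((1 - 2 * β) / 2) →
      IsUnit (1 - (ε : ℂ) • opT p β μ) := fun ε μ h1 h2 h3 h4 =>
    isUnit_one_sub_smul (hKb μ h3 (hsq μ h3 h4)) h1.le (by linarith [hεK ε h1 h2])
  -- The thresholds may depend on `f` and `β`, hence on which case occurs; if both values vanish
  -- only invertibility is claimed.
  by_cases hf : p.coeffHat 1 (√(1 - 2 * β)) ≠ 0 ∨ p.coeffHat 1 (-√(1 - 2 * β)) ≠ 0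
  swap
  · exact ⟨1 / (2 * K), by positivity, _, hκ, hκ', fun ε μ h1 h2 h3 h4 =>
      ⟨hunit ε μ h1 h2 h3 h4, fun h => absurd h hf⟩⟩
  obtain ⟨c, hc, μ₁, hμ₁, hcb⟩ := exists_le_im_avg_opT_gTwo hβ hf
  have hR := p.R_pos
  set B : ℝ := 2 * p.R * (K * (K * (2 * ‖gTwo p‖))) with hB
  have hB0 : 0 ≤ B := by positivity
  refine ⟨min (1 / (2 * K)) (c / (B + 1)), lt_min (by positivity) (by positivity),
    min (√((1 - 2 * β) / 2)) μ₁, lt_min hκ hμ₁, (min_le_left _ _).trans hκ',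
    fun ε μ h1 h2 h3 h4 => ?_⟩
  have h2' := h2.trans_le (min_le_left _ _)
  have h4' := h4.trans_le (min_le_left _ _)
  refine ⟨hunit ε μ h1 h2' h3 h4', fun _ hd => ?_⟩
  have hμ2 := hsq μ h3 h4'
  have e1 := hcb μ h3 (h4.trans_le (min_le_right _ _)) (h4'.trans_le hκ')
  have e2 := norm_quantF_sub_le (hKb μ h3 hμ2) h1.le (hεK ε h1 h2')
  have e3 : (avg (gTwo p (-1))).im = 0 := im_avg_coeffC_zero p
  have e4 := (Complex.abs_im_le_norm _).trans e2
  rw [Complex.sub_im, Complex.add_im, e3, Complex.im_ofReal_mul, zero_add] at e4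
  have e5 := (abs_le.1 e4).1
  have e6 : ε * (B + 1) < c := by
    have := h2.trans_le (min_le_right _ _)
    rwa [lt_div_iff₀ (by positivity)] at this
  have e7 : 0 < (quantF p β ε μ).im := by
    have e8 : ε ^ 2 * B < ε * c := by nlinarith
    have e9 : ε * c ≤ ε * (avg (opT p β μ (gTwo p) (-1))).im := mul_le_mul_of_nonneg_left e1 h1.le
    linarith
  have hg : 0 < gam β μ := lt_of_lt_of_le (by positivity) (le_gam (by linarith))
  have e10 := congrArg Complex.im hd
  have e11 : (ε * gam β μ * quantF p β ε μ : ℂ) = ((ε * gam β μ : ℝ) : ℂ) * quantF p β ε μ := by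
    push_cast
    rfl
  rw [disp, e11, Complex.sub_im, Complex.im_ofReal_mul, Complex.ofReal_im, Complex.zero_im] at e10
  have : 0 < ε * gam β μ * (quantF p β ε μ).im := by positivity
  linarith

end

/-! ### Weak solutions: moving all derivatives to the test function. -/

lemma tendsto_integral_mul_of_eLpNorm {α : Type*} [MeasurableSpace α] {m : Measure α}
    {g : ℕ → α → ℂ} {g₀ h : α → ℂ} (hg : ∀ k, MemLp (g k) 2 m) (hg₀ : MemLp g₀ 2 m)
    (hh : MemLp h 2 m) (ht : Tendsto (fun k => eLpNorm (g k - g₀) 2 m) atTop (𝓝 0)) :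
    Tendsto (fun k => ∫ x, g k x * h x ∂m) atTop (𝓝 (∫ x, g₀ x * h x ∂m)) := by
  refine tendsto_integral_of_L1' _ (hg₀.1.mul hh.1)
    (Eventually.of_forall fun k => (hg k).integrable_mul hh) ?_
  have h1 : Tendsto (fun k => eLpNorm (g k - g₀) 2 m * eLpNorm h 2 m) atTop (𝓝 0) := by
    have := ENNReal.Tendsto.mul_const ht (Or.inr hh.2.ne : (0 : ℝ≥0∞) ≠ 0 ∨ eLpNorm h 2 m ≠ ⊤)
    rwa [zero_mul] at this
  refine tendsto_of_tendsto_of_tendsto_of_le_of_le tendsto_const_nhds h1 (fun _ => zero_le)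
    fun k => ?_
  have h2 := eLpNorm_smul_le_mul_eLpNorm (p := 2) (q := 2) (r := 1) hh.1 ((hg k).1.sub hg₀.1)
  refine le_trans (le_of_eq ?_) h2
  congr 1
  funext x
  simp [sub_mul]

lemma integral_add_add_add {α : Type*} [MeasurableSpace α] {m : Measure α} {a b c d : α → ℂ}
    (ha : Integrable a m) (hb : Integrable b m) (hc : Integrable c m) (hd : Integrable d m) :
    ∫ x, (a x + b x + (c x + d x)) ∂m =
      (∫ x, a x ∂m) + (∫ x, b x ∂m) + ((∫ x, c x ∂m) + ∫ x, d x ∂m) := by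
  have h1 : Integrable (fun x => a x + b x) m := ha.add hb
  have h2 : Integrable (fun x => c x + d x) m := hc.add hd
  rw [integral_add h1 h2, integral_add ha hb, integral_add hc hd]

section

variable {p : Perturbation} {β ε μ : ℝ} {r t : ℂ} {u v vx vy φ : ℝ × ℝ → ℂ}

lemma IsTest.contDiff_one (hφ : IsTest β φ) : ContDiff ℝ 1 φ := hφ.1.of_le (by exact_mod_cast le_top)

lemma IsTest.contDiff_one_dX (hφ : IsTest β φ) : ContDiff ℝ 1 (dX φ) :=
  contDiff_dX (contDiff_infty.1 hφ.1 2) (by norm_num)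

lemma IsTest.contDiff_one_dY (hφ : IsTest β φ) : ContDiff ℝ 1 (dY φ) :=
  contDiff_dY (contDiff_infty.1 hφ.1 2) (by norm_num)

/-- Integration by parts in `x` for `H₁` functions, against a test function. -/
lemma IsH1.integral_dX (h : IsH1 β v vx vy) (hφ : IsTest β φ) :
    ∫ q, vx q * conj (dX φ q) ∂stripMeasure = -∫ q, v q * conj (dX (dX φ) q) ∂stripMeasure := by
  obtain ⟨hv, hvx, hvy, g, hg, h0, hX, hY⟩ := h
  obtain ⟨M, hM⟩ := hφ.2.2
  have hψ := contDiff_conj hφ.contDiff_one_dX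
  have hψ0 : ∀ x y, M < |x| → conj (dX φ (x, y)) = 0 := fun x y hx => by
    rw [dX_vanish hM x y hx, map_zero]
  have c2 : Continuous fun q => conj (dX (dX φ) q) :=
    (contDiff_conj (contDiff_dX (m := 0) hφ.contDiff_one_dX (by simp))).continuous
  have m1 := (strip_of_vanish hψ.continuous hψ0).1
  have m2 := (strip_of_vanish c2 (M := M) fun x y hx => by
    rw [dX_vanish (dX_vanish hM) x y hx, map_zero]).1
  have mg : ∀ k, MemLp (g k) 2 stripMeasure ∧ MemLp (dX (g k)) 2 stripMeasure := fun k => by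
    obtain ⟨M', hM'⟩ := (hg k).2.2
    exact ⟨(strip_of_vanish (hg k).1.continuous hM').1,
      (strip_of_vanish (hg k).contDiff_one_dX.continuous (dX_vanish hM')).1⟩
  -- The identity holds for the approximating test functions `g k`, and both sides converge because
  -- the other factor is square integrable.
  have l1 := tendsto_integral_mul_of_eLpNorm (fun k => (mg k).2) hvx m1 hX
  have l2 := (tendsto_integral_mul_of_eLpNorm (fun k => (mg k).1) hv m2 h0).neg
  refine tendsto_nhds_unique l1 (l2.congr fun k => ?_)
  have e := integral_mul_dX (hg k).contDiff_one hψ hψ0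
  simp_rw [dX_conj (hφ.contDiff_one_dX.differentiable (by simp))] at e
  exact e.symm

/-- Integration by parts in `y` for `H₁` functions, against a test function. -/
lemma IsH1.integral_dY (h : IsH1 β v vx vy) (hφ : IsTest β φ) :
    ∫ q, vy q * conj (dY φ q) ∂stripMeasure = -∫ q, v q * conj (dY (dY φ) q) ∂stripMeasure := by
  obtain ⟨hv, hvx, hvy, g, hg, h0, hX, hY⟩ := h
  obtain ⟨M, hM⟩ := hφ.2.2
  have hψ := contDiff_conj hφ.contDiff_one_dY
  have hψ0 : ∀ x y, M < |x| → conj (dY φ (x, y)) = 0 := fun x y hx => by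
    rw [dY_vanish hM x y hx, map_zero]
  have c2 : Continuous fun q => conj (dY (dY φ) q) :=
    (contDiff_conj (contDiff_dY (m := 0) hφ.contDiff_one_dY (by simp))).continuous
  have m1 := (strip_of_vanish hψ.continuous hψ0).1
  have m2 := (strip_of_vanish c2 (M := M) fun x y hx => by
    rw [dY_vanish (dY_vanish hM) x y hx, map_zero]).1
  have mg : ∀ k, MemLp (g k) 2 stripMeasure ∧ MemLp (dY (g k)) 2 stripMeasure := fun k => by
    obtain ⟨M', hM'⟩ := (hg k).2.2
    exact ⟨(strip_of_vanish (hg k).1.continuous hM').1,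
      (strip_of_vanish (hg k).contDiff_one_dY.continuous (dY_vanish hM')).1⟩
  have l1 := tendsto_integral_mul_of_eLpNorm (fun k => (mg k).2) hvy m1 hY
  have l2 := (tendsto_integral_mul_of_eLpNorm (fun k => (mg k).1) hv m2 h0).neg
  refine tendsto_nhds_unique l1 (l2.congr fun k => ?_)
  have e := integral_mul_dY (hg k).contDiff_one hψ hψ0 fun x => by
    rw [((hg k).2.1 x).1, (hφ.2.1 x).2, conj_phase_mul]
  simp_rw [dY_conj (hφ.contDiff_one_dY.differentiable (by simp))] at e
  exact e.symm

lemma leading_two_pi (x : ℝ) : leading β μ r t (x, 2 * π) =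
    Complex.exp (2 * π * Complex.I * β) * leading β μ r t (x, 0) := by
  rw [leading_eq, leading_eq]
  push_cast
  rw [mul_zero, Complex.exp_zero, mul_one, mul_comm]
  congr 2
  ring

lemma IsScatteringSolution.integrable_mul (h : IsScatteringSolution p β ε μ u r t)
    {b : ℝ × ℝ → ℂ} (hb : Continuous b) {M : ℝ} (h0 : ∀ x y, M < |x| → b (x, y) = 0) :
    Integrable (fun q => u q * b q) stripMeasure := by
  obtain ⟨vx, vy, ⟨hv, -⟩, -⟩ := h
  have i1 := hv.integrable_mul (strip_of_vanish hb h0).1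
  have i2 := (strip_of_vanish (g := fun q => leading β μ r t q * b q) (M := M)
    ((contDiff_leading β μ r t).continuous.mul hb) fun x y hx => by rw [h0 x y hx, mul_zero]).2
  refine (i1.add i2).congr (Eventually.of_forall fun q => ?_)
  simp only [Pi.add_apply, Pi.mul_apply, Pi.sub_apply]
  ring

/-- The equation with all derivatives on the test function. -/
lemma IsScatteringSolution.integral_eq_zero (h : IsScatteringSolution p β ε μ u r t)
    (hφ : IsTest β φ) :
    ∫ q, u q * conj (dX (dX φ) q + dY (dY φ) q + omegaSq β μ * (1 + ε * p.f q) * φ q)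
      ∂stripMeasure = 0 := by
  have hu := h
  obtain ⟨vx, vy, hH, hw⟩ := h
  have hw := hw φ hφ
  have eX := hH.integral_dX hφ
  have eY := hH.integral_dY hφ
  obtain ⟨M, hM⟩ := hφ.2.2
  set ℓ := leading β μ r t with hℓ
  have cℓ : ContDiff ℝ 1 ℓ := (contDiff_leading β μ r t).of_le (by exact_mod_cast le_top)
  have cX := contDiff_conj hφ.contDiff_one_dX
  have cY := contDiff_conj hφ.contDiff_one_dY
  have vX : ∀ x y, M < |x| → conj (dX φ (x, y)) = 0 := fun x y hx => by
    rw [dX_vanish hM x y hx, map_zero]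
  have vY : ∀ x y, M < |x| → conj (dY φ (x, y)) = 0 := fun x y hx => by
    rw [dY_vanish hM x y hx, map_zero]
  have fX := integral_mul_dX cℓ cX vX
  have fY := integral_mul_dY cℓ cY vY fun x => by
    rw [hℓ, leading_two_pi, (hφ.2.1 x).2, conj_phase_mul]
  simp_rw [dX_conj (hφ.contDiff_one_dX.differentiable (by simp))] at fX
  simp_rw [dY_conj (hφ.contDiff_one_dY.differentiable (by simp))] at fY
  have cXX : Continuous fun q => conj (dX (dX φ) q) :=
    (contDiff_conj (contDiff_dX (m := 0) hφ.contDiff_one_dX (by simp))).continuous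
  have cYY : Continuous fun q => conj (dY (dY φ) q) :=
    (contDiff_conj (contDiff_dY (m := 0) hφ.contDiff_one_dY (by simp))).continuous
  have vXX : ∀ x y, M < |x| → conj (dX (dX φ) (x, y)) = 0 := fun x y hx => by
    rw [dX_vanish (dX_vanish hM) x y hx, map_zero]
  have vYY : ∀ x y, M < |x| → conj (dY (dY φ) (x, y)) = 0 := fun x y hx => by
    rw [dY_vanish (dY_vanish hM) x y hx, map_zero]
  have hp := p.smooth.continuous
  have cφ : Continuous fun q => conj (φ q) := (contDiff_conj hφ.1).continuous
  have cF : Continuous fun q => (1 + ε * p.f q : ℂ) * conj (φ q) := by fun_prop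
  have vF : ∀ x y, M < |x| → (1 + ε * p.f (x, y) : ℂ) * conj (φ (x, y)) = 0 := fun x y hx => by
    rw [hM x y hx, map_zero, mul_zero]
  have iL : ∀ {a b : ℝ × ℝ → ℂ}, Continuous a → Continuous b →
      (∀ x y, M < |x| → b (x, y) = 0) → Integrable (fun q => a q * b q) stripMeasure :=
    fun ha hb h0 => (strip_of_vanish (ha.mul hb) (M := M) fun x y hx => by
      rw [Pi.mul_apply, h0 x y hx, mul_zero]).2
  have iV : ∀ {a b : ℝ × ℝ → ℂ}, MemLp a 2 stripMeasure → Continuous b →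
      (∀ x y, M < |x| → b (x, y) = 0) → Integrable (fun q => a q * b q) stripMeasure :=
    fun ha hb h0 => ha.integrable_mul (strip_of_vanish hb h0).1
  obtain ⟨hv, hvx, hvy, -⟩ := hH
  have cdX : Continuous (dX ℓ) := (contDiff_dX (m := 0) cℓ (by simp)).continuous
  have cdY : Continuous (dY ℓ) := (contDiff_dY (m := 0) cℓ (by simp)).continuous
  have split1 : ∫ q, ((vx q + dX ℓ q) * conj (dX φ q) + (vy q + dY ℓ q) * conj (dY φ q))
      ∂stripMeasure = -∫ q, u q * (conj (dX (dX φ) q) + conj (dY (dY φ) q)) ∂stripMeasure := by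
    have e1 : ∀ q, (vx q + dX ℓ q) * conj (dX φ q) + (vy q + dY ℓ q) * conj (dY φ q) =
        (vx q * conj (dX φ q) + dX ℓ q * conj (dX φ q)) +
          (vy q * conj (dY φ q) + dY ℓ q * conj (dY φ q)) := fun q => by ring
    have e2 : ∀ q, u q * (conj (dX (dX φ) q) + conj (dY (dY φ) q)) =
        ((u - ℓ) q * conj (dX (dX φ) q) + ℓ q * conj (dX (dX φ) q)) +
          ((u - ℓ) q * conj (dY (dY φ) q) + ℓ q * conj (dY (dY φ) q)) := fun q => by
      simp only [Pi.sub_apply]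
      ring
    simp_rw [e1, e2]
    rw [integral_add_add_add (iV hvx cX.continuous vX) (iL cdX cX.continuous vX)
        (iV hvy cY.continuous vY) (iL cdY cY.continuous vY),
      integral_add_add_add (iV hv cXX vXX) (iL cℓ.continuous cXX vXX) (iV hv cYY vYY)
        (iL cℓ.continuous cYY vYY), eX, eY, fX, fY]
    ring
  have iu : ∀ {b : ℝ × ℝ → ℂ}, Continuous b → (∀ x y, M < |x| → b (x, y) = 0) →
      Integrable (fun q => u q * b q) stripMeasure := fun hb h0 => hu.integrable_mul hb h0
  have e3 : ∀ q, u q * conj (dX (dX φ) q + dY (dY φ) q + omegaSq β μ * (1 + ε * p.f q) * φ q) =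
      u q * (conj (dX (dX φ) q) + conj (dY (dY φ) q)) +
        omegaSq β μ * (u q * ((1 + ε * p.f q : ℂ) * conj (φ q))) := fun q => by
    simp only [map_add, map_mul, Complex.conj_ofReal, map_one]
    ring
  simp_rw [e3]
  rw [integral_add (iu (b := fun q => conj (dX (dX φ) q) + conj (dY (dY φ) q)) (cXX.add cYY)
    fun x y hx => by rw [vXX x y hx, vYY x y hx, add_zero]) ((iu cF vF).const_mul _),
    integral_const_mul]
  have e4 : ∫ q, (1 + ε * p.f q : ℂ) * u q * conj (φ q) ∂stripMeasure =
      ∫ q, u q * ((1 + ε * p.f q : ℂ) * conj (φ q)) ∂stripMeasure := by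
    congr 1
    funext q
    ring
  rw [split1, e4] at hw
  linear_combination -hw

end

/-! ### The difference of two solutions and separated test functions. -/

/-- The difference `W` of two solutions of the scattering problem: a solution of the homogeneous
problem which is the sum of a square integrable function and of `ℓ(x) e^{iβy}`, where `ℓ` is
outgoing for large `|x|`. -/
structure IsDifference (p : Perturbation) (β ε μ : ℝ) (W : ℝ × ℝ → ℂ) (ℓ : ℝ → ℂ) (a b : ℂ) :
    Prop where
  memLp : MemLp (fun q : ℝ × ℝ => W q - ℓ q.1 * Complex.exp (Complex.I * β * q.2)) 2 stripMeasure
  contDiff : ContDiff ℝ ∞ ℓ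
  right : ∀ x : ℝ, 1 ≤ x → ℓ x = a * Complex.exp (Complex.I * kZero β μ * x)
  left : ∀ x : ℝ, x ≤ -1 → ℓ x = b * Complex.exp (-(Complex.I * kZero β μ * x))
  weak : ∀ φ, IsTest β φ →
    ∫ q, W q * conj (dX (dX φ) q + dY (dY φ) q + omegaSq β μ * (1 + ε * p.f q) * φ q)
      ∂stripMeasure = 0

section

variable {p : Perturbation} {β ε μ : ℝ} {r t r' t' a b : ℂ} {u u' W : ℝ × ℝ → ℂ} {ℓ : ℝ → ℂ}
  {n : ℤ} {M : ℝ} {c : ℝ → ℂ}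

/-- The incident wave is common to both leading parts and drops out for `x ≤ -1`, so what remains is
outgoing on both sides. -/
lemma IsScatteringSolution.sub (h : IsScatteringSolution p β ε μ u r t)
    (h' : IsScatteringSolution p β ε μ u' r' t') :
    IsDifference p β ε μ (u - u') (leadingMode β μ r t - leadingMode β μ r' t')
      (t - t') (r - r') where
  memLp := by
    have e : (fun q : ℝ × ℝ => (u - u') q - (leadingMode β μ r t - leadingMode β μ r' t') q.1 *
        Complex.exp (Complex.I * β * q.2)) =
        (u - leading β μ r t) - (u' - leading β μ r' t') := by
      funext q
      simp only [Pi.sub_apply, leading_eq]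
      ring
    obtain ⟨vx, vy, ⟨hv, -⟩, -⟩ := h
    obtain ⟨vx', vy', ⟨hv', -⟩, -⟩ := h'
    rw [e]
    exact hv.sub hv'
  contDiff := (contDiff_leadingMode β μ r t).sub (contDiff_leadingMode β μ r' t')
  right x hx := by
    rw [Pi.sub_apply, leadingMode_of_one_le _ _ _ _ hx, leadingMode_of_one_le _ _ _ _ hx]
    ring
  left x hx := by
    rw [Pi.sub_apply, leadingMode_of_le_neg_one _ _ _ _ hx, leadingMode_of_le_neg_one _ _ _ _ hx]
    ring
  weak φ hφ := by
    obtain ⟨M, hM⟩ := hφ.2.2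
    have hp := p.smooth.continuous
    have c0 := hφ.1.continuous
    have c1 : Continuous (dX (dX φ)) := (contDiff_dX (m := 0) hφ.contDiff_one_dX (by simp)).continuous
    have c2 : Continuous (dY (dY φ)) := (contDiff_dY (m := 0) hφ.contDiff_one_dY (by simp)).continuous
    have hb : Continuous fun q =>
        conj (dX (dX φ) q + dY (dY φ) q + omegaSq β μ * (1 + ε * p.f q) * φ q) :=
      Complex.continuous_conj.comp (by fun_prop)
    have hb0 : ∀ x y, M < |x| → conj (dX (dX φ) (x, y) + dY (dY φ) (x, y) +
        omegaSq β μ * (1 + ε * p.f (x, y)) * φ (x, y)) = 0 := fun x y hx => by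
      rw [dX_vanish (dX_vanish hM) x y hx, dY_vanish (dY_vanish hM) x y hx, hM x y hx]
      simp
    simp_rw [Pi.sub_apply, sub_mul]
    rw [integral_sub (h.integrable_mul hb hb0) (h'.integrable_mul hb hb0), h.integral_eq_zero hφ,
      h'.integral_eq_zero hφ, sub_zero]

lemma IsDifference.integrable_mul (h : IsDifference p β ε μ W ℓ a b)
    {g : ℝ × ℝ → ℂ} (hg : Continuous g) (h0 : ∀ x y, M < |x| → g (x, y) = 0) :
    Integrable (fun q => W q * g q) stripMeasure := by
  have i1 := h.memLp.integrable_mul (strip_of_vanish hg h0).1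
  have hc := h.contDiff.continuous
  have i2 := (strip_of_vanish (g := fun q => ℓ q.1 * Complex.exp (Complex.I * β * q.2) * g q)
    (M := M) (by fun_prop) fun x y hx => by rw [h0 x y hx, mul_zero]).2
  refine (i1.add i2).congr (Eventually.of_forall fun q => ?_)
  simp only [Pi.add_apply, Pi.mul_apply]
  ring

lemma dX_mul_separated (c e : ℝ → ℂ) :
    dX (fun q : ℝ × ℝ => c q.1 * e q.2) = fun q => deriv c q.1 * e q.2 :=
  funext fun q => deriv_mul_const_field (u := c) (x := q.1) (e q.2)

lemma dY_mul_separated (c e : ℝ → ℂ) :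
    dY (fun q : ℝ × ℝ => c q.1 * e q.2) = fun q => c q.1 * deriv e q.2 :=
  funext fun q => deriv_const_mul_field (v := e) (x := q.2) (c q.1)

/-- `e^{-i(β + n)y}`, the conjugate of the `n`-th transversal mode. -/
def modeConj (β : ℝ) (n : ℤ) (y : ℝ) : ℂ := Complex.exp (-(Complex.I * (β + n) * y))

lemma norm_modeConj (β : ℝ) (n : ℤ) (y : ℝ) : ‖modeConj β n y‖ = 1 := by
  rw [modeConj, Complex.norm_exp]
  simp

lemma contDiff_modeConj (β : ℝ) (n : ℤ) : ContDiff ℝ ∞ (modeConj β n) := by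
  have := contDiff_cexp_mul (-(Complex.I * (β + n)))
  simp only [neg_mul] at this
  exact this

lemma deriv_modeConj (β : ℝ) (n : ℤ) :
    deriv (modeConj β n) = fun y => -(Complex.I * (β + n)) * modeConj β n y :=
  funext fun y => by
    rw [modeConj, neg_mul]
    exact (hasDerivAt_cexp_neg_mul (Complex.I * (β + n)) y).deriv

lemma deriv_deriv_modeConj (β : ℝ) (n : ℤ) (y : ℝ) :
    deriv (deriv (modeConj β n)) y = -((β : ℂ) + n) ^ 2 * modeConj β n y := by
  rw [deriv_modeConj, deriv_const_mul_field, deriv_modeConj]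
  linear_combination ((β : ℂ) + n) ^ 2 * modeConj β n y * Complex.I_sq

lemma conj_modeConj_add_two_pi (β : ℝ) (n : ℤ) (y : ℝ) : conj (modeConj β n (y + 2 * π)) =
    Complex.exp (2 * π * Complex.I * β) * conj (modeConj β n y) := by
  have e : ∀ y, conj (modeConj β n y) = Complex.exp (Complex.I * (β + n) * y) := fun y => by
    rw [modeConj, ← Complex.exp_conj]
    simp
  have e1 : Complex.I * (β + n) * (y + 2 * π : ℝ) =
      2 * π * Complex.I * β + Complex.I * (β + n) * y + n * (2 * π * Complex.I) := by
    push_cast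
    ring
  rw [e, e, e1, Complex.exp_add, Complex.exp_int_mul_two_pi_mul_I, mul_one, Complex.exp_add]

lemma isTest_conj_mul_modeConj (hc : ContDiff ℝ ∞ c) (h0 : ∀ x, M < |x| → c x = 0) :
    IsTest β fun q => conj (c q.1 * modeConj β n q.2) := by
  refine ⟨contDiff_conj ((hc.comp contDiff_fst).mul ((contDiff_modeConj β n).comp contDiff_snd)),
    quasiBC_of_forall fun x y => ?_, M, fun x y hx => ?_⟩
  · simp only [map_mul, conj_modeConj_add_two_pi]
    ring
  · simp only [h0 x hx, zero_mul, map_zero]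

/-- A product of a profile in `x` and a transversal mode reduces the weak equation to an ordinary
differential operator in `x`, apart from the term with `f`. -/
lemma IsDifference.integral_mode (h : IsDifference p β ε μ W ℓ a b) (hc : ContDiff ℝ ∞ c)
    (h0 : ∀ x, M < |x| → c x = 0) (n : ℤ) :
    ∫ q, W q * ((deriv (deriv c) q.1 - ((β : ℂ) + n) ^ 2 * c q.1 +
      omegaSq β μ * (1 + ε * p.f q) * c q.1) * modeConj β n q.2) ∂stripMeasure = 0 := by
  rw [← h.weak _ (isTest_conj_mul_modeConj (n := n) hc h0)]
  congr 1
  funext q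
  congr 1
  set Φ : ℝ × ℝ → ℂ := fun q => c q.1 * modeConj β n q.2 with hΦ
  have hΦd : ContDiff ℝ ∞ Φ :=
    (hc.comp contDiff_fst).mul ((contDiff_modeConj β n).comp contDiff_snd)
  have dΦ := hΦd.differentiable (by simp)
  have dXΦ : Differentiable ℝ (dX Φ) :=
    (contDiff_dX (m := 1) (contDiff_infty.1 hΦd 2) (by norm_num)).differentiable (by simp)
  have dYΦ : Differentiable ℝ (dY Φ) :=
    (contDiff_dY (m := 1) (contDiff_infty.1 hΦd 2) (by norm_num)).differentiable (by simp)
  have e1 : dX (fun q => conj (Φ q)) = fun q => conj (dX Φ q) := funext (dX_conj dΦ)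
  have e2 : dY (fun q => conj (Φ q)) = fun q => conj (dY Φ q) := funext (dY_conj dΦ)
  rw [e1, e2, dX_conj dXΦ, dY_conj dYΦ]
  simp only [map_add, map_mul, Complex.conj_conj, Complex.conj_ofReal, map_one]
  rw [hΦ, dX_mul_separated, dX_mul_separated, dY_mul_separated, dY_mul_separated]
  simp only
  rw [deriv_deriv_modeConj]
  ring

end

/-! ### Truncated Green functions as test functions. -/

section

variable {k : ℂ} {ζ : ℝ → ℂ} {ρ : ℝ}

/-- The first-order system `g' = h`, `h' = k² g - ζ` for `gconv` and `gconvDeriv` lets both gain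
regularity together by induction. -/
lemma contDiff_gconv (hk : k ≠ 0) (hζ : ContDiff ℝ ∞ ζ) (h0 : ∀ x, ρ < |x| → ζ x = 0) :
    ContDiff ℝ ∞ (gconv k ζ) ∧ ContDiff ℝ ∞ (gconvDeriv k ζ) := by
  have d1 := hasDerivAt_gconv hk hζ.continuous h0
  have d2 := hasDerivAt_gconvDeriv (k := k) hζ.continuous h0
  have e1 : deriv (gconv k ζ) = gconvDeriv k ζ := funext fun x => (d1 x).deriv
  have e2 : deriv (gconvDeriv k ζ) = fun x => k ^ 2 * gconv k ζ x - ζ x :=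
    funext fun x => (d2 x).deriv
  have key : ∀ m : ℕ, ContDiff ℝ m (gconv k ζ) ∧ ContDiff ℝ m (gconvDeriv k ζ) := by
    intro m
    induction m with
    | zero =>
      exact ⟨contDiff_zero.2 (continuous_gconv hk hζ.continuous h0),
        contDiff_zero.2 (continuous_gconvDeriv hζ.continuous h0)⟩
    | succ m ih =>
      push_cast
      refine ⟨contDiff_succ_iff_deriv.2 ⟨fun x => (d1 x).differentiableAt, by simp, ?_⟩,
        contDiff_succ_iff_deriv.2 ⟨fun x => (d2 x).differentiableAt, by simp, ?_⟩⟩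
      · rw [e1]
        exact ih.2
      · rw [e2]
        exact (contDiff_const.mul ih.1).sub (contDiff_infty.1 hζ m)
  exact ⟨contDiff_infty.2 fun m => (key m).1, contDiff_infty.2 fun m => (key m).2⟩

lemma deriv_deriv_mul {f g : ℝ → ℂ} (hf : ContDiff ℝ ∞ f) (hg : ContDiff ℝ ∞ g) (x : ℝ) :
    deriv (deriv fun x => f x * g x) x =
      deriv (deriv f) x * g x + 2 * (deriv f x * deriv g x) + f x * deriv (deriv g) x := by
  have hf1 := hf.differentiable (by simp)
  have hg1 := hg.differentiable (by simp)
  have hf2 := (contDiff_infty_iff_deriv.1 hf).2.differentiable (by simp)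
  have hg2 := (contDiff_infty_iff_deriv.1 hg).2.differentiable (by simp)
  have e : deriv (fun x => f x * g x) = fun x => deriv f x * g x + f x * deriv g x :=
    funext fun x => ((hf1 x).hasDerivAt.mul (hg1 x).hasDerivAt).deriv
  rw [e]
  refine (((hf2 x).hasDerivAt.mul (hg1 x).hasDerivAt).add
    ((hf1 x).hasDerivAt.mul (hg2 x).hasDerivAt)).deriv.trans ?_
  ring

/-- The commutator of `d²/dx²` and the cut-off, applied to `gconv k ζ`. -/
def cutoffError (k : ℂ) (ζ : ℝ → ℂ) (N x : ℝ) : ℂ :=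
  deriv (deriv (cutoff N)) x * gconv k ζ x + 2 * (deriv (cutoff N) x * gconvDeriv k ζ x)

lemma continuous_cutoffError (hk : k ≠ 0) (hζ : ContDiff ℝ ∞ ζ) (h0 : ∀ x, ρ < |x| → ζ x = 0)
    (N : ℝ) : Continuous (cutoffError k ζ N) := by
  have h1 := (contDiff_infty_iff_deriv.1 (contDiff_cutoff N)).2
  have h2 := (contDiff_infty_iff_deriv.1 h1).2.continuous
  have h3 := h1.continuous
  have h4 := (contDiff_gconv hk hζ h0).1.continuous
  have h5 := (contDiff_gconv hk hζ h0).2.continuous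
  unfold cutoffError
  fun_prop

lemma deriv_eq_zero_of_vanish {f : ℝ → ℂ} {M : ℝ} (h : ∀ x, M < |x| → f x = 0) (x : ℝ)
    (hx : M < |x|) : deriv f x = 0 := by
  have h1 : f =ᶠ[𝓝 x] fun _ => 0 := by
    filter_upwards [(isOpen_lt continuous_const continuous_abs).mem_nhds hx] with s hs
    exact h s hs
  rw [h1.deriv_eq, deriv_const]

lemma cutoffError_eq_zero {N : ℝ} (hN : 0 < N) (x : ℝ) (hx : 2 * N < |x|) :
    cutoffError k ζ N x = 0 := by
  have h0 : ∀ x, 2 * N < |x| → cutoff N x = 0 := fun x hx => cutoff_eq_zero hN hx.le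
  rw [cutoffError, deriv_eq_zero_of_vanish (deriv_eq_zero_of_vanish h0) x hx,
    deriv_eq_zero_of_vanish h0 x hx]
  ring

end

section

variable {p : Perturbation} {β ε μ : ℝ} {a b k : ℂ} {W : ℝ × ℝ → ℂ} {ℓ ζ : ℝ → ℂ} {n : ℤ} {ρ N : ℝ}

/-- The test profile is `χ_N (G_n * ζ)`, since `G_n * ζ` itself need not have compact support. Where
`ζ` or `f` is nonzero `χ_N = 1`, so the operator produces `-ζ`, the term with `f`, and a commutator
supported where `χ_N` varies. -/
lemma IsDifference.integral_cutoffError (h : IsDifference p β ε μ W ℓ a b) (hk : k ≠ 0)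
    (hk2 : k ^ 2 = ((β : ℂ) + n) ^ 2 - omegaSq β μ) (hζ : ContDiff ℝ ∞ ζ)
    (h0 : ∀ x, ρ < |x| → ζ x = 0) (hN : 0 < N) (hρN : ρ ≤ N) (hRN : p.R ≤ N) :
    ∫ q, W q * (cutoffError k ζ N q.1 * modeConj β n q.2) ∂stripMeasure =
      (∫ q, W q * (ζ q.1 * modeConj β n q.2) ∂stripMeasure) -
        omegaSq β μ * ε *
          ∫ q, W q * (p.f q * gconv k ζ q.1 * modeConj β n q.2) ∂stripMeasure := by
  obtain ⟨c1, c2⟩ := contDiff_gconv hk hζ h0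
  have e1 : deriv (gconv k ζ) = gconvDeriv k ζ :=
    funext fun x => (hasDerivAt_gconv hk hζ.continuous h0 x).deriv
  have e2 : deriv (gconvDeriv k ζ) = fun x => k ^ 2 * gconv k ζ x - ζ x :=
    funext fun x => (hasDerivAt_gconvDeriv hζ.continuous h0 x).deriv
  have hc := (contDiff_cutoff N).mul c1
  have hc0 : ∀ x, 2 * N < |x| → cutoff N x * gconv k ζ x = 0 := fun x hx => by
    rw [cutoff_eq_zero hN hx.le, zero_mul]
  have key := h.integral_mode hc hc0 n
  have hm := (contDiff_modeConj β n).continuous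
  have hp := p.smooth.continuous
  have cg := c1.continuous
  have cζ := hζ.continuous
  have cE := continuous_cutoffError hk hζ h0 N
  have i1 := h.integrable_mul (M := 2 * N)
    (g := fun q => cutoffError k ζ N q.1 * modeConj β n q.2) (by fun_prop)
    fun x y hx => by simp only [cutoffError_eq_zero hN x hx, zero_mul]
  have i2 := h.integrable_mul (M := ρ)
    (g := fun q => ζ q.1 * modeConj β n q.2) (by fun_prop)
    fun x y hx => by simp only [h0 x hx, zero_mul]
  have i3 := h.integrable_mul (M := p.R)
    (g := fun q => p.f q * gconv k ζ q.1 * modeConj β n q.2) (by fun_prop)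
    fun x y hx => by simp only [p.vanish x y hx, Complex.ofReal_zero, zero_mul]
  have e : ∀ q : ℝ × ℝ, W q * ((deriv (deriv fun x => cutoff N x * gconv k ζ x) q.1 -
      ((β : ℂ) + n) ^ 2 * (cutoff N q.1 * gconv k ζ q.1) +
      omegaSq β μ * (1 + ε * p.f q) * (cutoff N q.1 * gconv k ζ q.1)) * modeConj β n q.2) =
      W q * (cutoffError k ζ N q.1 * modeConj β n q.2) -
        W q * (ζ q.1 * modeConj β n q.2) + omegaSq β μ * ε *
          (W q * (p.f q * gconv k ζ q.1 * modeConj β n q.2)) := by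
    intro q
    have hζ' : cutoff N q.1 * ζ q.1 = ζ q.1 := by
      by_cases hx : |q.1| ≤ N
      · rw [cutoff_eq_one hN hx, one_mul]
      · rw [h0 q.1 (hρN.trans_lt (not_le.1 hx)), mul_zero]
    have hf' : cutoff N q.1 * p.f q = p.f q := by
      by_cases hx : |q.1| ≤ N
      · rw [cutoff_eq_one hN hx, one_mul]
      · rw [show p.f q = 0 from p.vanish q.1 q.2 (hRN.trans_lt (not_le.1 hx)), Complex.ofReal_zero,
          mul_zero]
    rw [deriv_deriv_mul (contDiff_cutoff N) c1, e1, e2, cutoffError, hk2]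
    linear_combination (-W q * modeConj β n q.2) * hζ' +
      (W q * modeConj β n q.2 * omegaSq β μ * ε * gconv k ζ q.1) * hf'
  simp_rw [e] at key
  have i4 : Integrable (fun q => W q * (cutoffError k ζ N q.1 * modeConj β n q.2) -
        W q * (ζ q.1 * modeConj β n q.2)) stripMeasure := i1.sub i2
  rw [integral_add i4 (i3.const_mul _), integral_sub i1 i2, integral_const_mul] at key
  linear_combination key

end

section

variable {k : ℂ} {ζ : ℝ → ℂ} {ρ : ℝ}

lemma exists_gconv_bound (hk : 0 ≤ k.re) (hζ : Continuous ζ) (h0 : ∀ x, ρ < |x| → ζ x = 0) :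
    ∃ B, 0 ≤ B ∧ ∀ x, ‖gconv k ζ x‖ ≤ B ∧ ‖gconvDeriv k ζ x‖ ≤ B := by
  have hi : Integrable ζ := hζ.integrable_of_hasCompactSupport (hasCompactSupport_of_vanish h0)
  set I := ∫ ξ, ‖ζ ξ‖ with hI
  have hI0 : 0 ≤ I := integral_nonneg fun _ => norm_nonneg _
  have hle : ∀ x, ∫ ξ, Real.exp (-(k.re * |x - ξ|)) * ‖ζ ξ‖ ≤ I := fun x => by
    refine integral_mono_of_nonneg (Eventually.of_forall fun _ => by positivity) hi.norm
      (Eventually.of_forall fun ξ => mul_le_of_le_one_left (norm_nonneg _) ?_)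
    exact Real.exp_le_one_iff.2 (neg_nonpos.2 (by positivity))
  refine ⟨1 / (2 * ‖k‖) * I + 1 / 2 * I, by positivity, fun x => ⟨?_, ?_⟩⟩
  · have := (norm_gconv_le hζ h0 x).trans (mul_le_mul_of_nonneg_left (hle x)
      (by positivity : 0 ≤ 1 / (2 * ‖k‖)))
    linarith
  · have := (norm_gconvDeriv_le (k := k) hζ h0 x).trans (mul_le_mul_of_nonneg_left (hle x)
      (by norm_num : (0 : ℝ) ≤ 1 / 2))
    have h2 : 0 ≤ 1 / (2 * ‖k‖) * I := by positivity
    linarith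

/-- The commutator has size `1/N` and lives on `|x| ≤ 2N`, where `√(1+x²) ≤ 3N`. The second bound is
therefore independent of `N`, and square integrable on the strip: a majorant against any `L²`
function. -/
lemma exists_cutoffError_bound (hk : 0 ≤ k.re) (hζ : Continuous ζ)
    (h0 : ∀ x, ρ < |x| → ζ x = 0) : ∃ B, 0 ≤ B ∧ ∀ N, 1 ≤ N → ∀ x,
      ‖cutoffError k ζ N x‖ ≤ B / N ∧ ‖cutoffError k ζ N x‖ ≤ 3 * B * (√(1 + x ^ 2))⁻¹ := by
  obtain ⟨B, hB0, hB⟩ := exists_gconv_bound hk hζ h0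
  obtain ⟨D, hD0, hD⟩ := exists_deriv_cutoff_bound
  refine ⟨3 * B * D, by positivity, fun N hN x => ?_⟩
  have h1 : ‖cutoffError k ζ N x‖ ≤ 3 * B * D / N := by
    rw [cutoffError]
    refine (norm_add_le _ _).trans ?_
    rw [norm_mul, norm_mul, norm_mul, Complex.norm_ofNat]
    have e1 := mul_le_mul (hD N hN x).2 (hB x).1 (norm_nonneg _) (by positivity)
    have e2 := mul_le_mul (hD N hN x).1 (hB x).2 (norm_nonneg _) (by positivity)
    have e3 : 3 * B * D / N = D / N * B + 2 * (D / N * B) := by ring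
    rw [e3]
    linarith
  refine ⟨h1, ?_⟩
  by_cases hx : 2 * N < |x|
  · rw [cutoffError_eq_zero (by linarith) x hx, norm_zero]
    positivity
  · refine h1.trans ?_
    rw [div_eq_mul_inv, mul_comm 3 (3 * B * D), mul_assoc (3 * B * D)]
    refine mul_le_mul_of_nonneg_left ?_ (by positivity)
    have h2 : √(1 + x ^ 2) ≤ 3 * N := by
      rw [Real.sqrt_le_left (by positivity)]
      have : x ^ 2 ≤ (2 * N) ^ 2 := by
        rw [← sq_abs x]
        exact pow_le_pow_left₀ (abs_nonneg x) (not_lt.1 hx) 2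
      nlinarith
    rw [← div_eq_mul_inv, inv_eq_one_div, div_le_div_iff₀ (by positivity) (by positivity)]
    linarith

end

lemma memLp_inv_sqrt_one_add_sq :
    MemLp (fun q : ℝ × ℝ => (√(1 + q.1 ^ 2))⁻¹) 2 stripMeasure := by
  rw [stripMeasure_eq]
  refine MemLp.comp_fst (f := fun x : ℝ => (√(1 + x ^ 2))⁻¹) ?_ _
  have hc : Continuous fun x : ℝ => (√(1 + x ^ 2))⁻¹ :=
    Continuous.inv₀ (by fun_prop) fun x => by positivity
  rw [memLp_two_iff_integrable_sq hc.aestronglyMeasurable]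
  refine integrable_inv_one_add_sq.congr (Eventually.of_forall fun x => ?_)
  simp only
  rw [inv_pow, Real.sq_sqrt (by positivity)]

lemma tendsto_integral_mul_cutoffError {k : ℂ} {ζ : ℝ → ℂ} {ρ : ℝ} {v : ℝ × ℝ → ℂ}
    (hv : MemLp v 2 stripMeasure) (hk0 : k ≠ 0) (hk : 0 ≤ k.re) (hζ : ContDiff ℝ ∞ ζ)
    (h0 : ∀ x, ρ < |x| → ζ x = 0) (β : ℝ) (n : ℤ) :
    Tendsto (fun j : ℕ => ∫ q, v q * (cutoffError k ζ ((j : ℝ) + 1) q.1 * modeConj β n q.2)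
      ∂stripMeasure) atTop (𝓝 0) := by
  obtain ⟨B, hB0, hB⟩ := exists_cutoffError_bound hk hζ.continuous h0
  have hm := (contDiff_modeConj β n).continuous
  have hN : ∀ j : ℕ, (1 : ℝ) ≤ (j : ℝ) + 1 := fun j => by simp
  have h1 := tendsto_integral_of_dominated_convergence (μ := stripMeasure)
    (F := fun (j : ℕ) q => v q * (cutoffError k ζ ((j : ℝ) + 1) q.1 * modeConj β n q.2))
    (f := fun _ => 0) (fun q => ‖v q‖ * (3 * B * (√(1 + q.1 ^ 2))⁻¹))
    (fun j => hv.1.mul (by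
      have := continuous_cutoffError hk0 hζ h0 ((j : ℝ) + 1)
      exact Continuous.aestronglyMeasurable (by fun_prop)))
    (hv.norm.integrable_mul (memLp_inv_sqrt_one_add_sq.const_mul (3 * B)))
    (fun j => Eventually.of_forall fun q => by
      rw [norm_mul, norm_mul, norm_modeConj, mul_one]
      exact mul_le_mul_of_nonneg_left (hB _ (hN j) q.1).2 (norm_nonneg _))
    (Eventually.of_forall fun q => by
      have h2 : Tendsto (fun j : ℕ => ‖v q‖ * (B * (1 / ((j : ℝ) + 1)))) atTop (𝓝 0) := by
        simpa using (tendsto_one_div_add_atTop_nhds_zero_nat (𝕜 := ℝ)).const_mul B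
          |>.const_mul ‖v q‖
      refine squeeze_zero_norm (fun j => ?_) h2
      rw [norm_mul, norm_mul, norm_modeConj, mul_one, mul_one_div]
      exact mul_le_mul_of_nonneg_left (hB _ (hN j) q.1).1 (norm_nonneg _))
  simpa using h1

section

variable {p : Perturbation} {β ε μ : ℝ} {a b k : ℂ} {W : ℝ × ℝ → ℂ} {ℓ ζ : ℝ → ℂ} {n : ℤ} {ρ N : ℝ}

lemma IsDifference.deriv_of_lt (h : IsDifference p β ε μ W ℓ a b) {x : ℝ} (hx : 1 < x) :
    deriv ℓ x = Complex.I * kZero β μ * ℓ x := by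
  have e : ℓ =ᶠ[𝓝 x] fun x : ℝ => a * Complex.exp (Complex.I * kZero β μ * x) := by
    filter_upwards [lt_mem_nhds hx] with y hy
    exact h.right y hy.le
  rw [e.deriv_eq, h.right x hx.le, ((hasDerivAt_cexp_mul (Complex.I * kZero β μ) x).const_mul a).deriv]
  ring

lemma IsDifference.deriv_of_lt_neg (h : IsDifference p β ε μ W ℓ a b) {x : ℝ} (hx : x < -1) :
    deriv ℓ x = -(Complex.I * kZero β μ * ℓ x) := by
  have e : ℓ =ᶠ[𝓝 x] fun x : ℝ => b * Complex.exp (-(Complex.I * kZero β μ * x)) := by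
    filter_upwards [gt_mem_nhds hx] with y hy
    exact h.left y hy.le
  rw [e.deriv_eq, h.left x hx.le,
    ((hasDerivAt_cexp_neg_mul (Complex.I * kZero β μ) x).const_mul b).deriv]
  ring

lemma deriv_cutoff_eq_zero {x : ℝ} (hN : 0 < N) (hx : |x| < N) : deriv (cutoff N) x = 0 := by
  have h1 : cutoff N =ᶠ[𝓝 x] fun _ => 1 := by
    filter_upwards [(isOpen_lt continuous_abs continuous_const).mem_nhds hx] with s hs
    exact cutoff_eq_one hN (le_of_lt hs)
  rw [h1.deriv_eq, deriv_const]

/-- The product `ℓ · cutoffError` is the exact derivative of `χ_N' (G_0 * ζ) ℓ`, which has compact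
support, up to `χ_N'` times a Wronskian. -/
lemma IsDifference.integral_mul_cutoffError (h : IsDifference p β ε μ W ℓ a b)
    (hk : kZero β μ ≠ 0) (hζ : ContDiff ℝ ∞ ζ) (h0 : ∀ x, ρ < |x| → ζ x = 0) (hN : 1 < N)
    (hρN : ρ < N) : ∫ x, ℓ x * cutoffError (-(Complex.I * kZero β μ)) ζ N x = 0 := by
  set k : ℂ := -(Complex.I * kZero β μ) with hkdef
  have hk0 : k ≠ 0 := neg_ne_zero.2 (mul_ne_zero Complex.I_ne_zero (by exact_mod_cast hk))
  have hN0 : 0 < N := by linarith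
  have c1 := (contDiff_gconv hk0 hζ h0).1.continuous
  have hχ := (contDiff_infty_iff_deriv.1 (contDiff_cutoff N)).2
  have cχ := hχ.continuous
  have cℓ := h.contDiff.continuous
  have cE := continuous_cutoffError hk0 hζ h0 N
  have v1 : ∀ x, 2 * N < |x| → deriv (cutoff N) x = 0 :=
    deriv_eq_zero_of_vanish fun x hx => cutoff_eq_zero hN0 hx.le
  refine integral_eq_zero_of_hasDerivAt_of_integrable
    (f := fun x => deriv (cutoff N) x * gconv k ζ x * ℓ x) (fun x => ?_) ?_ ?_
  · have d1 := (hχ.differentiable (by simp) x).hasDerivAt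
    have d2 := hasDerivAt_gconv hk0 hζ.continuous h0 x
    have d3 := (h.contDiff.differentiable (by simp) x).hasDerivAt
    refine ((d1.mul d2).mul d3).congr_deriv ?_
    -- `χ_N' = 0` for `|x| < N`. For `|x| ≥ N`, beyond the support of `ζ` and beyond `1`, both
    -- functions are multiples of the same outgoing exponential, so their Wronskian is zero.
    have key : deriv (cutoff N) x * (gconv k ζ x * deriv ℓ x - gconvDeriv k ζ x * ℓ x) = 0 := by
      rcases lt_or_ge |x| N with hx | hx
      · rw [deriv_cutoff_eq_zero hN0 hx, zero_mul]
      · rcases le_total 0 x with hs | hs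
        · rw [abs_of_nonneg hs] at hx
          rw [gconvDeriv_of_right hk0 hζ.continuous h0 (by linarith), h.deriv_of_lt (by linarith),
            hkdef]
          ring
        · rw [abs_of_nonpos hs] at hx
          rw [gconvDeriv_of_left hk0 hζ.continuous h0 (by linarith),
            h.deriv_of_lt_neg (by linarith), hkdef]
          ring
    rw [cutoffError, Pi.mul_apply]
    linear_combination key
  · exact Continuous.integrable_of_hasCompactSupport (by fun_prop)
      (hasCompactSupport_of_vanish (R := 2 * N) fun x hx => by
        rw [cutoffError_eq_zero hN0 x hx, mul_zero])
  · exact Continuous.integrable_of_hasCompactSupport (by fun_prop)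
      (hasCompactSupport_of_vanish (R := 2 * N) fun x hx => by
        rw [v1 x hx, zero_mul, zero_mul])

lemma integral_exp_neg_int (hn : n ≠ 0) :
    ∫ y in Ioo 0 (2 * π), Complex.exp (-(Complex.I * n * y)) = 0 := by
  rw [← integral_Ioc_eq_integral_Ioo, ← intervalIntegral.integral_of_le (by positivity)]
  have h := coeff_by_parts (g := fun _ => 1) (g' := fun _ => 0) (fun y => hasDerivAt_const y (1 : ℂ))
    continuous_const rfl hn
  simpa using h

/-- The `L²` part of `W` is handled by dominated convergence. The outgoing part `ℓ(x) e^{iβy}`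
contributes exactly zero for large `N`: for `n ≠ 0` through the integral in `y`, for `n = 0` through
the vanishing Wronskian. -/
lemma IsDifference.tendsto_cutoffError (h : IsDifference p β ε μ W ℓ a b) (hβ : 0 < β)
    (hβ' : β < 1 / 2) (hμ : 0 < μ) (hμ' : μ < √(1 - 2 * β)) (hζ : ContDiff ℝ ∞ ζ)
    (h0 : ∀ x, ρ < |x| → ζ x = 0) (n : ℤ) :
    Tendsto (fun j : ℕ => ∫ q, W q *
      (cutoffError (waveNumber β μ n) ζ ((j : ℝ) + 1) q.1 * modeConj β n q.2) ∂stripMeasure)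
      atTop (𝓝 0) := by
  have hk0 := waveNumber_ne_zero hβ hβ' hμ hμ' n
  refine (tendsto_integral_mul_cutoffError h.memLp hk0 (re_waveNumber_nonneg hμ n) hζ h0 β n).congr'
    ?_
  filter_upwards [eventually_gt_atTop 0,
    (tendsto_natCast_atTop_atTop (R := ℝ)).eventually_gt_atTop ρ] with j hj hρ
  have hN : (1 : ℝ) < (j : ℝ) + 1 := by
    have : (0 : ℝ) < j := by exact_mod_cast hj
    linarith
  set N : ℝ := (j : ℝ) + 1
  set k := waveNumber β μ n
  have hm := (contDiff_modeConj β n).continuous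
  have cE := continuous_cutoffError hk0 hζ h0 N
  have cℓ := h.contDiff.continuous
  have i1 := h.integrable_mul (M := 2 * N)
    (g := fun q => cutoffError k ζ N q.1 * modeConj β n q.2) (by fun_prop)
    fun x y hx => by simp only [cutoffError_eq_zero (by linarith : 0 < N) x hx, zero_mul]
  have i2 := (strip_of_vanish (M := 2 * N) (g := fun q => ℓ q.1 * Complex.exp (Complex.I * β * q.2) *
    (cutoffError k ζ N q.1 * modeConj β n q.2)) (by fun_prop)
    fun x y hx => by simp only [cutoffError_eq_zero (by linarith : 0 < N) x hx, zero_mul, mul_zero]).2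
  simp_rw [sub_mul]
  rw [integral_sub i1 i2, sub_eq_self]
  have e : ∀ q : ℝ × ℝ, ℓ q.1 * Complex.exp (Complex.I * β * q.2) *
      (cutoffError k ζ N q.1 * modeConj β n q.2) =
      (ℓ q.1 * cutoffError k ζ N q.1) * Complex.exp (-(Complex.I * n * q.2)) := by
    intro q
    have : Complex.exp (-(Complex.I * n * q.2)) =
        Complex.exp (Complex.I * β * q.2) * modeConj β n q.2 := by
      rw [modeConj, ← Complex.exp_add]
      congr 1
      ring
    rw [this]
    ring
  simp_rw [e]
  rw [stripMeasure_eq, integral_prod_mul (fun x => ℓ x * cutoffError k ζ N x)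
    fun y : ℝ => Complex.exp (-(Complex.I * n * y))]
  by_cases hn : n = 0
  · have hk : k = -(Complex.I * kZero β μ) := by
      rw [← waveNumber_zero, ← hn]
    rw [hk, h.integral_mul_cutoffError (kZero_pos hμ hμ').ne' hζ h0 hN (by linarith), zero_mul]
  · rw [integral_exp_neg_int hn, mul_zero]

/-- The `n`-th mode of a solution of the homogeneous problem, tested against `ζ`. -/
lemma IsDifference.integral_eq (h : IsDifference p β ε μ W ℓ a b) (hβ : 0 < β)
    (hβ' : β < 1 / 2) (hμ : 0 < μ) (hμ' : μ < √(1 - 2 * β)) (hζ : ContDiff ℝ ∞ ζ)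
    (h0 : ∀ x, ρ < |x| → ζ x = 0) (n : ℤ) :
    ∫ q, W q * (ζ q.1 * modeConj β n q.2) ∂stripMeasure = omegaSq β μ * ε *
      ∫ q, W q * (p.f q * gconv (waveNumber β μ n) ζ q.1 * modeConj β n q.2) ∂stripMeasure := by
  have h1 := h.tendsto_cutoffError hβ hβ' hμ hμ' hζ h0 n
  refine sub_eq_zero.1 (tendsto_nhds_unique (tendsto_const_nhds.congr' ?_) h1)
  filter_upwards [(tendsto_natCast_atTop_atTop (R := ℝ)).eventually_gt_atTop ρ,
    (tendsto_natCast_atTop_atTop (R := ℝ)).eventually_gt_atTop p.R] with j hj hj'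
  exact (h.integral_cutoffError (waveNumber_ne_zero hβ hβ' hμ hμ' n)
    (waveNumber_sq hβ hβ' hμ hμ' n) hζ h0 (by positivity) (by linarith) (by linarith)).symm

end

/-! ### Modes of the difference as radiated fields. -/

instance instSFiniteStripMeasure : SFinite stripMeasure := by
  rw [stripMeasure_eq]
  infer_instance

/-- The `n`-th transversal mode `∫₀^{2π} W(x, y) e^{-i(β + n)y} dy`. -/
def waveMode (β : ℝ) (n : ℤ) (W : ℝ × ℝ → ℂ) (x : ℝ) : ℂ :=
  ∫ y in Ioo 0 (2 * π), W (x, y) * modeConj β n y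

/-- The `n`-th mode of `f W`. -/
def sourceMode (p : Perturbation) (β : ℝ) (n : ℤ) (W : ℝ × ℝ → ℂ) (x : ℝ) : ℂ :=
  ∫ y in Ioo 0 (2 * π), W (x, y) * (p.f (x, y) * modeConj β n y)

/-- The field of mode `n` radiated by the source `ω² ε f W`. -/
def radiated (p : Perturbation) (β ε μ : ℝ) (n : ℤ) (W : ℝ × ℝ → ℂ) (x : ℝ) : ℂ :=
  omegaSq β μ * ε * ∫ q, expGreen (waveNumber β μ n) (x - q.1) *
    (W q * (p.f q * modeConj β n q.2)) ∂stripMeasure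

lemma norm_expGreen_le {k : ℂ} (hk : 0 ≤ k.re) (x : ℝ) : ‖expGreen k x‖ ≤ 1 / (2 * ‖k‖) := by
  rw [expGreen, norm_mul, Complex.norm_exp]
  have h1 : ‖(1 : ℂ) / (2 * k)‖ = 1 / (2 * ‖k‖) := by simp
  rw [h1]
  refine mul_le_of_le_one_right (by positivity) (Real.exp_le_one_iff.2 ?_)
  rw [Complex.neg_re, Complex.re_mul_ofReal]
  exact neg_nonpos.2 (by positivity)

/-- Fubini and evenness of the Green function move the convolution from the test function `ζ` to the
source. -/
lemma integral_mul_gconv {m : Measure (ℝ × ℝ)} [SFinite m] {S : ℝ × ℝ → ℂ} (hS : Integrable S m)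
    {k : ℂ} (hk : 0 ≤ k.re) {ζ : ℝ → ℂ} (hζ : Integrable ζ) :
    ∫ q, S q * gconv k ζ q.1 ∂m = ∫ ξ, ζ ξ * ∫ q, expGreen k (ξ - q.1) * S q ∂m := by
  have hi : Integrable (fun z : (ℝ × ℝ) × ℝ => expGreen k (z.2 - z.1.1) * (S z.1 * ζ z.2))
      (m.prod volume) := by
    refine (hS.mul_prod hζ).bdd_mul (c := 1 / (2 * ‖k‖)) ?_
      (Eventually.of_forall fun z => norm_expGreen_le hk _)
    exact ((continuous_expGreen k).comp (by fun_prop)).aestronglyMeasurable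
  calc _ = ∫ q, (∫ ξ : ℝ, expGreen k (ξ - q.1) * (S q * ζ ξ)) ∂m := by
        congr 1
        funext q
        rw [gconv, ← integral_const_mul]
        congr 1
        funext ξ
        have : expGreen k (q.1 - ξ) = expGreen k (ξ - q.1) := by
          rw [expGreen, expGreen, abs_sub_comm]
        rw [this]
        ring
    _ = _ := by
        rw [integral_integral_swap hi]
        congr 1
        funext ξ
        rw [← integral_const_mul]
        congr 1
        funext q
        ring

section

variable {p : Perturbation} {β ε μ : ℝ} {a b k : ℂ} {W : ℝ × ℝ → ℂ} {ℓ : ℝ → ℂ}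

lemma IsDifference.integrable_source (h : IsDifference p β ε μ W ℓ a b) (n : ℤ) :
    Integrable (fun q => W q * (p.f q * modeConj β n q.2)) stripMeasure := by
  have hm := (contDiff_modeConj β n).continuous
  have hp := p.smooth.continuous
  exact h.integrable_mul (M := p.R) (by fun_prop) fun x y hx => by
    simp only [p.vanish x y hx, Complex.ofReal_zero, zero_mul]

lemma IsDifference.continuous_radiated (h : IsDifference p β ε μ W ℓ a b) (hμ : 0 < μ) (n : ℤ) :
    Continuous (radiated p β ε μ n W) := by
  have hi := h.integrable_source n
  refine continuous_const.mul (continuous_of_dominated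
    (bound := fun q => 1 / (2 * ‖waveNumber β μ n‖) * ‖W q * (p.f q * modeConj β n q.2)‖)
    (fun x => ?_) (fun x => Eventually.of_forall fun q => ?_) (hi.norm.const_mul _)
    (Eventually.of_forall fun q => ?_))
  · exact (((continuous_expGreen (waveNumber β μ n)).comp
      (continuous_const.sub continuous_fst)).aestronglyMeasurable).mul hi.1
  · rw [norm_mul]
    exact mul_le_mul_of_nonneg_right (norm_expGreen_le (re_waveNumber_nonneg hμ n) _) (norm_nonneg _)
  · exact ((continuous_expGreen _).comp (continuous_id.sub continuous_const)).mul continuous_const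

/-- The transversal modes have modulus one, so the source integral has a bound independent of `n`.
The resulting decay like `1/|n|` is enough for square summability. -/
lemma IsDifference.exists_norm_radiated_le (h : IsDifference p β ε μ W ℓ a b) (hμ : 0 < μ) :
    ∃ B, 0 ≤ B ∧ ∀ (n : ℤ) x, ‖radiated p β ε μ n W x‖ ≤ B / ‖waveNumber β μ n‖ := by
  have e : ∀ n : ℤ, ∫ q, ‖W q * (p.f q * modeConj β n q.2)‖ ∂stripMeasure =
      ∫ q, ‖W q‖ * |p.f q| ∂stripMeasure := fun n => by
    congr 1
    funext q
    rw [norm_mul, norm_mul, norm_modeConj, mul_one, Complex.norm_real, Real.norm_eq_abs]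
  refine ⟨‖(omegaSq β μ * ε : ℂ)‖ * (1 / 2 * ∫ q, ‖W q‖ * |p.f q| ∂stripMeasure), ?_,
    fun n x => ?_⟩
  · have : 0 ≤ ∫ q, ‖W q‖ * |p.f q| ∂stripMeasure := integral_nonneg fun q => by positivity
    positivity
  · have h1 : ‖∫ q, expGreen (waveNumber β μ n) (x - q.1) *
        (W q * (p.f q * modeConj β n q.2)) ∂stripMeasure‖ ≤
        ∫ q, 1 / (2 * ‖waveNumber β μ n‖) * ‖W q * (p.f q * modeConj β n q.2)‖ ∂stripMeasure := by
      refine norm_integral_le_of_norm_le ((h.integrable_source n).norm.const_mul _)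
        (Eventually.of_forall fun q => ?_)
      rw [norm_mul]
      exact mul_le_mul_of_nonneg_right (norm_expGreen_le (re_waveNumber_nonneg hμ n) _)
        (norm_nonneg _)
    rw [integral_const_mul, e] at h1
    rw [radiated, norm_mul, mul_div_assoc]
    refine mul_le_mul_of_nonneg_left (h1.trans_eq ?_) (norm_nonneg _)
    rw [one_div, mul_inv]
    ring

lemma IsDifference.integrable_waveMode (h : IsDifference p β ε μ W ℓ a b) (n : ℤ)
    {g : ℝ → ℂ} (hg : Continuous g) {M : ℝ} (h0 : ∀ x, M < |x| → g x = 0) :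
    Integrable (fun x => g x * waveMode β n W x) ∧
      ∫ q, W q * (g q.1 * modeConj β n q.2) ∂stripMeasure = ∫ x, g x * waveMode β n W x := by
  have hm := (contDiff_modeConj β n).continuous
  have hi := h.integrable_mul (M := M) (g := fun q => g q.1 * modeConj β n q.2) (by fun_prop)
    fun x y hx => by simp only [h0 x hx, zero_mul]
  have e : ∀ x, ∫ y in Ioo 0 (2 * π), W (x, y) * (g x * modeConj β n y) =
      g x * waveMode β n W x := fun x => by
    rw [waveMode, ← integral_const_mul]
    congr 1
    funext y
    ring
  rw [stripMeasure_eq] at hi ⊢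
  refine ⟨hi.integral_prod_left.congr (Eventually.of_forall e), ?_⟩
  rw [integral_prod _ hi]
  exact integral_congr_ae (Eventually.of_forall e)

lemma IsDifference.locallyIntegrable_waveMode (h : IsDifference p β ε μ W ℓ a b) (n : ℤ) :
    LocallyIntegrable (waveMode β n W) := by
  intro x
  refine ⟨Metric.ball x 1, Metric.ball_mem_nhds x one_pos, ?_⟩
  have hN : 0 < |x| + 1 := by positivity
  have hi := (h.integrable_waveMode n (contDiff_cutoff (|x| + 1)).continuous
    (M := 2 * (|x| + 1)) fun y hy => cutoff_eq_zero hN hy.le).1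
  refine hi.integrableOn.congr_fun (s := Metric.ball x 1) (fun y hy => ?_) measurableSet_ball
  rw [Metric.mem_ball, Real.dist_eq] at hy
  have : |y| ≤ |x| + 1 := by
    have := abs_sub_abs_le_abs_sub y x
    linarith
  simp only [cutoff_eq_one hN this, one_mul]

/-- The modes of a solution of the homogeneous problem are the radiated fields. -/
lemma IsDifference.waveMode_ae_eq (h : IsDifference p β ε μ W ℓ a b) (hβ : 0 < β)
    (hβ' : β < 1 / 2) (hμ : 0 < μ) (hμ' : μ < √(1 - 2 * β)) (n : ℤ) :
    ∀ᵐ x, waveMode β n W x = radiated p β ε μ n W x := by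
  have hr := h.continuous_radiated hμ n
  -- Fundamental lemma of the calculus of variations: it suffices to test the difference against
  -- smooth functions of compact support.
  have key := ae_eq_zero_of_integral_contDiff_smul_eq_zero
    ((h.locallyIntegrable_waveMode n).sub hr.locallyIntegrable) fun g hg hgs => ?_
  · filter_upwards [key] with x hx
    exact sub_eq_zero.1 hx
  obtain ⟨ρ, hρ⟩ := hgs.isCompact.isBounded.subset_closedBall 0
  set ζ : ℝ → ℂ := fun x => (g x : ℂ) with hζ
  have cζ : ContDiff ℝ ∞ ζ := Complex.ofRealCLM.contDiff.comp hg
  have h0 : ∀ x, ρ < |x| → ζ x = 0 := fun x hx => by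
    have : g x = 0 := by
      by_contra hne
      have h1 := hρ (subset_tsupport g hne)
      rw [mem_closedBall_zero_iff, Real.norm_eq_abs] at h1
      linarith
    simp [hζ, this]
  have iζ : Integrable ζ := cζ.continuous.integrable_of_hasCompactSupport
    (hasCompactSupport_of_vanish h0)
  obtain ⟨i1, e1⟩ := h.integrable_waveMode n cζ.continuous h0
  have e2 := h.integral_eq hβ hβ' hμ hμ' cζ h0 n
  have e3 := integral_mul_gconv (h.integrable_source n) (re_waveNumber_nonneg hμ n (β := β)) iζ
  have e4 : ∀ q, W q * (p.f q * gconv (waveNumber β μ n) ζ q.1 * modeConj β n q.2) =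
      W q * (p.f q * modeConj β n q.2) * gconv (waveNumber β μ n) ζ q.1 := fun q => by ring
  simp_rw [e4] at e2
  rw [e1, e3, ← integral_const_mul] at e2
  have i2 : Integrable fun x => ζ x * radiated p β ε μ n W x :=
    (cζ.continuous.mul hr).integrable_of_hasCompactSupport
      ((hasCompactSupport_of_vanish h0).mul_right)
  have e5 : ∀ x, g x • (waveMode β n W - radiated p β ε μ n W) x =
      ζ x * waveMode β n W x - ζ x * radiated p β ε μ n W x := fun x => by
    rw [Complex.real_smul, Pi.sub_apply, mul_sub]
  simp_rw [e5]
  rw [integral_sub i1 i2, e2, sub_eq_zero]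
  congr 1
  funext x
  rw [radiated]
  ring

lemma IsDifference.radiated_eq (h : IsDifference p β ε μ W ℓ a b) (hμ : 0 < μ) (n : ℤ) (x : ℝ) :
    radiated p β ε μ n W x = omegaSq β μ * ε *
      ∫ ξ, expGreen (waveNumber β μ n) (x - ξ) * sourceMode p β n W ξ := by
  have hi : Integrable (fun q => expGreen (waveNumber β μ n) (x - q.1) *
      (W q * (p.f q * modeConj β n q.2))) stripMeasure :=
    (h.integrable_source n).bdd_mul
      ((continuous_expGreen _).comp (by fun_prop)).aestronglyMeasurable
      (Eventually.of_forall fun q => norm_expGreen_le (re_waveNumber_nonneg hμ n) _)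
  rw [radiated]
  rw [stripMeasure_eq] at hi ⊢
  rw [integral_prod _ hi]
  congr 2
  funext ξ
  rw [sourceMode, ← integral_const_mul]

lemma IsDifference.ae_memLp (h : IsDifference p β ε μ W ℓ a b) :
    ∀ᵐ x, MemLp (fun y => W (x, y)) 2 (volume.restrict (Ioo 0 (2 * π))) := by
  have hv := h.memLp
  rw [stripMeasure_eq] at hv
  have h1 := hv.1.prodMk_left
  have h2 := ((memLp_two_iff_integrable_sq_norm hv.1).1 hv).prod_right_ae
  filter_upwards [h1, h2] with x hx1 hx2
  have h3 := (memLp_two_iff_integrable_sq_norm hx1).2 hx2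
  have h4 : MemLp (fun y : ℝ => ℓ x * Complex.exp (Complex.I * β * y)) 2
      (volume.restrict (Ioo 0 (2 * π))) := by
    refine MemLp.of_bound (Continuous.aestronglyMeasurable (by fun_prop)) ‖ℓ x‖
      (Eventually.of_forall fun y => ?_)
    rw [norm_mul, Complex.norm_exp]
    simp
  refine (h3.add h4).ae_eq (Eventually.of_forall fun y => ?_)
  simp

/-- Insert the Fourier series of `f` under the integral; multiplication by `e^{ijy}` turns mode `n`
into mode `n - j`, and absolute summability of the `f_j` permits the exchange. -/
lemma hasSum_sourceMode {x : ℝ} (hW : Integrable (fun y => W (x, y)) (volume.restrict (Ioo 0 (2 * π))))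
    (n : ℤ) : HasSum (fun j => p.coeff j x * waveMode β (n - j) W x)
      (2 * π * sourceMode p β n W x) := by
  have hi : ∀ m : ℤ, Integrable (fun y => W (x, y) * modeConj β m y)
      (volume.restrict (Ioo 0 (2 * π))) := fun m => by
    have h1 := hW.bdd_mul (contDiff_modeConj β m).continuous.aestronglyMeasurable (c := 1)
      (Eventually.of_forall fun y => (norm_modeConj β m y).le)
    simpa only [mul_comm] using h1
  have h1 := hasSum_integral_of_summable_integral_norm (μ := volume.restrict (Ioo 0 (2 * π)))
    (F := fun (j : ℤ) y => p.coeff j x * (W (x, y) * modeConj β (n - j) y))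
    (fun j => (hi (n - j)).const_mul _) ?_
  · simp_rw [integral_const_mul] at h1
    have e0 : 2 * π * sourceMode p β n W x = ∫ y in Ioo 0 (2 * π),
        ∑' j : ℤ, p.coeff j x * (W (x, y) * modeConj β (n - j) y) := by
      rw [sourceMode, ← integral_const_mul]
      congr 1
      funext y
      have h2 := (hasSum_fourier_f p x y).mul_right (W (x, y) * modeConj β n y)
      have e : ∀ j : ℤ, p.coeff j x * Complex.exp (Complex.I * j * y) * (W (x, y) * modeConj β n y) =
          p.coeff j x * (W (x, y) * modeConj β (n - j) y) := fun j => by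
        have : modeConj β (n - j) y = Complex.exp (Complex.I * j * y) * modeConj β n y := by
          rw [modeConj, modeConj, ← Complex.exp_add]
          congr 1
          push_cast
          ring
        rw [this]
        ring
      simp_rw [e] at h2
      rw [h2.tsum_eq]
      ring
    rw [e0]
    exact h1
  · have e : ∀ j : ℤ, ∫ y in Ioo 0 (2 * π), ‖p.coeff j x * (W (x, y) * modeConj β (n - j) y)‖ =
        ‖p.coeff j x‖ * ∫ y in Ioo 0 (2 * π), ‖W (x, y)‖ := fun j => by
      rw [← integral_const_mul]
      congr 1
      funext y
      rw [norm_mul, norm_mul, norm_modeConj, mul_one]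
    simp_rw [e]
    exact (summable_norm_coeff p x).mul_right _

end

/-! ### Uniqueness. -/

section

variable {p : Perturbation} {β ε μ : ℝ} {a b : ℂ} {W : ℝ × ℝ → ℂ} {ℓ : ℝ → ℂ}

lemma memℓp_two_of_le {B : ℤ → Comp p} {C : ℝ} (h : ∀ n, n ≠ 0 → ‖B n‖ ≤ C / |(n : ℝ)|) :
    Memℓp B 2 := by
  refine memℓp_gen ?_
  simp only [ENNReal.toReal_ofNat, Real.rpow_two]
  have h1 : Summable fun n : ℤ => C ^ 2 * (1 / (n : ℝ) ^ 2) :=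
    (Real.summable_one_div_int_pow.2 (by norm_num)).mul_left _
  refine Summable.of_norm_bounded_eventually h1 ?_
  rw [eventually_cofinite]
  refine (finite_singleton (0 : ℤ)).subset fun n hn => ?_
  by_contra h0
  refine hn ?_
  have h2 := pow_le_pow_left₀ (norm_nonneg _) (h n h0) 2
  rw [div_pow, sq_abs] at h2
  rw [Real.norm_of_nonneg (by positivity), mul_one_div]
  exact h2

/-- The source `2εγ f W` of a solution of the homogeneous problem as an element of `𝒜`. -/
lemma IsDifference.exists_source (h : IsDifference p β ε μ W ℓ a b) (hβ : 0 < β)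
    (hβ' : β < 1 / 2) (hμ : 0 < μ) (hμ' : μ < √(1 - 2 * β)) :
    ∃ A : Space p, (∀ n x, conv (green β μ n) (A n) x = radiated p β ε μ n W x) ∧
      ∀ m, HasSum (fun n => (2 * ε * gam β μ : ℂ) • (convG β μ n (A n) * coeffC p (m - n)))
        (A m) := by
  have hR := p.R_pos
  obtain ⟨C, hC0, hC⟩ := h.exists_norm_radiated_le hμ
  obtain ⟨c, hc, hck⟩ := exists_le_re_waveNumber hβ hβ' hμ
  -- The radiated field is the continuous representative of the `n`-th mode of `W`, which is itself
  -- determined only almost everywhere.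
  let B : ℤ → Comp p := fun n => ⟨fun x => radiated p β ε μ n W x,
    (h.continuous_radiated hμ n).comp continuous_subtype_val⟩
  have hB : Memℓp B 2 := memℓp_two_of_le (C := C / c) fun n hn => by
    have hn' : 0 < |(n : ℝ)| := abs_pos.2 (by exact_mod_cast hn)
    have h1 : c * |(n : ℝ)| ≤ ‖waveNumber β μ n‖ := by
      refine le_trans ?_ ((hck n hn).trans (Complex.re_le_norm _))
      nlinarith
    rw [ContinuousMap.norm_le _ (by positivity)]
    intro x
    refine (hC n x).trans ?_
    rw [div_div]
    exact div_le_div_of_nonneg_left hC0 (by positivity) h1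
  obtain ⟨L, -, hL⟩ := exists_mulOp p
  set A : Space p := (2 * ε * gam β μ : ℂ) • L ⟨B, hB⟩ with hA
  have hAn : ∀ n, A n = (2 * ε * gam β μ : ℂ) • L ⟨B, hB⟩ n := fun n => rfl
  -- There are countably many modes, so one null set of `x` serves for all `n`.
  have hall := ae_all_iff.2 fun n => h.waveMode_ae_eq hβ hβ' hμ hμ' n
  have hconv : ∀ n x, conv (green β μ n) (A n) x = radiated p β ε μ n W x := by
    intro n x
    rw [conv_green, gconv, h.radiated_eq hμ, ← integral_const_mul]
    refine integral_congr_ae ?_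
    filter_upwards [hall, h.ae_memLp] with ξ h1 h2
    by_cases hξ : ξ ∈ Icc (-p.R) p.R
    · rw [zeroExt_of_mem _ hξ]
      have e1 := (hL ⟨B, hB⟩ n).mapL (ContinuousMap.evalCLM ℂ (⟨ξ, hξ⟩ : Icc (-p.R) p.R))
      have e2 := (Equiv.subLeft n).hasSum_iff.2
        (hasSum_sourceMode (p := p) (β := β) (h2.integrable one_le_two) n)
      have e3 : L ⟨B, hB⟩ n ⟨ξ, hξ⟩ = 2 * π * sourceMode p β n W ξ := by
        refine e1.unique (e2.congr_fun fun j => ?_)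
        rw [Function.comp_apply, Equiv.subLeft_apply, sub_sub_cancel, h1 j]
        exact mul_comm _ _
      have e4 : A n ⟨ξ, hξ⟩ = 2 * ε * gam β μ * L ⟨B, hB⟩ n ⟨ξ, hξ⟩ := by
        rw [hAn]
        rfl
      have hπ : (π : ℂ) ≠ 0 := by exact_mod_cast Real.pi_ne_zero
      have e5 : (gam β μ : ℂ) * (4 * π) = omegaSq β μ := by
        rw [gam]
        push_cast
        field_simp
      rw [e4, e3]
      linear_combination (expGreen (waveNumber β μ n) (x - ξ) * ε * sourceMode p β n W ξ) * e5
    · have e1 : sourceMode p β n W ξ = 0 := by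
        have hx : p.R < |ξ| := by
          by_contra hlt
          exact hξ (abs_le.1 (not_lt.1 hlt))
        simp [sourceMode, p.vanish ξ _ hx]
      rw [zeroExt_of_notMem _ hξ, e1]
      ring
  refine ⟨A, hconv, fun m => ?_⟩
  have h1 := (hL ⟨B, hB⟩ m).const_smul (2 * ε * gam β μ : ℂ)
  rw [← hAn] at h1
  refine h1.congr_fun fun n => ?_
  have : convG β μ n (A n) = B n := by
    ext x
    exact hconv n x
  rw [this]

/-- The homogeneous equation makes `A` the multiple `εγ⟨A_{-1}⟩/μ` of the resolvent applied to
`g⁽²⁾`. Averaging mode `-1` gives `⟨A_{-1}⟩ (μ - εγF) = 0`, so the multiple is zero. -/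
lemma eq_zero_of_disp_ne_zero (hμ : 0 < μ) (hu : IsUnit (1 - (ε : ℂ) • opT p β μ))
    (hd : disp p β ε μ ≠ 0) {A : Space p}
    (hA : ∀ m, HasSum (fun n => (2 * ε * gam β μ : ℂ) • (convG β μ n (A n) * coeffC p (m - n)))
      (A m)) : A = 0 := by
  have hμ' : (μ : ℂ) ≠ 0 := by exact_mod_cast hμ.ne'
  have h1 := eq_resolvent_of_eq hu (eq_of_hasSum hA)
  rw [map_smul] at h1
  have h2 : A (-1) = (2 * ε * gam β μ * (avg (A (-1)) / (2 * μ)) : ℂ) •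
      resolvent p β ε μ (gTwo p) (-1) := congrArg (fun B : Space p => B (-1)) h1
  have h3 := congrArg avg h2
  conv_rhs at h3 => rw [avg_eq_pairing, map_smul, ← avg_eq_pairing, smul_eq_mul]
  change _ = _ * quantF p β ε μ at h3
  have h4 : avg (A (-1)) * disp p β ε μ = 0 := by
    rw [disp]
    field_simp at h3
    linear_combination h3
  rw [h1, (mul_eq_zero.1 h4).resolve_right hd, zero_div, mul_zero, zero_smul]

lemma ae_eq_zero_of_forall_mode {g : ℝ → ℂ} (hg : MemLp g 2 (volume.restrict (Ioo 0 (2 * π))))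
    (h : ∀ n : ℤ, ∫ y in Ioo 0 (2 * π), g y * modeConj β n y = 0) :
    ∀ᵐ y ∂(volume.restrict (Ioo 0 (2 * π))), g y = 0 := by
  have hπ : (0 : ℝ) < 2 * π := by positivity
  rw [restrict_Ioo_eq_restrict_Ioc] at hg ⊢
  -- The factor `e^{-iβy}` turns the quasiperiodic modes into ordinary Fourier coefficients, so that
  -- Parseval applies.
  set G : ℝ → ℂ := fun y => g y * modeConj β 0 y with hG
  have hGn : ∀ y, ‖G y‖ = ‖g y‖ := fun y => by rw [hG, norm_mul, norm_modeConj, mul_one]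
  have hGL : MemLp G 2 (volume.restrict (Ioc 0 (2 * π))) :=
    hg.of_le (hg.1.mul (contDiff_modeConj β 0).continuous.aestronglyMeasurable)
      (Eventually.of_forall fun y => (hGn y).le)
  have hcoef : ∀ n, fourierCoeffOn hπ G n = 0 := fun n => by
    rw [fourierCoeffOn_eq_integral, intervalIntegral.integral_of_le hπ.le,
      integral_Ioc_eq_integral_Ioo]
    have e : ∀ y : ℝ, fourier (-n) (y : AddCircle (2 * π - 0)) • G y = g y * modeConj β n y := by
      intro y
      have h2π : (2 * π : ℂ) ≠ 0 := by exact_mod_cast hπ.ne'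
      have hGy : G y = g y * modeConj β 0 y := rfl
      rw [fourier_coe_apply, smul_eq_mul, hGy, modeConj, modeConj, mul_left_comm, ← Complex.exp_add]
      congr 2
      push_cast
      rw [sub_zero]
      field_simp
      ring
    simp_rw [e]
    rw [h n, smul_zero]
  have hs := hasSum_sq_fourierCoeffOn hπ hGL
  simp only [hcoef, norm_zero, ne_eq, OfNat.ofNat_ne_zero, not_false_eq_true, zero_pow] at hs
  have h0 := hs.unique hasSum_zero
  rw [intervalIntegral.integral_of_le hπ.le, sub_zero, smul_eq_mul, mul_eq_zero] at h0
  have h1 := h0.resolve_left (by positivity)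
  rw [integral_eq_zero_iff_of_nonneg (fun y => by positivity)
    ((memLp_two_iff_integrable_sq_norm hGL.1).1 hGL)] at h1
  filter_upwards [h1] with y hy
  simp only [hGn, Pi.zero_apply] at hy
  simpa using hy

/-- The zero set of `g` need not be measurable, so Fubini for null sets is applied to a measurable
representative. -/
lemma ae_prod_eq_zero {α γ : Type*} [MeasurableSpace α] [MeasurableSpace γ] {m : Measure α}
    {ν : Measure γ} [SFinite m] [SFinite ν] {g : α × γ → ℂ}
    (hg : AEStronglyMeasurable g (m.prod ν)) (h : ∀ᵐ x ∂m, ∀ᵐ y ∂ν, g (x, y) = 0) :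
    ∀ᵐ q ∂(m.prod ν), g q = 0 := by
  have h1 := Measure.ae_ae_of_ae_prod hg.ae_eq_mk
  have hs : MeasurableSet {q | hg.mk g q ≠ 0} :=
    (hg.stronglyMeasurable_mk.measurable (measurableSet_singleton 0)).compl
  have h2 : ∀ᵐ q ∂(m.prod ν), hg.mk g q = 0 := by
    refine (Measure.measure_prod_null hs).2 ?_
    filter_upwards [h1, h] with x hx1 hx2
    have : ∀ᵐ y ∂ν, hg.mk g (x, y) = 0 := by
      filter_upwards [hx1, hx2] with y hy1 hy2
      rw [← hy1, hy2]
    exact this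
  filter_upwards [hg.ae_eq_mk, h2] with q hq1 hq2
  rw [hq1, hq2]

lemma stripMeasure_prod_univ {s : Set ℝ} (hs : volume s = ⊤) : stripMeasure (s ×ˢ univ) = ⊤ := by
  rw [stripMeasure_eq, Measure.prod_prod, hs, Measure.restrict_apply_univ, Real.volume_Ioo, sub_zero]
  exact ENNReal.top_mul (by simp [Real.pi_pos])

lemma eq_zero_of_memLp_of_norm_eq {g : ℝ × ℝ → ℂ} (hg : MemLp g 2 stripMeasure) {s : Set ℝ}
    (hs : MeasurableSet s) (hv : volume s = ⊤) {c : ℂ} (h : ∀ x ∈ s, ∀ y, ‖g (x, y)‖ = ‖c‖) :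
    c = 0 := by
  have h1 := hg.restrict (s ×ˢ univ)
  have h2 : MemLp (fun _ : ℝ × ℝ => c) 2 (stripMeasure.restrict (s ×ˢ univ)) := by
    refine h1.of_le aestronglyMeasurable_const ?_
    filter_upwards [ae_restrict_mem (hs.prod MeasurableSet.univ)] with q hq
    exact (h q.1 hq.1 q.2).ge
  rw [memLp_const_iff (by norm_num) (by norm_num), Measure.restrict_apply_univ,
    stripMeasure_prod_univ hv] at h2
  exact h2.resolve_right (lt_irrefl _)

/-- If `W = 0` then the outgoing part is itself square integrable, but its modulus is the constant
`|a|` for `x ≥ 1` and `|b|` for `x ≤ -1`, on sets of infinite measure. -/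
lemma IsDifference.coefficients_eq_zero (h : IsDifference p β ε μ W ℓ a b)
    (hW : ∀ᵐ q ∂stripMeasure, W q = 0) : a = 0 ∧ b = 0 := by
  have h1 : MemLp (fun q : ℝ × ℝ => -(ℓ q.1 * Complex.exp (Complex.I * β * q.2))) 2
      stripMeasure := by
    refine h.memLp.ae_eq ?_
    filter_upwards [hW] with q hq
    rw [hq, zero_sub]
  constructor
  · refine eq_zero_of_memLp_of_norm_eq h1 (s := Ici 1) measurableSet_Ici Real.volume_Ici
      fun x hx y => ?_
    rw [norm_neg, norm_mul, h.right x hx, norm_mul, Complex.norm_exp, Complex.norm_exp]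
    simp
  · refine eq_zero_of_memLp_of_norm_eq h1 (s := Iic (-1)) measurableSet_Iic Real.volume_Iic
      fun x hx y => ?_
    rw [norm_neg, norm_mul, h.left x hx, norm_mul, Complex.norm_exp, Complex.norm_exp]
    simp

/-- With the source zero, nothing is radiated, so every mode vanishes for almost every `x`;
completeness of the modes in `y` then gives `W = 0`. -/
lemma IsDifference.ae_eq_zero (h : IsDifference p β ε μ W ℓ a b) (hβ : 0 < β)
    (hβ' : β < 1 / 2) (hμ : 0 < μ) (hμ' : μ < √(1 - 2 * β))
    (hu : IsUnit (1 - (ε : ℂ) • opT p β μ)) (hd : disp p β ε μ ≠ 0) :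
    ∀ᵐ q ∂stripMeasure, W q = 0 := by
  obtain ⟨A, hA1, hA2⟩ := h.exists_source hβ hβ' hμ hμ'
  have hA := eq_zero_of_disp_ne_zero hμ hu hd hA2
  have hr : ∀ n x, radiated p β ε μ n W x = 0 := fun n x => by
    have e : A n = 0 := by rw [hA]; rfl
    rw [← hA1, conv, e]
    simp [zeroExt]
  have hall := ae_all_iff.2 fun n => h.waveMode_ae_eq hβ hβ' hμ hμ' n
  have hcs : ∀ᵐ x, ∀ᵐ y ∂(volume.restrict (Ioo 0 (2 * π))), W (x, y) = 0 := by
    filter_upwards [hall, h.ae_memLp] with x h1 h2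
    exact ae_eq_zero_of_forall_mode (β := β) h2 fun n => (h1 n).trans (hr n x)
  have hm : AEStronglyMeasurable W stripMeasure := by
    have c1 := h.contDiff.continuous
    have := h.memLp.1.add (g := fun q : ℝ × ℝ => ℓ q.1 * Complex.exp (Complex.I * β * q.2))
      (Continuous.aestronglyMeasurable (by fun_prop))
    refine this.congr (Eventually.of_forall fun q => ?_)
    simp
  rw [stripMeasure_eq] at hm ⊢
  exact ae_prod_eq_zero hm hcs

/-- Uniqueness for the scattering problem. -/
lemma IsScatteringSolution.unique {u u' : ℝ × ℝ → ℂ} {r t r' t' : ℂ} (hβ : 0 < β)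
    (hβ' : β < 1 / 2) (hμ : 0 < μ) (hμ' : μ < √(1 - 2 * β))
    (hu : IsUnit (1 - (ε : ℂ) • opT p β μ)) (hd : disp p β ε μ ≠ 0)
    (h : IsScatteringSolution p β ε μ u r t) (h' : IsScatteringSolution p β ε μ u' r' t') :
    u =ᵐ[stripMeasure] u' ∧ r = r' ∧ t = t' := by
  have hs := h.sub h'
  have h0 := hs.ae_eq_zero hβ hβ' hμ hμ' hu hd
  obtain ⟨ht, hr⟩ := hs.coefficients_eq_zero h0
  refine ⟨?_, sub_eq_zero.1 hr, sub_eq_zero.1 ht⟩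
  filter_upwards [h0] with q hq
  exact sub_eq_zero.1 hq

end

end Scatter

end

theorem mainTheorem2 (p : Perturbation) (β : ℝ) (hβ : 0 < β) (hβ' : β < 1 / 2) :
    (∀ ε μ : ℝ, 0 < ε → 0 < μ → μ < √(1 - 2 * β) →
      IsUnit (1 - (ε : ℂ) • opT p β μ) → disp p β ε μ ≠ 0 →
      (∀ x y : ℝ, Summable fun n : ℤ =>
        psiComp p β ε μ n x * Complex.exp (Complex.I * n * y)) ∧
      IsClassicalSolution p β ε μ (psi p β ε μ) ∧
      IsScatteringSolution p β ε μ (psi p β ε μ) (reflCoeff p β ε μ) (transCoeff p β ε μ)) ∧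
    ∃ ε₀ > 0, ∃ μ₀ > 0, μ₀ ≤ √(1 - 2 * β) ∧
      ∀ ε μ : ℝ, 0 < ε → ε < ε₀ → 0 < μ → μ < μ₀ →
        IsUnit (1 - (ε : ℂ) • opT p β μ) ∧
        (p.coeffHat 1 (√(1 - 2 * β)) ≠ 0 ∨ p.coeffHat 1 (-√(1 - 2 * β)) ≠ 0 →
          disp p β ε μ ≠ 0 ∧
          IsScatteringSolution p β ε μ (psi p β ε μ) (reflCoeff p β ε μ) (transCoeff p β ε μ) ∧
          ∀ (u : ℝ × ℝ → ℂ) (r t : ℂ), IsScatteringSolution p β ε μ u r t →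
            u =ᵐ[stripMeasure] psi p β ε μ ∧ r = reflCoeff p β ε μ ∧ t = transCoeff p β ε μ) := by
  refine ⟨fun ε μ _ hμ hμ' hu hd => ⟨summable_psi hβ hβ' hμ hμ' hu hd,
    isClassicalSolution_psi hβ hβ' hμ hμ' hu hd, isScatteringSolution_psi hβ hβ' hμ hμ' hu hd⟩, ?_⟩
  obtain ⟨ε₀, hε₀, μ₀, hμ₀, hle, h⟩ := exists_isUnit_and_disp_ne_zero p hβ hβ'
  refine ⟨ε₀, hε₀, μ₀, hμ₀, hle, fun ε μ hε hε' hμ hμ' => ?_⟩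
  obtain ⟨hu, hd⟩ := h ε μ hε hε' hμ hμ'
  refine ⟨hu, fun hf => ?_⟩
  have hμ1 := hμ'.trans_le hle
  have hsol := isScatteringSolution_psi hβ hβ' hμ hμ1 hu (hd hf)
  exact ⟨hd hf, hsol, fun u r t hs => hs.unique hβ hβ' hμ hμ1 hu (hd hf) hsol⟩
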